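/- Let $(M,\omega)$ be a symplectic manifold of dimension $2m$ (smooth, Hausdorff, second countable, not necessarily compact). A \emph{Lagrangian field} $\Lambda=(E,\lambda)$ on $M$ is a smooth vector bundle $\pi:E\to M$ of rank $m$ with a surjective submersion $\lambda:E\to M$ such that $\lambda=\pi$ on the zero section and such that, for every $x\in M$, the restriction of $\lambda$ to the fiber $E_x$ is an embedding onto a Lagrangian submanifold $\Lambda_x:=\lambda(E_x)$ of $M$. Two Lagrangian fields $\Lambda=(E,\lambda)$ and $\tilde\Lambda=(\tilde E,\tilde\lambda)$ are \emph{transversal} if $\Lambda_x$ and $\tilde\Lambda_x$ intersect transversally at $x$ for every $x\in M$. A \emph{local Lie groupoid} $V\rightrightarrows M$ consists of manifolds $V$ and $M$, surjective submersions $s,t:V\to M$, an embedding $\epsilon:M\to V$ with $s\epsilon=t\epsilon=\mathrm{id}$, a smooth product $(\alpha,\beta)\mapsto\alpha\beta$ with $s(\alpha\beta)=s(\beta)$, $t(\alpha\beta)=t(\alpha)$, defined on a relatively open subset $D$ of $\{(\alpha,\beta)\mid s(\alpha)=t(\beta)\}$ which contains all pairs $(\epsilon(t(\alpha)),\alpha)$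 and $(\alpha,\epsilon(s(\alpha)))$, and a smooth involutive inverse $i$ which interchanges $s$ and $t$ and maps an open neighborhood $D_i$ of $\epsilon(M)$ in $V$ to itself, such that: units are neutral; for $\alpha\in D_i$ the products $\alpha\, i(\alpha)=\epsilon(t(\alpha))$ and $i(\alpha)\,\alpha=\epsilon(s(\alpha))$ are defined; and if $\alpha\beta$ and $\beta\gamma$ are defined, then $(\alpha\beta)\gamma$ is defined if and only if $\alpha(\beta\gamma)$ is, and then they are equal. It is a \emph{local symplectic groupoid} if $V$ carries a symplectic form for which $\epsilon(M)$ is Lagrangian, $i$ is an anti-symplectomorphism, and the set of $3$-cycles, that is, of triples $(\alpha,\beta,\gamma)$ for which $(\alpha\beta)\gamma$ is defined and is a unit, is a Lagrangian submanifold of $V^3$. \textbf{Theorem.} Let $\Lambda=(E,\lambda)$ and $\tilde\Lambda=(\tilde E,\tilde\lambda)$ be two transversal Lagrangian fields on $(M,\omega)$, with bundle projections $\pi$ and $\tilde\pi$. Let $\hat E=E\oplus\tilde E$, with bundle projection $\hat\pi$ and projections $\tau:\hat E\to E$, $\tilde\tau:\hat E\to\tilde E$. (1) There is a unique smooth horizontal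 1-form $\phi$ on $E$ (that is, $\phi$ annihilates $\ker d\pi$) which vanishes at all points of the zero section and satisfies $\lambda^*\omega-\pi^*\omega=d\phi$; likewise a unique such form $\tilde\phi$ on $\tilde E$ for $\tilde\lambda,\tilde\pi$. There is a unique fiberwise map $\chi:\hat E\to T^*M$ over $M$ such that $(d\hat\pi_p)^*\chi(p)=(\tilde\tau^*\tilde\phi-\tau^*\phi)(p)$ for all $p\in\hat E$. (2) Call an open neighborhood $W$ of the zero section of $\hat E$ \emph{admissible} if $\chi|_W$ is a diffeomorphism onto an open subset of $T^*M$ and $(\tilde\lambda\tilde\tau,\lambda\tau)|_W$ is a diffeomorphism onto an open subset of $M^2$. Every neighborhood of the zero section of $\hat E$ contains an admissible $W$, and $W$ can be chosen such that its image in $M^2$ is invariant under $(x,y)\mapsto(y,x)$. (3) Let $W$ be admissible and $V=\chi(W)$. Then $V$ is an open neighborhood of the zero section of $T^*M$, and there is a unique map $f:V\to M^2$ with $f\circ\chi|_W=(\tilde\lambda\tilde\tau,\lambda\tau)|_W$. It is a diffeomorphism onto an open subset of $M^2$, maps the zero covector at $x$ to $(x,x)$, and satisfies $f^*(\pi_2^*\omega-\pi_1^*\omega)=-d\theta$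 on $V$, where $\theta$ is the canonical 1-form of $T^*M$ and $\pi_1,\pi_2:M^2\to M$ are the projections. The manifold $V$ with the symplectic form $-d\theta$ is a local symplectic groupoid over $M$ with $s=\pi_2\circ f$, $t=\pi_1\circ f$ and with the zero section as unit map; here $\alpha\beta$ is defined exactly if $s(\alpha)=t(\beta)$ and $(t(\alpha),s(\beta))\in f(V)$, and the inverse is defined exactly on $\{\alpha\in V\mid (s(\alpha),t(\alpha))\in f(V)\}$ (hence on all of $V$ if $f(V)$ is invariant under $(x,y)\mapsto(y,x)$). Moreover $$s(T^*_xM\cap V)\subset\Lambda_x\quad\text{and}\quad t(T^*_xM\cap V)\subset\tilde\Lambda_x\qquad\text{for all }x\in M.$$ -/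

import Mathlib

open Set Bundle Topology
open scoped Manifold ContDiff

noncomputable section

/-! ### Differential forms on manifolds without boundary -/

section Forms

variable {EM : Type*} [NormedAddCommGroup EM] [NormedSpace ℝ EM]
  {H : Type*} [TopologicalSpace H] {I : ModelWithCorners ℝ EM H}
  {M : Type*} [TopologicalSpace M] [ChartedSpace H M]
  {EN : Type*} [NormedAddCommGroup EN] [NormedSpace ℝ EN]
  {H' : Type*} [TopologicalSpace H'] {J : ModelWithCorners ℝ EN H'}
  {N : Type*} [TopologicalSpace N] [ChartedSpace H' N]

/-- A (not necessarily smooth) real differential form of degree `k` on a manifold `M`. -/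
abbrev DiffForm (I : ModelWithCorners ℝ EM H) (M : Type*) [TopologicalSpace M] [ChartedSpace H M]
    (k : ℕ) :=
  ∀ x : M, (TangentSpace I x) [⋀^Fin k]→L[ℝ] ℝ

namespace DiffForm

/-- The pullback `f^* α` of a form along a (differentiable) map. -/
def pullback {k : ℕ} (f : N → M) (α : DiffForm I M k) : DiffForm J N k :=
  fun y => (α (f y)).compContinuousLinearMap (mfderiv J I f y)

/-- The form `α` written in the preferred chart at `x₀`: a form on the model vector space
(meaningful on the target of the chart). -/
def inChart {k : ℕ} (α : DiffForm I M k) (x₀ : M) : EM → EM [⋀^Fin k]→L[ℝ] ℝ :=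
  fun y => (α ((extChartAt I x₀).symm y)).compContinuousLinearMap
    (mfderiv 𝓘(ℝ, EM) I (extChartAt I x₀).symm y)

/-- A form is smooth on the open set `V` if its coefficients in the charts are smooth there. -/
def SmoothOn {k : ℕ} (α : DiffForm I M k) (V : Set M) : Prop :=
  ∀ x₀ : M, ContDiffOn ℝ ∞ (α.inChart x₀)
    ((extChartAt I x₀).target ∩ (extChartAt I x₀).symm ⁻¹' V)

/-- The exterior derivative of a form, computed at `x` in the preferred chart at `x`. -/
def extD {k : ℕ} (α : DiffForm I M k) : DiffForm I M (k + 1) :=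
  fun x => (extDeriv (α.inChart x) (extChartAt I x x)).compContinuousLinearMap
    (mfderiv I 𝓘(ℝ, EM) (extChartAt I x) x)

/-- `om` restricts to a symplectic form on the open set `V`: smooth, closed, nondegenerate. -/
structure IsSymplecticOn (om : DiffForm I M 2) (V : Set M) : Prop where
  smooth : om.SmoothOn V
  closed : ∀ x ∈ V, om.extD x = 0
  nondegenerate : ∀ x ∈ V, ∀ v : TangentSpace I x,
    (∀ w : TangentSpace I x, om x ![v, w] = 0) → v = 0

/-- The sum `pr₁^* Ω + pr₂^* Ω + pr₃^* Ω` on the triple product. -/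
def triple (Ω : DiffForm I M 2) : DiffForm (I.prod (I.prod I)) (M × M × M) 2 :=
  Ω.pullback (fun p : M × M × M => p.1) + Ω.pullback (fun p : M × M × M => p.2.1) +
    Ω.pullback (fun p : M × M × M => p.2.2)

/-- The form `pr₂^* om - pr₁^* om` on `M × M`. -/
def pairForm (om : DiffForm I M 2) : DiffForm (I.prod I) (M × M) 2 :=
  om.pullback (fun p : M × M => p.2) - om.pullback (fun p : M × M => p.1)

/-- `S` is an (embedded) Lagrangian submanifold of `(M, om)`: locally it is the image of a smooth
embedding of an open subset of `ℝ^k` along which `om` vanishes, where `2 k = dim M`. -/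
def IsLagrangian (om : DiffForm I M 2) (S : Set M) : Prop :=
  ∃ k : ℕ, Module.finrank ℝ EM = 2 * k ∧ ∀ p ∈ S,
    ∃ (O : Set M) (U : Set (EuclideanSpace ℝ (Fin k))) (g : EuclideanSpace ℝ (Fin k) → M),
      IsOpen O ∧ p ∈ O ∧ IsOpen U ∧ g '' U = S ∩ O ∧
      ContMDiffOn 𝓘(ℝ, EuclideanSpace ℝ (Fin k)) I ∞ g U ∧
      IsEmbedding (U.domRestrict g) ∧
      ∀ u ∈ U, Function.Injective (mfderiv 𝓘(ℝ, EuclideanSpace ℝ (Fin k)) I g u) ∧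
        om.pullback (J := 𝓘(ℝ, EuclideanSpace ℝ (Fin k))) g u = 0

end DiffForm

/-- `f` restricts to a diffeomorphism of `W` (an open set) onto an open set `f '' W`. -/
def IsDiffeoOntoOpen (J : ModelWithCorners ℝ EN H') (I : ModelWithCorners ℝ EM H)
    (f : N → M) (W : Set N) : Prop :=
  IsOpen W ∧ IsOpen (f '' W) ∧ ContMDiffOn J I ∞ f W ∧
    ∃ g : M → N, ContMDiffOn I J ∞ g (f '' W) ∧ ∀ z ∈ W, g (f z) = z

end Forms

/-! ### Local Lie groupoids and local symplectic groupoids -/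

section Groupoids

variable {EM : Type*} [NormedAddCommGroup EM] [NormedSpace ℝ EM]
  {H : Type*} [TopologicalSpace H]
  {EP : Type*} [NormedAddCommGroup EP] [NormedSpace ℝ EP]
  {H' : Type*} [TopologicalSpace H']

/-- A local Lie groupoid `V ⇉ M` whose manifold of arrows is an open subset `V` of a manifold `P`.
An arrow `α` goes from `s α` to `t α`; the product `mul (α, β)` is only defined for those pairs
with `s α = t β` which lie in the relatively open set `mulDom` (which contains all pairs one of
whose members is a unit), and the inverse is defined on an open neighbourhood `invDom` of the
units. The values of the structure maps outside of their domains are irrelevant. -/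
structure LocalLieGroupoid (I : ModelWithCorners ℝ EM H)
    (M : Type*) [TopologicalSpace M] [ChartedSpace H M]
    (J : ModelWithCorners ℝ EP H') {P : Type*} [TopologicalSpace P] [ChartedSpace H' P]
    (V : Set P) where
  s : P → M
  t : P → M
  unit : M → P
  mul : P × P → P
  inv : P → P
  mulDom : Set (P × P)
  invDom : Set P
  isOpen_arrows : IsOpen V
  -- source and target are surjective submersions
  smooth_s : ContMDiffOn J I ∞ s V
  smooth_t : ContMDiffOn J I ∞ t V
  surj_s : s '' V = univ
  surj_t : t '' V = univ
  submersion_s : ∀ α ∈ V, Function.Surjective (mfderiv J I s α)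
  submersion_t : ∀ α ∈ V, Function.Surjective (mfderiv J I t α)
  -- the unit map is an embedding
  unit_mem : ∀ x, unit x ∈ V
  smooth_unit : ContMDiff I J ∞ unit
  embedding_unit : IsEmbedding unit
  immersion_unit : ∀ x, Function.Injective (mfderiv I J unit x)
  s_unit : ∀ x, s (unit x) = x
  t_unit : ∀ x, t (unit x) = x
  -- the product
  mulDom_eq : ∃ O : Set (P × P), IsOpen O ∧
    mulDom = {p | p.1 ∈ V ∧ p.2 ∈ V ∧ s p.1 = t p.2} ∩ O
  smooth_mul : ContMDiffOn (J.prod J) J ∞ mul mulDom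
  mul_mem : ∀ p ∈ mulDom, mul p ∈ V
  s_mul : ∀ p ∈ mulDom, s (mul p) = s p.2
  t_mul : ∀ p ∈ mulDom, t (mul p) = t p.1
  unit_mul : ∀ α ∈ V, (unit (t α), α) ∈ mulDom ∧ mul (unit (t α), α) = α
  mul_unit : ∀ α ∈ V, (α, unit (s α)) ∈ mulDom ∧ mul (α, unit (s α)) = α
  assoc_dom : ∀ α β γ, (α, β) ∈ mulDom → (β, γ) ∈ mulDom →
    ((mul (α, β), γ) ∈ mulDom ↔ (α, mul (β, γ)) ∈ mulDom)
  assoc : ∀ α β γ, (α, β) ∈ mulDom → (β, γ) ∈ mulDom → (mul (α, β), γ) ∈ mulDom →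
    mul (mul (α, β), γ) = mul (α, mul (β, γ))
  -- the inverse
  isOpen_invDom : IsOpen invDom
  invDom_subset : invDom ⊆ V
  unit_mem_invDom : ∀ x, unit x ∈ invDom
  smooth_inv : ContMDiffOn J J ∞ inv invDom
  inv_mem : ∀ α ∈ invDom, inv α ∈ invDom
  inv_inv : ∀ α ∈ invDom, inv (inv α) = α
  s_inv : ∀ α ∈ invDom, s (inv α) = t α
  t_inv : ∀ α ∈ invDom, t (inv α) = s α
  mul_inv : ∀ α ∈ invDom, (α, inv α) ∈ mulDom ∧ mul (α, inv α) = unit (t α)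
  inv_mul : ∀ α ∈ invDom, (inv α, α) ∈ mulDom ∧ mul (inv α, α) = unit (s α)

/-- The set of 3-cycles: triples whose product `α β γ` is defined and is a unit. -/
def LocalLieGroupoid.threeCycles {I : ModelWithCorners ℝ EM H}
    {M : Type*} [TopologicalSpace M] [ChartedSpace H M]
    {J : ModelWithCorners ℝ EP H'} {P : Type*} [TopologicalSpace P] [ChartedSpace H' P]
    {V : Set P} (G : LocalLieGroupoid I M J V) : Set (P × P × P) :=
  {p | (p.1, p.2.1) ∈ G.mulDom ∧ (G.mul (p.1, p.2.1), p.2.2) ∈ G.mulDom ∧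
    G.mul (G.mul (p.1, p.2.1), p.2.2) = G.unit (G.t p.1)}

/-- A local symplectic groupoid `(V, Ω) ⇉ M`: a local Lie groupoid with a symplectic form `Ω` on
the manifold `V` of arrows such that the space of units is Lagrangian, the inverse is an
anti-symplectomorphism and the set of 3-cycles is a Lagrangian submanifold of `V × V × V`. -/
structure LocalSymplecticGroupoid (I : ModelWithCorners ℝ EM H)
    (M : Type*) [TopologicalSpace M] [ChartedSpace H M]
    {J : ModelWithCorners ℝ EP H'} {P : Type*} [TopologicalSpace P] [ChartedSpace H' P]
    (Ω : DiffForm J P 2) (V : Set P) extends LocalLieGroupoid I M J V where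
  symplectic : Ω.IsSymplecticOn V
  lagrangian_units : Ω.IsLagrangian (range unit)
  antisymplectic_inv : ∀ α ∈ invDom, Ω.pullback (J := J) inv α = - Ω α
  lagrangian_threeCycles : Ω.triple.IsLagrangian toLocalLieGroupoid.threeCycles

end Groupoids

/-! ### The cotangent bundle -/

section Cotangent

variable {EM : Type*} [NormedAddCommGroup EM] [NormedSpace ℝ EM]

/-- The cotangent bundle `T^*M`. -/
abbrev CotangentBundle (EM : Type*) [NormedAddCommGroup EM] [NormedSpace ℝ EM]
    (M : Type*) [TopologicalSpace M] [ChartedSpace EM M] :=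
  TotalSpace (EM →L[ℝ] ℝ) (fun x : M => TangentSpace 𝓘(ℝ, EM) x →L[ℝ] ℝ)

/-- The model with corners of `T^*M`. -/
abbrev cotangentModel (EM : Type*) [NormedAddCommGroup EM] [NormedSpace ℝ EM] :=
  𝓘(ℝ, EM).prod 𝓘(ℝ, EM →L[ℝ] ℝ)

variable (M : Type*) [TopologicalSpace M] [ChartedSpace EM M] [IsManifold 𝓘(ℝ, EM) ∞ M]

/-- The canonical 1-form `θ` on `T^*M`: `θ_ξ (v) = ξ (dπ v)`. -/
def canonicalOneForm : DiffForm (cotangentModel EM) (CotangentBundle EM M) 1 :=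
  fun ξ => ContinuousAlternatingMap.ofSubsingleton ℝ _ ℝ (0 : Fin 1)
    (ξ.2.comp (mfderiv (cotangentModel EM) 𝓘(ℝ, EM)
      (TotalSpace.proj : CotangentBundle EM M → M) ξ))

/-- The canonical symplectic form `-dθ` on `T^*M`. -/
def canonicalSymplecticForm : DiffForm (cotangentModel EM) (CotangentBundle EM M) 2 :=
  - (canonicalOneForm M).extD

end Cotangent

/-! ### Lagrangian fields -/

section LagrangianFields

variable {EM : Type*} [NormedAddCommGroup EM] [NormedSpace ℝ EM]
  {M : Type*} [TopologicalSpace M] [ChartedSpace EM M]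
  {F : Type*} [NormedAddCommGroup F] [NormedSpace ℝ F]
  {E : M → Type*} [∀ x, AddCommGroup (E x)] [∀ x, Module ℝ (E x)] [∀ x, TopologicalSpace (E x)]
  [TopologicalSpace (TotalSpace F E)] [FiberBundle F E] [VectorBundle ℝ F E]
  {F' : Type*} [NormedAddCommGroup F'] [NormedSpace ℝ F']
  {E' : M → Type*} [∀ x, AddCommGroup (E' x)] [∀ x, Module ℝ (E' x)]
  [∀ x, TopologicalSpace (E' x)]
  [TopologicalSpace (TotalSpace F' E')] [FiberBundle F' E'] [VectorBundle ℝ F' E']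

/-- The linear identification of the typical fiber `F` with the fiber `E x`. -/
def fiberEquiv (F : Type*) [NormedAddCommGroup F] [NormedSpace ℝ F]
    (E : M → Type*) [∀ x, AddCommGroup (E x)] [∀ x, Module ℝ (E x)]
    [∀ x, TopologicalSpace (E x)]
    [TopologicalSpace (TotalSpace F E)] [FiberBundle F E] [VectorBundle ℝ F E] (x : M) :
    F ≃L[ℝ] E x :=
  ((trivializationAt F E x).continuousLinearEquivAt ℝ x
    (mem_baseSet_trivializationAt F E x)).symm

/-- A Lagrangian field `Λ = (E, lam)` on `(M, om)`, `dim M = 2 m`: a smooth vector bundle `E` of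
rank `m` with a surjective submersion `lam : E → M` which is the projection on the zero section,
and whose restriction to each fiber (identified with `F` by a linear isomorphism) is an embedding
onto a Lagrangian submanifold of `M`. -/
structure LagrangianField (om : DiffForm 𝓘(ℝ, EM) M 2)
    (F : Type*) [NormedAddCommGroup F] [NormedSpace ℝ F]
    (E : M → Type*) [∀ x, AddCommGroup (E x)] [∀ x, Module ℝ (E x)]
    [∀ x, TopologicalSpace (E x)]
    [TopologicalSpace (TotalSpace F E)] [FiberBundle F E] [VectorBundle ℝ F E] where
  lam : TotalSpace F E → M
  rank : Module.finrank ℝ EM = 2 * Module.finrank ℝ F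
  smooth : ContMDiff (𝓘(ℝ, EM).prod 𝓘(ℝ, F)) 𝓘(ℝ, EM) ∞ lam
  surjective : Function.Surjective lam
  submersion : ∀ z, Function.Surjective (mfderiv (𝓘(ℝ, EM).prod 𝓘(ℝ, F)) 𝓘(ℝ, EM) lam z)
  zero : ∀ x, lam ⟨x, 0⟩ = x
  embedding : ∀ x, IsEmbedding (fun w : F => lam ⟨x, fiberEquiv F E x w⟩)
  immersion : ∀ x w, Function.Injective
    (mfderiv 𝓘(ℝ, F) 𝓘(ℝ, EM) (fun w : F => lam ⟨x, fiberEquiv F E x w⟩) w)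
  isotropic : ∀ x w,
    om.pullback (J := 𝓘(ℝ, F)) (fun w : F => lam ⟨x, fiberEquiv F E x w⟩) w = 0

namespace LagrangianField

variable {om : DiffForm 𝓘(ℝ, EM) M 2}

/-- The Lagrangian submanifold `Λ_x = lam (E_x)`. -/
def leaf (Λ : LagrangianField om F E) (x : M) : Set M :=
  range (fun v : E x => Λ.lam ⟨x, v⟩)

/-- The tangent space at `x` of the Lagrangian submanifold `Λ_x`. (`lam` maps `0 ∈ E_x` to `x`.) -/
def tangentAt (Λ : LagrangianField om F E) (x : M) : Submodule ℝ (TangentSpace 𝓘(ℝ, EM) x) :=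
  LinearMap.range (M₂ := TangentSpace 𝓘(ℝ, EM) x) (mfderiv 𝓘(ℝ, F) 𝓘(ℝ, EM)
    (fun w : F => Λ.lam ⟨x, fiberEquiv F E x w⟩) 0).toLinearMap

/-- `Λ_x` and `Λ'_x` intersect transversally at `x`, for all `x`. -/
def Transversal (Λ : LagrangianField om F E) (Λ' : LagrangianField om F' E') : Prop :=
  ∀ x, Λ.tangentAt x ⊔ Λ'.tangentAt x = ⊤

/-- `φ` is a smooth horizontal 1-form on `E` which vanishes at the points of the zero section and
satisfies `lam^* om - π^* om = dφ`. -/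
structure IsHorizontalPrimitive (Λ : LagrangianField om F E)
    (φ : DiffForm (𝓘(ℝ, EM).prod 𝓘(ℝ, F)) (TotalSpace F E) 1) : Prop where
  smooth : φ.SmoothOn univ
  horizontal : ∀ (z : TotalSpace F E) (v : TangentSpace (𝓘(ℝ, EM).prod 𝓘(ℝ, F)) z),
    mfderiv (𝓘(ℝ, EM).prod 𝓘(ℝ, F)) 𝓘(ℝ, EM) (TotalSpace.proj : TotalSpace F E → M) z v = 0 →
      φ z ![v] = 0
  zero : ∀ x, φ ⟨x, 0⟩ = 0
  eq_d : om.pullback Λ.lam - om.pullback (TotalSpace.proj : TotalSpace F E → M) = φ.extD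

end LagrangianField

/-- The projection `τ : E ⊕ E' → E`. -/
def sumFst (F : Type*) (E : M → Type*) (F' : Type*) (E' : M → Type*)
    (p : TotalSpace (F × F') (E ×ᵇ E')) : TotalSpace F E :=
  ⟨p.proj, p.2.1⟩

/-- The projection `τ' : E ⊕ E' → E'`. -/
def sumSnd (F : Type*) (E : M → Type*) (F' : Type*) (E' : M → Type*)
    (p : TotalSpace (F × F') (E ×ᵇ E')) : TotalSpace F' E' :=
  ⟨p.proj, p.2.2⟩

/-- The family of covectors `c p ∈ T^*_{π p} M`, `p ∈ E ⊕ E'`, represents the horizontal 1-form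
`τ'^* φ' - τ^* φ`: the pullback of `c p` by the bundle projection is the value of the form
at `p`. -/
def RepresentsDifference
    (φ : DiffForm (𝓘(ℝ, EM).prod 𝓘(ℝ, F)) (TotalSpace F E) 1)
    (φ' : DiffForm (𝓘(ℝ, EM).prod 𝓘(ℝ, F')) (TotalSpace F' E') 1)
    (c : ∀ p : TotalSpace (F × F') (E ×ᵇ E'), TangentSpace 𝓘(ℝ, EM) p.proj →L[ℝ] ℝ) : Prop :=
  ∀ (p : TotalSpace (F × F') (E ×ᵇ E'))
    (v : TangentSpace (𝓘(ℝ, EM).prod 𝓘(ℝ, F × F')) p),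
    c p (mfderiv (𝓘(ℝ, EM).prod 𝓘(ℝ, F × F')) 𝓘(ℝ, EM)
        (TotalSpace.proj : TotalSpace (F × F') (E ×ᵇ E') → M) p v) =
      (φ'.pullback (J := 𝓘(ℝ, EM).prod 𝓘(ℝ, F × F')) (sumSnd F E F' E') -
        φ.pullback (J := 𝓘(ℝ, EM).prod 𝓘(ℝ, F × F')) (sumFst F E F' E')) p ![v]

/-- The fiberwise map `χ : E ⊕ E' → T^*M` given by a family of covectors. -/
def covectorMap
    (c : ∀ p : TotalSpace (F × F') (E ×ᵇ E'), TangentSpace 𝓘(ℝ, EM) p.proj →L[ℝ] ℝ)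
    (p : TotalSpace (F × F') (E ×ᵇ E')) : CotangentBundle EM M :=
  ⟨p.proj, c p⟩

/-- The map `(z, z') ↦ (lam' z', lam z)` from `E ⊕ E'` to `M × M`. -/
def endpointMap {om : DiffForm 𝓘(ℝ, EM) M 2}
    (Λ : LagrangianField om F E) (Λ' : LagrangianField om F' E')
    (p : TotalSpace (F × F') (E ×ᵇ E')) : M × M :=
  (Λ'.lam (sumSnd F E F' E' p), Λ.lam (sumFst F E F' E' p))

/-- `W` is an open neighbourhood of the zero section of `E ⊕ E'` which both `χ` and
`(z, z') ↦ (lam' z', lam z)` map diffeomorphically onto open sets (necessarily neighbourhoods of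
the zero section of `T^*M` and of the diagonal of `M × M`, respectively). -/
structure IsAdmissible [IsManifold 𝓘(ℝ, EM) ∞ M] {om : DiffForm 𝓘(ℝ, EM) M 2}
    (Λ : LagrangianField om F E) (Λ' : LagrangianField om F' E')
    (χ : TotalSpace (F × F') (E ×ᵇ E') → CotangentBundle EM M)
    (W : Set (TotalSpace (F × F') (E ×ᵇ E'))) : Prop where
  isOpen : IsOpen W
  zero_mem : ∀ x : M, (⟨x, 0⟩ : TotalSpace (F × F') (E ×ᵇ E')) ∈ W
  diffeo_chi : IsDiffeoOntoOpen (𝓘(ℝ, EM).prod 𝓘(ℝ, F × F')) (cotangentModel EM) χ W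
  diffeo_endpoint : IsDiffeoOntoOpen (𝓘(ℝ, EM).prod 𝓘(ℝ, F × F')) (𝓘(ℝ, EM).prod 𝓘(ℝ, EM))
    (endpointMap Λ Λ') W

end LagrangianFields

end

set_option linter.unusedSectionVars false

/-! ### Smoothness of families of alternating forms -/

section AlternatingSmooth

variable {X : Type*} [NormedAddCommGroup X] [NormedSpace ℝ X]
  {E : Type*} [NormedAddCommGroup E] [NormedSpace ℝ E] [FiniteDimensional ℝ E]
  {E' : Type*} [NormedAddCommGroup E'] [NormedSpace ℝ E'] {k : ℕ} {n : ℕ∞ω}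

/-! Write `β = λ^*ω - π^*ω` on `E`. It is closed. It vanishes on each fiber, where `λ` is isotropic
and `π` is constant, and its pullback to the zero section vanishes, because `λ` and `π` agree there.
Fiberwise scaling `h_t` contracts `E` onto the zero section, so the radial homotopy operator, which
integrates over `t` the contraction of `β` with the velocity of `h_t`, yields `φ` with `dφ = h_1^*β
- h_0^*β = β` (`extD_fiberPrimitive`). On a vertical vector the integrand is `β` of two vertical
vectors, hence `φ` is horizontal; on the zero section the velocity is zero, hence so is `φ`.
Conversely, a closed horizontal 1-form has coefficients that are constant along rays, so it is
determined by its values on the zero section (`eq_zero_of_horizontal_of_extD_eq_zero`). This settles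
existence and uniqueness in (1).

A horizontal 1-form on a bundle over `M` is the same thing as a fiberwise map to `T^*M`, and it is
the pullback of `θ` by that map. Applied to `τ'^*φ' - τ^*φ` on `E ⊕ E'` this gives `χ`. Let `F =
(λ'τ', λτ)` be the endpoint map. In the differential of `τ'^*φ' - τ^*φ` the two terms with the
bundle projections cancel, and what remains is the central identity `χ^*(-dθ) = F^*(π₂^*ω - π₁^*ω)`
(`pullback_canonicalSymplecticForm`).

Along the zero section the derivative of `F` sends a vector with base part `v` and fiber parts `a`,
`b` to `(v + A' b, v + A a)`, where `A`, `A'` are the derivatives of `λ`, `λ'` in the fibers.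
Transversality and a dimension count make it bijective. No computation is needed for `χ`: a vector
killed by `dχ` lies in the radical of `F^*(π₂^*ω - π₁^*ω)`, which is zero where `dF` is bijective
(`mfderiv_covectorMap_zero_bijective`). The inverse function theorem makes both maps local
diffeomorphisms near the zero section. Both are injective on a whole neighborhood of it because a
retraction onto the zero section factors through each of them (`exists_isOpen_injOn`). This gives
(2).

For (3), `f = F ∘ (χ|W)⁻¹` is a symplectic diffeomorphism onto an open neighborhood of the diagonal
in `M × M` with the form `π₂^*ω - π₁^*ω`. The groupoid on `χ(W)` is the pair groupoid transported by
`f`, with products and inverses defined whenever the result stays in `f(V)`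
(`PairChart.symplecticGroupoid`). Units correspond to the diagonal and 3-cycles to triples
`((x,y),(y,z),(z,x))`. On both, the form cancels term by term, and each is the image of a map with a
smooth left inverse and of half the ambient dimension (`DiffForm.isLagrangian_of_leftInverse`). -/

theorem ContinuousAlternatingMap.finiteDimensional_real :
    FiniteDimensional ℝ (E [⋀^Fin k]→L[ℝ] ℝ) := by
  let L : (E [⋀^Fin k]→L[ℝ] ℝ) →ₗ[ℝ] MultilinearMap ℝ (fun _ : Fin k => E) ℝ :=
    { toFun := fun m => m.toMultilinearMap
      map_add' := fun _ _ => rfl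
      map_smul' := fun _ _ => rfl }
  refine FiniteDimensional.of_injective L ?_
  intro a b h
  ext v
  exact congrArg (fun m : MultilinearMap ℝ (fun _ : Fin k => E) ℝ => m v) h

/-- An alternating form is determined by its values on tuples of basis vectors. Evaluation on these
tuples is an injective linear map into a finite-dimensional space, so it has a linear left inverse,
automatically continuous, which recovers the form smoothly from finitely many scalar functions. -/
theorem contDiffWithinAt_alternating_iff {om : X → E [⋀^Fin k]→L[ℝ] ℝ} {s : Set X} {x : X} :
    ContDiffWithinAt ℝ n om s x ↔ ∀ v, ContDiffWithinAt ℝ n (fun y => om y v) s x := by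
  constructor
  · intro h v
    exact ((ContinuousAlternatingMap.apply ℝ E ℝ v).contDiff.contDiffAt).comp_contDiffWithinAt x h
  · intro h
    have := ContinuousAlternatingMap.finiteDimensional_real (E := E) (k := k)
    let b := Module.finBasis ℝ E
    let L : (E [⋀^Fin k]→L[ℝ] ℝ) →ₗ[ℝ] ((Fin k → Fin (Module.finrank ℝ E)) → ℝ) :=
      LinearMap.pi fun j => (ContinuousAlternatingMap.apply ℝ E ℝ (fun i => b (j i))).toLinearMap
    have hL : Function.Injective L := by
      intro a c hac
      have : a.toMultilinearMap = c.toMultilinearMap :=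
        Module.Basis.ext_multilinear (fun _ => b) fun j => congrFun hac j
      ext v
      exact congrArg (fun m : MultilinearMap ℝ (fun _ : Fin k => E) ℝ => m v) this
    obtain ⟨R, hR⟩ := LinearMap.exists_leftInverse_of_injective L (LinearMap.ker_eq_bot.2 hL)
    have h2 : ContDiffWithinAt ℝ n (fun y => L (om y)) s x :=
      contDiffWithinAt_pi.2 fun j => h _
    have h3 := (R.toContinuousLinearMap.contDiff.contDiffAt (n := n)).comp_contDiffWithinAt x h2
    refine h3.congr_of_eventuallyEq (Filter.Eventually.of_forall fun y => ?_) ?_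
    · exact (congrArg (fun l => l (om y)) hR).symm
    · exact (congrArg (fun l => l (om x)) hR).symm

theorem contDiffAt_alternating_iff {om : X → E [⋀^Fin k]→L[ℝ] ℝ} {x : X} :
    ContDiffAt ℝ n om x ↔ ∀ v, ContDiffAt ℝ n (fun y => om y v) x := by
  simp only [← contDiffWithinAt_univ]
  exact contDiffWithinAt_alternating_iff

theorem ContDiffAt.alternating_compContinuousLinearMap
    {om : X → E' [⋀^Fin k]→L[ℝ] ℝ} {g : X → E →L[ℝ] E'} {x : X}
    (hom : ContDiffAt ℝ n om x) (hg : ContDiffAt ℝ n g x) :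
    ContDiffAt ℝ n (fun y => (om y).compContinuousLinearMap (g y)) x := by
  rw [contDiffAt_alternating_iff]
  intro v
  have h1 : ContDiffAt ℝ n (fun y => (om y).toContinuousMultilinearMap) x :=
    ((ContinuousAlternatingMap.toContinuousMultilinearMapCLM (E := E') (F := ℝ) (ι := Fin k) ℝ
      (𝕜 := ℝ)).contDiff.contDiffAt).comp x hom
  -- Precomposition with `g` is a continuous multilinear expression in `k` copies of `g`, so it
  -- depends smoothly on `g`.
  have h2 : ContDiffAt ℝ n (fun y => ContinuousMultilinearMap.compContinuousLinearMapContinuousMultilinear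
      ℝ (fun _ : Fin k => E) (fun _ : Fin k => E') ℝ (fun _ => g y)) x :=
    (ContinuousMultilinearMap.contDiff _).contDiffAt.comp x (contDiffAt_pi.2 fun _ => hg)
  exact ((ContinuousMultilinearMap.apply ℝ (fun _ : Fin k => E) ℝ v).contDiff.contDiffAt).comp x
    (h2.clm_apply h1)

end AlternatingSmooth

/-! ### Calculus of forms on boundaryless manifolds -/

section FormCalculus

variable {EM : Type*} [NormedAddCommGroup EM] [NormedSpace ℝ EM]
  {H : Type*} [TopologicalSpace H] {I : ModelWithCorners ℝ EM H}
  {M : Type*} [TopologicalSpace M] [ChartedSpace H M]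
  {EN : Type*} [NormedAddCommGroup EN] [NormedSpace ℝ EN]
  {H' : Type*} [TopologicalSpace H'] {J : ModelWithCorners ℝ EN H'}
  {N : Type*} [TopologicalSpace N] [ChartedSpace H' N]
  {EQ : Type*} [NormedAddCommGroup EQ] [NormedSpace ℝ EQ]
  {H'' : Type*} [TopologicalSpace H''] {K : ModelWithCorners ℝ EQ H''}
  {Q : Type*} [TopologicalSpace Q] [ChartedSpace H'' Q]

theorem minSmoothness_two_le : minSmoothness ℝ 2 ≤ ∞ := by
  simp only [minSmoothness_of_isRCLikeNormedField]
  exact ENat.LEInfty.out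

theorem mdifferentiableAt_extChartAt_symm [I.Boundaryless] [IsManifold I ∞ M] {x₀ : M} {y : EM}
    (hy : y ∈ (extChartAt I x₀).target) :
    MDifferentiableAt 𝓘(ℝ, EM) I (extChartAt I x₀).symm y :=
  ((contMDiffOn_extChartAt_symm (n := ∞) x₀).contMDiffAt
    ((isOpen_extChartAt_target x₀).mem_nhds hy)).mdifferentiableAt (by simp)

theorem contMDiffAt_extChartAt_symm [I.Boundaryless] [IsManifold I ∞ M] {x₀ : M} {y : EM}
    (hy : y ∈ (extChartAt I x₀).target) :
    ContMDiffAt 𝓘(ℝ, EM) I ∞ (extChartAt I x₀).symm y :=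
  (contMDiffOn_extChartAt_symm (n := ∞) x₀).contMDiffAt
    ((isOpen_extChartAt_target x₀).mem_nhds hy)

theorem mdifferentiableAt_extChartAt_of_mem [IsManifold I ∞ M] {x₀ x : M}
    (hx : x ∈ (extChartAt I x₀).source) :
    MDifferentiableAt I 𝓘(ℝ, EM) (extChartAt I x₀) x := by
  have : IsManifold I 1 M := IsManifold.of_le (n := ∞) (by simp)
  exact mdifferentiableAt_extChartAt (by simpa using hx)

theorem mfderiv_extChartAt_symm_comp [I.Boundaryless] [IsManifold I ∞ M] {x₀ x : M}
    (hx : x ∈ (extChartAt I x₀).source) (v : TangentSpace I x) :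
    mfderiv 𝓘(ℝ, EM) I (extChartAt I x₀).symm (extChartAt I x₀ x)
      (mfderiv I 𝓘(ℝ, EM) (extChartAt I x₀) x v) = v := by
  have : IsManifold I 1 M := IsManifold.of_le (n := ∞) (by simp)
  have h := mfderivWithin_extChartAt_symm_comp_mfderiv_extChartAt' (I := I) hx
  rw [I.range_eq_univ, mfderivWithin_univ] at h
  exact congrArg (fun l => l v) h

theorem mfderiv_extChartAt_comp_symm [I.Boundaryless] [IsManifold I ∞ M] {x₀ : M} {y : EM}
    (hy : y ∈ (extChartAt I x₀).target) (v : EM) :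
    mfderiv I 𝓘(ℝ, EM) (extChartAt I x₀) ((extChartAt I x₀).symm y)
      (mfderiv 𝓘(ℝ, EM) I (extChartAt I x₀).symm y v) = v := by
  have : IsManifold I 1 M := IsManifold.of_le (n := ∞) (by simp)
  have h := mfderiv_extChartAt_comp_mfderivWithin_extChartAt_symm (I := I) hy
  rw [I.range_eq_univ, mfderivWithin_univ] at h
  exact congrArg (fun l => l v) h

namespace DiffForm

theorem pullback_apply {k : ℕ} (f : N → M) (α : DiffForm I M k) (y : N)
    (v : Fin k → TangentSpace J y) :
    α.pullback (J := J) f y v = α (f y) (fun i => mfderiv J I f y (v i)) := rfl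

theorem pullback_add {k : ℕ} (f : N → M) (α β : DiffForm I M k) :
    (α + β).pullback (J := J) f = α.pullback f + β.pullback f := rfl

theorem pullback_sub {k : ℕ} (f : N → M) (α β : DiffForm I M k) :
    (α - β).pullback (J := J) f = α.pullback f - β.pullback f := rfl

theorem pullback_neg {k : ℕ} (f : N → M) (α : DiffForm I M k) :
    (-α).pullback (J := J) f = -α.pullback f := rfl

theorem pullback_pullback {k : ℕ} {f : N → M} {g : Q → N} (α : DiffForm I M k) {q : Q}
    (hf : MDifferentiableAt J I f (g q)) (hg : MDifferentiableAt K J g q) :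
    (α.pullback (J := J) f).pullback (J := K) g q = α.pullback (J := K) (f ∘ g) q := by
  ext v
  simp only [pullback_apply]
  rw [mfderiv_comp q hf hg]
  rfl

theorem pullback_congr {k : ℕ} {f g : N → M} (α : DiffForm I M k) {y : N} (h : f =ᶠ[𝓝 y] g) :
    α.pullback (J := J) f y = α.pullback (J := J) g y := by
  have h1 := h.mfderiv_eq (I := J) (I' := I)
  have h2 := h.self_of_nhds
  ext v
  simp only [pullback_apply]
  rw [h1]
  revert h2
  generalize f y = a
  generalize g y = b
  rintro rfl
  rfl

theorem pullback_eq_of_eq {k : ℕ} {f : N → M} {α β : DiffForm I M k} {y : N}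
    (h : α (f y) = β (f y)) : α.pullback (J := J) f y = β.pullback (J := J) f y := by
  simp only [pullback, h]

theorem pullback_id {k : ℕ} (α : DiffForm I M k) (x : M) :
    α.pullback (J := I) id x = α x := by
  ext v
  simp only [pullback_apply, mfderiv_id]
  rfl

theorem inChart_eq_pullback {k : ℕ} (α : DiffForm I M k) (x₀ : M) :
    α.inChart x₀ = α.pullback (J := 𝓘(ℝ, EM)) (extChartAt I x₀).symm := rfl

theorem eq_inChart_comp {k : ℕ} [I.Boundaryless] [IsManifold I ∞ M] (α : DiffForm I M k) {x₀ x : M}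
    (hx : x ∈ (extChartAt I x₀).source) (v : Fin k → TangentSpace I x) :
    α.inChart x₀ (extChartAt I x₀ x) (fun i => mfderiv I 𝓘(ℝ, EM) (extChartAt I x₀) x (v i)) =
      α x v := by
  -- The point `symm (extChartAt x)` equals `x` only propositionally, so the tangent space is
  -- generalized along with the point before substituting.
  have h : ∀ x', x' = x → ∀ w : Fin k → EM, (∀ i, w i = v i) → α x' w = α x v := by
    rintro x' rfl w hw
    congr 1
    funext i
    exact hw i
  refine h _ ((extChartAt I x₀).left_inv hx) _ fun i => ?_
  exact mfderiv_extChartAt_symm_comp hx (v i)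

/-- The chain rule in charts. It replaces `mfderiv` by the `fderiv` of the local representative, so
that calculus of forms on vector spaces applies. -/
theorem inChart_pullback {k : ℕ} [I.Boundaryless] [IsManifold I ∞ M] [J.Boundaryless]
    [IsManifold J ∞ N] (α : DiffForm I M k)
    {f : N → M} {y₀ : N} {x₀ : M} {z : EN} (hz : z ∈ (extChartAt J y₀).target)
    (hf : MDifferentiableAt J I f ((extChartAt J y₀).symm z))
    (hx : f ((extChartAt J y₀).symm z) ∈ (extChartAt I x₀).source) :
    (α.pullback (J := J) f).inChart y₀ z =
      (α.inChart x₀ (extChartAt I x₀ (f ((extChartAt J y₀).symm z)))).compContinuousLinearMap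
        (fderiv ℝ (fun z => extChartAt I x₀ (f ((extChartAt J y₀).symm z))) z) := by
  have h1 := mdifferentiableAt_extChartAt_symm hz
  have h2 : MDifferentiableAt 𝓘(ℝ, EN) I (f ∘ (extChartAt J y₀).symm) z := hf.comp z h1
  have h3 := mdifferentiableAt_extChartAt_of_mem hx
  have h4 : mfderiv 𝓘(ℝ, EN) 𝓘(ℝ, EM) (extChartAt I x₀ ∘ (f ∘ (extChartAt J y₀).symm)) z =
      _ := mfderiv_comp z h3 h2
  rw [inChart_eq_pullback, pullback_pullback α hf h1]
  ext v
  rw [mfderiv_eq_fderiv] at h4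
  refine (eq_inChart_comp α hx _).symm.trans ?_
  change _ = α.inChart x₀ _ fun i => (fderiv ℝ (extChartAt I x₀ ∘ (f ∘ (extChartAt J y₀).symm)) z) (v i)
  rw [h4]
  rfl

theorem contDiffAt_chart_comp [IsManifold I ∞ M] [J.Boundaryless]
    [IsManifold J ∞ N] {f : N → M} {y₀ : N} {x₀ : M} {z : EN}
    (hz : z ∈ (extChartAt J y₀).target)
    (hf : ContMDiffAt J I ∞ f ((extChartAt J y₀).symm z))
    (hx : f ((extChartAt J y₀).symm z) ∈ (extChartAt I x₀).source) :
    ContDiffAt ℝ ∞ (fun z => extChartAt I x₀ (f ((extChartAt J y₀).symm z))) z := by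
  rw [← contMDiffAt_iff_contDiffAt]
  have h1 := contMDiffAt_extChartAt_symm hz
  have h3 : ContMDiffAt I 𝓘(ℝ, EM) ∞ (extChartAt I x₀) (f ((extChartAt J y₀).symm z)) :=
    contMDiffAt_extChartAt' (by simpa using hx)
  exact h3.comp z (hf.comp z h1)

/-- The conditions under which chart formulas for `f` hold are open, so a formula proved at single
points holds as an identity of germs and may be differentiated. -/
theorem eventually_chart_comp {p : EN → Prop} [I.Boundaryless] [J.Boundaryless] [IsManifold J ∞ N] {f : N → M} {y₀ : N} {x₀ : M} {z : EN}
    (hz : z ∈ (extChartAt J y₀).target)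
    (hf : ∀ᶠ w in 𝓝 ((extChartAt J y₀).symm z), ContMDiffAt J I ∞ f w)
    (hx : f ((extChartAt J y₀).symm z) ∈ (extChartAt I x₀).source)
    (h : ∀ w, w ∈ (extChartAt J y₀).target →
      ContMDiffAt J I ∞ f ((extChartAt J y₀).symm w) →
      f ((extChartAt J y₀).symm w) ∈ (extChartAt I x₀).source → p w) : ∀ᶠ w in 𝓝 z, p w := by
  have hc := continuousAt_extChartAt_symm'' hz
  have hfc : ContinuousAt f ((extChartAt J y₀).symm z) := hf.self_of_nhds.continuousAt
  filter_upwards [(isOpen_extChartAt_target y₀).mem_nhds hz, hc.eventually hf,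
    (hfc.comp hc).eventually ((isOpen_extChartAt_source x₀).mem_nhds hx)] with w h1 h2 h3
  exact h w h1 h2 h3

/-- A form is smooth at a point if it is smooth there in some chart. -/
def SmoothAt {k : ℕ} (α : DiffForm I M k) (x : M) : Prop :=
  ContDiffAt ℝ ∞ (α.inChart x) (extChartAt I x x)

theorem SmoothAt.pullback_inChart {k : ℕ} [FiniteDimensional ℝ EN] [I.Boundaryless]
    [IsManifold I ∞ M] [J.Boundaryless] [IsManifold J ∞ N] {α : DiffForm I M k}
    {f : N → M} {y₀ y : N} (hy : y ∈ (extChartAt J y₀).source) {x₀ : M}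
    (hx : f y ∈ (extChartAt I x₀).source)
    (hα : ContDiffAt ℝ ∞ (α.inChart x₀) (extChartAt I x₀ (f y)))
    (hf : ∀ᶠ w in 𝓝 y, ContMDiffAt J I ∞ f w) :
    ContDiffAt ℝ ∞ ((α.pullback (J := J) f).inChart y₀) (extChartAt J y₀ y) := by
  have hz := (extChartAt J y₀).map_source hy
  have hl := (extChartAt J y₀).left_inv hy
  rw [← hl] at hf hx hα
  have h1 := contDiffAt_chart_comp hz hf.self_of_nhds hx
  have h2 : ContDiffAt ℝ ∞ (fderiv ℝ (fun z => extChartAt I x₀ (f ((extChartAt J y₀).symm z))))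
      (extChartAt J y₀ y) := h1.fderiv_right (m := ∞) (by simp)
  have h3 := ContDiffAt.alternating_compContinuousLinearMap (ContDiffAt.comp (extChartAt J y₀ y) hα h1) h2
  refine h3.congr_of_eventuallyEq ?_
  refine eventually_chart_comp hz hf hx fun w hw1 hw2 hw3 => ?_
  exact inChart_pullback α hw1 (hw2.mdifferentiableAt (by simp)) hw3

/-- Independence of the chart: this is smoothness of the pullback by the identity, read in two
different charts. -/
theorem SmoothAt.inChart {k : ℕ} [FiniteDimensional ℝ EM] [I.Boundaryless]
    [IsManifold I ∞ M] {α : DiffForm I M k} {x₀ x : M} (hα : α.SmoothAt x)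
    (hx : x ∈ (extChartAt I x₀).source) :
    ContDiffAt ℝ ∞ (α.inChart x₀) (extChartAt I x₀ x) := by
  have h := SmoothAt.pullback_inChart (α := α) (f := id) (J := I) hx (mem_extChartAt_source x) hα
    (Filter.Eventually.of_forall fun w => contMDiffAt_id)
  have e : α.pullback (J := I) id = α := funext fun x => pullback_id α x
  rwa [e] at h

theorem SmoothAt.pullback {k : ℕ} [FiniteDimensional ℝ EN] [I.Boundaryless]
    [IsManifold I ∞ M] [J.Boundaryless] [IsManifold J ∞ N] {α : DiffForm I M k}
    {f : N → M} {y : N} (hα : α.SmoothAt (f y))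
    (hf : ∀ᶠ w in 𝓝 y, ContMDiffAt J I ∞ f w) : (α.pullback (J := J) f).SmoothAt y :=
  SmoothAt.pullback_inChart (mem_extChartAt_source y) (mem_extChartAt_source _) hα hf

theorem SmoothAt.sub {k : ℕ} {α β : DiffForm I M k} {x : M} (hα : α.SmoothAt x)
    (hβ : β.SmoothAt x) : (α - β).SmoothAt x :=
  ContDiffAt.sub hα hβ

theorem SmoothAt.neg {k : ℕ} {α : DiffForm I M k} {x : M} (hα : α.SmoothAt x) :
    (-α).SmoothAt x :=
  ContDiffAt.neg hα

theorem smoothOn_of_smoothAt {k : ℕ} [FiniteDimensional ℝ EM] [I.Boundaryless]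
    [IsManifold I ∞ M] {α : DiffForm I M k} {V : Set M} (h : ∀ x ∈ V, α.SmoothAt x) :
    α.SmoothOn V := by
  rintro x₀ z ⟨hz, hzV⟩
  have := (h _ hzV).inChart ((extChartAt I x₀).map_target hz)
  rw [(extChartAt I x₀).right_inv hz] at this
  exact this.contDiffWithinAt

theorem SmoothOn.smoothAt {k : ℕ} [I.Boundaryless] {α : DiffForm I M k} {V : Set M}
    (h : α.SmoothOn V) {x : M} (hx : V ∈ 𝓝 x) : α.SmoothAt x := by
  refine (h x).contDiffAt (Filter.inter_mem (extChartAt_target_mem_nhds x) ?_)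
  have := continuousAt_extChartAt_symm (I := I) x
  refine this.preimage_mem_nhds ?_
  simpa using hx

theorem inChart_congr {k : ℕ} [I.Boundaryless] {α β : DiffForm I M k} {x₀ : M} {z : EM}
    (hz : z ∈ (extChartAt I x₀).target) (h : ∀ᶠ y in 𝓝 ((extChartAt I x₀).symm z), α y = β y) :
    α.inChart x₀ =ᶠ[𝓝 z] β.inChart x₀ := by
  filter_upwards [(continuousAt_extChartAt_symm'' hz).eventually h] with w hw
  simp only [inChart, hw]

theorem extD_congr {k : ℕ} [I.Boundaryless] {α β : DiffForm I M k} {x : M} (h : ∀ᶠ y in 𝓝 x, α y = β y) :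
    α.extD x = β.extD x := by
  have := inChart_congr (I := I) (x₀ := x) (mem_extChartAt_target x)
    (by simpa using h)
  simp only [extD, this.extDeriv_eq]

theorem SmoothAt.congr {k : ℕ} [I.Boundaryless] {α β : DiffForm I M k} {x : M}
    (hα : α.SmoothAt x) (h : ∀ᶠ y in 𝓝 x, β y = α y) : β.SmoothAt x :=
  ContDiffAt.congr_of_eventuallyEq hα (inChart_congr (I := I) (x₀ := x) (mem_extChartAt_target x)
    (by simpa using h))

theorem SmoothAt.differentiableAt {k : ℕ} {α : DiffForm I M k} {x : M}
    (hα : α.SmoothAt x) : DifferentiableAt ℝ (α.inChart x) (extChartAt I x x) :=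
  ContDiffAt.differentiableAt hα (by simp)

theorem extD_add {k : ℕ} {α β : DiffForm I M k} {x : M}
    (hα : α.SmoothAt x) (hβ : β.SmoothAt x) : (α + β).extD x = α.extD x + β.extD x := by
  have : extDeriv ((α + β).inChart x) (extChartAt I x x) = _ :=
    extDeriv_add hα.differentiableAt hβ.differentiableAt
  simp only [extD, this]
  rfl

theorem extD_neg {k : ℕ} (α : DiffForm I M k) (x : M) : (-α).extD x = -α.extD x := by
  have h : (-α).inChart x = fun y => (-1 : ℝ) • α.inChart x y := by
    funext y
    ext v
    exact (neg_one_smul ℝ _).symm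
  have : extDeriv ((-α).inChart x) (extChartAt I x x) = (-1 : ℝ) • extDeriv (α.inChart x) (extChartAt I x x) := by
    rw [h]
    exact extDeriv_fun_smul (-1 : ℝ) _
  simp only [extD, this]
  ext v
  simp
  rfl

theorem extD_sub {k : ℕ} {α β : DiffForm I M k} {x : M}
    (hα : α.SmoothAt x) (hβ : β.SmoothAt x) : (α - β).extD x = α.extD x - β.extD x := by
  rw [sub_eq_add_neg, extD_add hα hβ.neg, extD_neg, sub_eq_add_neg]

/-- Both sides reduce to `extDeriv_pullback` for the local representative of `f` in the charts at
`y` and `f y`. Since `extD` is computed in a chart chosen point by point, this naturality also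
carries its independence of the chart. -/
theorem extD_pullback {k : ℕ} [I.Boundaryless] [IsManifold I ∞ M] [J.Boundaryless]
    [IsManifold J ∞ N] {α : DiffForm I M k}
    {f : N → M} {y : N} (hα : α.SmoothAt (f y))
    (hf : ∀ᶠ w in 𝓝 y, ContMDiffAt J I ∞ f w) :
    (α.pullback (J := J) f).extD y = α.extD.pullback (J := J) f y := by
  have hz := mem_extChartAt_target (I := J) y
  have hx := mem_extChartAt_source (I := I) (f y)
  have hl := (extChartAt J y).left_inv (mem_extChartAt_source y)
  have hf' := hf
  have hx' := hx
  rw [← hl] at hf'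
  rw [← hl] at hx'
  rw [hl] at hx'
  have hx'' : f ((extChartAt J y).symm (extChartAt J y y)) ∈ (extChartAt I (f y)).source := by
    rw [hl]; exact hx
  have h1 := contDiffAt_chart_comp hz hf'.self_of_nhds hx''
  have h3 := hf.self_of_nhds.mdifferentiableAt (by simp)
  have e1 : (α.pullback (J := J) f).inChart y =ᶠ[𝓝 (extChartAt J y y)] _ :=
    eventually_chart_comp hz hf' hx'' fun w hw1 hw2 hw3 =>
      inChart_pullback α hw1 (hw2.mdifferentiableAt (by simp)) hw3
  have hα' : DifferentiableAt ℝ (α.inChart (f y))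
      (extChartAt I (f y) (f ((extChartAt J y).symm (extChartAt J y y)))) := by
    rw [hl]; exact hα.differentiableAt
  have e2 := e1.extDeriv_eq.trans (extDeriv_pullback (r := ∞) hα' h1 minSmoothness_two_le)
  have h4 : mfderiv J 𝓘(ℝ, EM) (extChartAt I (f y) ∘ f) y = _ :=
    mfderiv_comp y (mdifferentiableAt_extChartAt_of_mem hx) h3
  have h5 : (fun z => extChartAt I (f y) (f ((extChartAt J y).symm z))) ∘ extChartAt J y
      =ᶠ[𝓝 y] extChartAt I (f y) ∘ f := by
    filter_upwards [extChartAt_source_mem_nhds (I := J) y] with w hw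
    simp only [Function.comp_apply, (extChartAt J y).left_inv hw]
  -- The derivative of the local representative after the chart at `y` equals the chart at `f y`
  -- after the derivative of `f`; this matches the vectors fed to the two sides.
  have h6 := mfderiv_comp (I' := 𝓘(ℝ, EN)) y (h1.contMDiffAt.mdifferentiableAt (by simp))
    (mdifferentiableAt_extChartAt_of_mem (mem_extChartAt_source (I := J) y))
  rw [h5.mfderiv_eq, h4, mfderiv_eq_fderiv] at h6
  simp only [extD, pullback]
  rw [e2]
  ext v
  rw [hl]
  refine congrArg (extDeriv (α.inChart (f y)) (extChartAt I (f y) (f y))) (funext fun i => ?_)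
  exact (congrArg (fun l => l (v i)) h6).symm

theorem inChart_model {k : ℕ} (α : DiffForm 𝓘(ℝ, EM) EM k) (x₀ : EM) : α.inChart x₀ = α := by
  funext x
  have h : ⇑(extChartAt 𝓘(ℝ, EM) x₀).symm = id := by
    rw [extChartAt_model_space_eq_id]
    rfl
  change α.pullback (J := 𝓘(ℝ, EM)) (⇑(extChartAt 𝓘(ℝ, EM) x₀).symm) x = α x
  rw [h]
  exact pullback_id α x

theorem extD_model {k : ℕ} (α : DiffForm 𝓘(ℝ, EM) EM k) (x : EM) :
    α.extD x = extDeriv (F := ℝ) (n := k) (E := EM) α x := by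
  ext v
  have h : ∀ c : EM → EM, c = id → extDeriv (F := ℝ) (n := k) (E := EM) α (c x)
      (fun i => mfderiv 𝓘(ℝ, EM) 𝓘(ℝ, EM) c x (v i)) =
      extDeriv (F := ℝ) (n := k) (E := EM) α x v := by
    rintro _ rfl
    rw [mfderiv_id]
    rfl
  have h2 : ⇑(extChartAt 𝓘(ℝ, EM) x) = id := by
    rw [extChartAt_model_space_eq_id]
    rfl
  refine Eq.trans ?_ (h _ h2)
  simp only [extD, inChart_model]
  rfl

/-- Naturality of `d` for the inverse chart: the exterior derivative may be computed in any chart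
around the point, not only in the one centered there. -/
theorem extD_inChart {k : ℕ} [FiniteDimensional ℝ EM] [I.Boundaryless] [IsManifold I ∞ M]
    {α : DiffForm I M k} {x₀ : M} {z : EM} (hz : z ∈ (extChartAt I x₀).target)
    (hα : α.SmoothAt ((extChartAt I x₀).symm z)) :
    α.extD.inChart x₀ z = extDeriv (α.inChart x₀) z := by
  rw [inChart_eq_pullback, ← extD_pullback hα, extD_model]
  · rfl
  · filter_upwards [(isOpen_extChartAt_target x₀).mem_nhds hz] with w hw
    exact contMDiffAt_extChartAt_symm hw

theorem eq_of_inChart_eq {k : ℕ} [I.Boundaryless] [IsManifold I ∞ M] {α β : DiffForm I M k}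
    {x₀ x : M} (hx : x ∈ (extChartAt I x₀).source)
    (h : α.inChart x₀ (extChartAt I x₀ x) = β.inChart x₀ (extChartAt I x₀ x)) : α x = β x := by
  ext v
  rw [← eq_inChart_comp α hx, ← eq_inChart_comp β hx, h]

end DiffForm

end FormCalculus

/-! ### Integrals depending smoothly on a parameter -/

section ParametricIntegral

open MeasureTheory intervalIntegral

variable {Y : Type*} [NormedAddCommGroup Y] [NormedSpace ℝ Y] [FiniteDimensional ℝ Y]

theorem hasFDerivAt_integral_of_contDiffOn {O : Set Y} (hO : IsOpen O) {g : ℝ × Y → ℝ}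
    (hg : ContDiffOn ℝ ∞ g (univ ×ˢ O)) {y : Y} (hy : y ∈ O) :
    HasFDerivAt (fun y => ∫ t in (0:ℝ)..1, g (t, y))
      (∫ t in (0:ℝ)..1, (fderiv ℝ g (t, y)).comp (ContinuousLinearMap.inr ℝ ℝ Y)) y := by
  have hU : IsOpen ((univ : Set ℝ) ×ˢ O) := isOpen_univ.prod hO
  have hc : ∀ z ∈ O, Continuous fun t => g (t, z) := fun z hz =>
    hg.continuousOn.comp_continuous (by fun_prop) fun t => ⟨mem_univ _, hz⟩
  have hd : ContinuousOn (fderiv ℝ g) (univ ×ˢ O) :=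
    hg.continuousOn_fderiv_of_isOpen hU (by simp)
  have hd' : ContinuousOn (fun q : ℝ × Y =>
      (fderiv ℝ g q).comp (ContinuousLinearMap.inr ℝ ℝ Y)) (univ ×ˢ O) :=
    hd.clm_comp continuousOn_const
  -- A closed ball is compact here, so the derivative of the integrand is bounded on it uniformly in
  -- `t`, and a constant serves as the dominating function.
  obtain ⟨ε, hε, hball⟩ := Metric.nhds_basis_closedBall.mem_iff.1 (hO.mem_nhds hy)
  have hK : IsCompact (Icc (0:ℝ) 1 ×ˢ Metric.closedBall y ε) :=
    isCompact_Icc.prod (isCompact_closedBall y ε)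
  obtain ⟨C, hC⟩ := hK.exists_bound_of_continuousOn
    (hd'.mono (prod_mono (subset_univ _) hball))
  refine hasFDerivAt_integral_of_dominated_of_fderiv_le (s := Metric.closedBall y ε)
    (bound := fun _ => C)
    (F' := fun z t => (fderiv ℝ g (t, z)).comp (ContinuousLinearMap.inr ℝ ℝ Y))
    (Metric.closedBall_mem_nhds y hε) ?_ ((hc y hy).intervalIntegrable _ _) ?_ ?_ (by simp) ?_
  · filter_upwards [hO.mem_nhds hy] with z hz
    exact (hc z hz).aestronglyMeasurable
  · refine Continuous.aestronglyMeasurable ?_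
    exact hd'.comp_continuous (by fun_prop) fun t => ⟨mem_univ _, hy⟩
  · refine Filter.Eventually.of_forall fun t ht z hz => ?_
    rw [uIoc_of_le zero_le_one] at ht
    exact hC (t, z) ⟨Ioc_subset_Icc_self ht, hz⟩
  · refine Filter.Eventually.of_forall fun t ht z hz => ?_
    have h1 : HasFDerivAt g (fderiv ℝ g (t, z)) (t, z) :=
      ((hg.contDiffAt (hU.mem_nhds ⟨mem_univ _, hball hz⟩)).differentiableAt (by simp)).hasFDerivAt
    exact h1.comp z (hasFDerivAt_prodMk_right t z)

theorem fderiv_integral_of_contDiffOn {O : Set Y} (hO : IsOpen O) {g : ℝ × Y → ℝ}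
    (hg : ContDiffOn ℝ ∞ g (univ ×ˢ O)) {y : Y} (hy : y ∈ O) (u : Y) :
    fderiv ℝ (fun y => ∫ t in (0:ℝ)..1, g (t, y)) y u =
      ∫ t in (0:ℝ)..1, fderiv ℝ g (t, y) (0, u) := by
  rw [(hasFDerivAt_integral_of_contDiffOn hO hg hy).fderiv, ContinuousLinearMap.intervalIntegral_apply]
  · rfl
  · refine Continuous.intervalIntegrable ?_ _ _
    have hd : ContinuousOn (fderiv ℝ g) (univ ×ˢ O) :=
      hg.continuousOn_fderiv_of_isOpen (isOpen_univ.prod hO) (by simp)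
    exact (hd.comp_continuous (by fun_prop) fun t => ⟨mem_univ _, hy⟩).clm_comp continuous_const

/-- Each directional derivative of the integral is again an integral of a smooth integrand, namely
`fderiv ℝ g q (0, u)`. Induction on the order of differentiability, for all `g` at once, therefore
closes. -/
theorem contDiffOn_integral {O : Set Y} (hO : IsOpen O) {g : ℝ × Y → ℝ}
    (hg : ContDiffOn ℝ ∞ g (univ ×ˢ O)) :
    ContDiffOn ℝ ∞ (fun y => ∫ t in (0:ℝ)..1, g (t, y)) O := by
  rw [contDiffOn_infty]
  intro n
  induction n generalizing g with
  | zero =>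
    rw [Nat.cast_zero, contDiffOn_zero]
    exact fun y hy => (hasFDerivAt_integral_of_contDiffOn hO hg hy).continuousAt.continuousWithinAt
  | succ n ih =>
    rw [Nat.cast_succ, contDiffOn_succ_iff_fderiv_apply hO.uniqueDiffOn]
    refine ⟨fun y hy =>
      (hasFDerivAt_integral_of_contDiffOn hO hg hy).differentiableAt.differentiableWithinAt,
      fun h => by simp at h, fun u => ?_⟩
    have h1 : ContDiffOn ℝ ∞ (fun q => fderiv ℝ g q (0, u)) (univ ×ˢ O) :=
      (hg.fderiv_of_isOpen (isOpen_univ.prod hO) (by simp)).clm_apply contDiffOn_const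
    refine (ih h1).congr fun y hy => ?_
    rw [fderivWithin_of_isOpen hO hy, fderiv_integral_of_contDiffOn hO hg hy]

end ParametricIntegral

/-! ### The fiberwise radial homotopy operator on a product of vector spaces -/

section Poincare

open MeasureTheory intervalIntegral

/-- The vectors `v y i` are packed into one linear map from `ℝ^k` that sends the `i`-th basis vector
to `v y i`. Evaluation on them becomes evaluation of the pulled back form on the fixed standard
basis. -/
theorem ContDiffAt.alternating_apply {X : Type*} [NormedAddCommGroup X] [NormedSpace ℝ X]
    {E : Type*} [NormedAddCommGroup E] [NormedSpace ℝ E] {k : ℕ} {n : ℕ∞ω}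
    {om : X → E [⋀^Fin k]→L[ℝ] ℝ} {v : X → Fin k → E} {x : X}
    (hom : ContDiffAt ℝ n om x) (hv : ∀ i, ContDiffAt ℝ n (fun y => v y i) x) :
    ContDiffAt ℝ n (fun y => om y (v y)) x := by
  let g : X → (Fin k → ℝ) →L[ℝ] E := fun y =>
    ∑ i, (ContinuousLinearMap.proj (R := ℝ) (φ := fun _ : Fin k => ℝ) i).smulRight (v y i)
  have hg : ContDiffAt ℝ n g x := ContDiffAt.sum fun i _ =>
    ((ContinuousLinearMap.smulRightL ℝ (Fin k → ℝ) E
      (ContinuousLinearMap.proj i)).contDiff.contDiffAt).comp x (hv i)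
  have h := contDiffAt_alternating_iff.1 (hom.alternating_compContinuousLinearMap hg)
    (fun i => Pi.single i 1)
  refine h.congr_of_eventuallyEq (Filter.Eventually.of_forall fun y => ?_)
  simp only [ContinuousAlternatingMap.compContinuousLinearMap_apply]
  congr 1
  funext i
  simp [g, Pi.single_apply]

variable {X : Type*} [NormedAddCommGroup X] [NormedSpace ℝ X] [FiniteDimensional ℝ X]
  {F : Type*} [NormedAddCommGroup F] [NormedSpace ℝ F] [FiniteDimensional ℝ F]

/-- Multiplication by `t` in the second factor. -/
noncomputable def scaleSnd (X F : Type*) [NormedAddCommGroup X] [NormedSpace ℝ X] [NormedAddCommGroup F]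
    [NormedSpace ℝ F] (t : ℝ) : X × F →L[ℝ] X × F :=
  (ContinuousLinearMap.fst ℝ X F).prod (t • ContinuousLinearMap.snd ℝ X F)

@[simp] theorem scaleSnd_apply (t : ℝ) (w : X × F) : scaleSnd X F t w = (w.1, t • w.2) := rfl

/-- The integrand of the radial homotopy operator. -/
noncomputable def radialIntegrand (B : X × F → (X × F) [⋀^Fin 2]→L[ℝ] ℝ) (p w : X × F) (t : ℝ) : ℝ :=
  B (scaleSnd X F t p) ![(0, p.2), scaleSnd X F t w]

open Classical in
/-- The fiberwise radial homotopy operator on `2`-forms. -/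
noncomputable def radialPrimitive (B : X × F → (X × F) [⋀^Fin 2]→L[ℝ] ℝ) (p : X × F) :
    (X × F) [⋀^Fin 1]→L[ℝ] ℝ :=
  -- Linearity in `w` needs integrability, which is available where `B` is smooth along the ray; the
  -- value `0` only serves elsewhere.
  if h : IsLinearMap ℝ fun w => ∫ t in (0:ℝ)..1, radialIntegrand B p w t then
    ContinuousAlternatingMap.ofSubsingleton ℝ _ ℝ (0 : Fin 1)
      (LinearMap.toContinuousLinearMap (h.mk' _))
  else 0

variable {B : X × F → (X × F) [⋀^Fin 2]→L[ℝ] ℝ} {T : Set X}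

theorem contDiffOn_radialIntegrand (hT : IsOpen T) (hB : ContDiffOn ℝ ∞ B (T ×ˢ univ))
    (w : X × F) : ContDiffOn ℝ ∞ (fun q : ℝ × (X × F) => radialIntegrand B q.2 w q.1)
      (univ ×ˢ (T ×ˢ univ)) := by
  rintro ⟨t, p⟩ ⟨-, hp⟩
  refine ContDiffAt.contDiffWithinAt ?_
  have h1 : ContDiffAt ℝ ∞ (fun q : ℝ × (X × F) => B (scaleSnd X F q.1 q.2)) (t, p) := by
    have : ContDiffAt ℝ ∞ B (scaleSnd X F t p) :=
      hB.contDiffAt ((hT.prod isOpen_univ).mem_nhds ⟨hp.1, mem_univ _⟩)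
    refine ContDiffAt.comp (t, p) this ?_
    simp only [scaleSnd_apply]
    fun_prop
  refine ContDiffAt.alternating_apply h1 fun i => ?_
  fin_cases i
  · simp only [Fin.zero_eta, Matrix.cons_val_zero]
    fun_prop
  · simp only [Fin.mk_one, Matrix.cons_val_one, Matrix.cons_val_fin_one, scaleSnd_apply]
    fun_prop

theorem continuous_radialIntegrand (hT : IsOpen T) (hB : ContDiffOn ℝ ∞ B (T ×ˢ univ))
    {p : X × F} (hp : p.1 ∈ T) (w : X × F) : Continuous (radialIntegrand B p w) :=
  (contDiffOn_radialIntegrand hT hB w).continuousOn.comp_continuous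
    (f := fun t : ℝ => (t, p)) (by fun_prop) fun t => ⟨mem_univ _, hp, mem_univ _⟩

theorem update_pair_zero {E : Type*} (a b x : E) : Function.update ![a, b] 0 x = ![x, b] := by
  funext i
  fin_cases i <;> rfl

theorem update_pair_one {E : Type*} (a b x : E) : Function.update ![a, b] 1 x = ![a, x] := by
  funext i
  fin_cases i <;> rfl

theorem map_pair_add {E : Type*} [NormedAddCommGroup E] [NormedSpace ℝ E]
    (m : E [⋀^Fin 2]→L[ℝ] ℝ) (a b c : E) : m ![a, b + c] = m ![a, b] + m ![a, c] := by
  have h := m.map_update_add ![a, 0] 1 b c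
  simp only [update_pair_one] at h
  exact h

theorem map_pair_smul {E : Type*} [NormedAddCommGroup E] [NormedSpace ℝ E]
    (m : E [⋀^Fin 2]→L[ℝ] ℝ) (a b : E) (c : ℝ) : m ![a, c • b] = c * m ![a, b] := by
  have h := m.map_update_smul ![a, 0] 1 c b
  simp only [update_pair_one] at h
  exact h

theorem map_pair_swap {E : Type*} [NormedAddCommGroup E] [NormedSpace ℝ E]
    (m : E [⋀^Fin 2]→L[ℝ] ℝ) (a b : E) : m ![a, b] = -m ![b, a] := by
  have := m.map_swap ![b, a] (i := 0) (j := 1) (by simp)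
  refine Eq.trans ?_ this
  refine congrArg m (funext fun i => ?_)
  fin_cases i <;> simp

theorem radialPrimitive_apply (hT : IsOpen T) (hB : ContDiffOn ℝ ∞ B (T ×ˢ univ))
    {p : X × F} (hp : p.1 ∈ T) (w : Fin 1 → X × F) :
    radialPrimitive B p w = ∫ t in (0:ℝ)..1, radialIntegrand B p (w 0) t := by
  have hi : ∀ w, IntervalIntegrable (radialIntegrand B p w) volume 0 1 := fun w =>
    (continuous_radialIntegrand hT hB hp w).intervalIntegrable _ _
  have h : IsLinearMap ℝ fun w => ∫ t in (0:ℝ)..1, radialIntegrand B p w t := by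
    constructor
    · intro a b
      rw [← integral_add (hi a) (hi b)]
      congr 1
      funext t
      simp only [radialIntegrand, map_add, map_pair_add]
    · intro c a
      rw [smul_eq_mul, ← intervalIntegral.integral_const_mul]
      congr 1
      funext t
      simp only [radialIntegrand, map_smul, map_pair_smul]
  rw [radialPrimitive, dif_pos h]
  rfl

theorem contDiffOn_radialPrimitive (hT : IsOpen T) (hB : ContDiffOn ℝ ∞ B (T ×ˢ univ)) :
    ContDiffOn ℝ ∞ (radialPrimitive B) (T ×ˢ univ) := by
  intro p hp
  rw [contDiffWithinAt_alternating_iff]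
  intro w
  have h := contDiffOn_integral (hT.prod isOpen_univ) (contDiffOn_radialIntegrand hT hB (w 0))
  exact (h.congr fun q hq => radialPrimitive_apply hT hB hq.1 w) p hp

theorem extDeriv_one_apply {E : Type*} [NormedAddCommGroup E] [NormedSpace ℝ E]
    {a : E → E [⋀^Fin 1]→L[ℝ] ℝ} {p : E} (ha : DifferentiableAt ℝ a p) (u w : E) :
    extDeriv a p ![u, w] =
      fderiv ℝ (fun q => a q ![w]) p u - fderiv ℝ (fun q => a q ![u]) p w := by
  rw [extDeriv_apply ha]
  have h0 : (0 : Fin 2).removeNth ![u, w] = ![w] := by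
    funext i; fin_cases i; rfl
  have h1 : (1 : Fin 2).removeNth ![u, w] = ![u] := by
    funext i; fin_cases i; rfl
  simp [Fin.sum_univ_two, h0, h1, sub_eq_add_neg]

theorem extDeriv_two_apply {E : Type*} [NormedAddCommGroup E] [NormedSpace ℝ E]
    {a : E → E [⋀^Fin 2]→L[ℝ] ℝ} {p : E} (ha : DifferentiableAt ℝ a p) (u v w : E) :
    extDeriv a p ![u, v, w] =
      fderiv ℝ a p u ![v, w] - fderiv ℝ a p v ![u, w] + fderiv ℝ a p w ![u, v] := by
  rw [extDeriv_apply ha]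
  have h0 : (0 : Fin 3).removeNth ![u, v, w] = ![v, w] := by
    funext i; fin_cases i <;> rfl
  have h1 : (1 : Fin 3).removeNth ![u, v, w] = ![u, w] := by
    funext i; fin_cases i <;> rfl
  have h2 : (2 : Fin 3).removeNth ![u, v, w] = ![u, v] := by
    funext i; fin_cases i <;> rfl
  simp [Fin.sum_univ_three, h0, h1, h2, sub_eq_add_neg,
    fderiv_continuousAlternatingMap_apply_const_apply ha]

theorem hasFDerivAt_pair_apply {Y E : Type*} [NormedAddCommGroup Y] [NormedSpace ℝ Y]
    [NormedAddCommGroup E] [NormedSpace ℝ E] {b : Y → E [⋀^Fin 2]→L[ℝ] ℝ} {f g : Y → E} {y : Y}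
    {f' g' : Y →L[ℝ] E}
    (hb : DifferentiableAt ℝ b y) (hf : HasFDerivAt f f' y) (hg : HasFDerivAt g g' y) (u : Y) :
    DifferentiableAt ℝ (fun z => b z ![f z, g z]) y ∧
    fderiv ℝ (fun z => b z ![f z, g z]) y u =
      fderiv ℝ b y u ![f y, g y] + b y ![f' u, g y] + b y ![f y, g' u] := by
  let G : Fin 2 → Y → E := ![f, g]
  have hG : ∀ i, DifferentiableAt ℝ (G i) y := by
    intro i
    fin_cases i
    · exact hf.differentiableAt
    · exact hg.differentiableAt
  have h := fderiv_continuousAlternatingMap_apply_apply hb hG u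
  have h' := DifferentiableAt.continuousAlternatingMap_apply hb hG
  have e : ∀ z, (fun i => G i z) = ![f z, g z] := by
    intro z
    funext i
    fin_cases i <;> rfl
  simp only [e] at h h'
  refine ⟨h', ?_⟩
  rw [h, Fin.sum_univ_two, add_assoc]
  simp only [G, Matrix.cons_val_zero, Matrix.cons_val_one, Matrix.cons_val_fin_one, hf.fderiv,
    hg.fderiv, update_pair_zero, update_pair_one]

theorem differentiableAt_scaleSnd (hT : IsOpen T) (hB : ContDiffOn ℝ ∞ B (T ×ˢ univ))
    {p : X × F} (hp : p.1 ∈ T) (t : ℝ) : DifferentiableAt ℝ B (scaleSnd X F t p) := by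
  have h : scaleSnd X F t p ∈ T ×ˢ (univ : Set F) := ⟨hp, mem_univ _⟩
  exact (hB.contDiffAt ((hT.prod isOpen_univ).mem_nhds h)).differentiableAt (by simp)

theorem fderiv_radialIntegrand (hT : IsOpen T) (hB : ContDiffOn ℝ ∞ B (T ×ˢ univ))
    {p : X × F} (hp : p.1 ∈ T) (t : ℝ) (u w : X × F) :
    fderiv ℝ (fun q : ℝ × (X × F) => radialIntegrand B q.2 w q.1) (t, p) (0, u) =
      fderiv ℝ B (scaleSnd X F t p) (scaleSnd X F t u) ![(0, p.2), scaleSnd X F t w] +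
        B (scaleSnd X F t p) ![(0, u.2), scaleSnd X F t w] := by
  have hBd := differentiableAt_scaleSnd hT hB hp t
  have h0 : DifferentiableAt ℝ (fun q : ℝ × (X × F) => radialIntegrand B q.2 w q.1) (t, p) :=
    ((contDiffOn_radialIntegrand hT hB w).contDiffAt
      ((isOpen_univ.prod (hT.prod isOpen_univ)).mem_nhds
        ⟨mem_univ _, hp, mem_univ _⟩)).differentiableAt (by simp)
  have h1 : fderiv ℝ (fun q : ℝ × (X × F) => radialIntegrand B q.2 w q.1) (t, p) (0, u) =
      fderiv ℝ (fun p => radialIntegrand B p w t) p u := by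
    have := h0.hasFDerivAt.comp p (hasFDerivAt_prodMk_right t p)
    rw [show (fun p => radialIntegrand B p w t) =
      (fun q : ℝ × (X × F) => radialIntegrand B q.2 w q.1) ∘ fun p => (t, p) from rfl, this.fderiv]
    rfl
  rw [h1]
  have hb := hBd.hasFDerivAt.comp p (scaleSnd X F t).hasFDerivAt
  have := (hasFDerivAt_pair_apply (b := fun p => B (scaleSnd X F t p))
    (f := fun p : X × F => ((0 : X), p.2)) (g := fun _ => scaleSnd X F t w) (y := p)
    hb.differentiableAt ((ContinuousLinearMap.inr ℝ X F).comp
      (ContinuousLinearMap.snd ℝ X F)).hasFDerivAt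
    (hasFDerivAt_const _ _) u).2
  refine this.trans ?_
  have e : fderiv ℝ (fun p => B (scaleSnd X F t p)) p = _ := hb.fderiv
  have z : ∀ m : (X × F) [⋀^Fin 2]→L[ℝ] ℝ, ∀ a, m ![a, 0] = 0 := fun m a =>
    m.map_coord_zero 1 rfl
  rw [e]
  simp [z]

theorem hasDerivAt_scaleSnd_pair (hT : IsOpen T) (hB : ContDiffOn ℝ ∞ B (T ×ˢ univ))
    {p : X × F} (hp : p.1 ∈ T) (t : ℝ) (u w : X × F) :
    HasDerivAt (fun t => B (scaleSnd X F t p) ![scaleSnd X F t u, scaleSnd X F t w])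
      (fderiv ℝ B (scaleSnd X F t p) (0, p.2) ![scaleSnd X F t u, scaleSnd X F t w] +
        B (scaleSnd X F t p) ![(0, u.2), scaleSnd X F t w] +
        B (scaleSnd X F t p) ![scaleSnd X F t u, (0, w.2)]) t := by
  have hBd := differentiableAt_scaleSnd hT hB hp t
  have hs : ∀ q : X × F, HasFDerivAt (fun t => scaleSnd X F t q)
      ((1 : ℝ →L[ℝ] ℝ).smulRight ((0 : X), q.2)) t := by
    intro q
    have h : HasDerivAt (fun t : ℝ => (q.1, t • q.2)) ((0 : X), (1 : ℝ) • q.2) t :=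
      (hasDerivAt_const t q.1).prodMk ((hasDerivAt_id t).smul_const q.2)
    rw [one_smul] at h
    exact h.hasFDerivAt
  have hb := hBd.hasFDerivAt.comp t (hs p)
  have h := hasFDerivAt_pair_apply hb.differentiableAt (hs u) (hs w) 1
  have e : fderiv ℝ (B ∘ fun t => scaleSnd X F t p) t = _ := hb.fderiv
  have h2 := h.1.hasDerivAt
  rw [← fderiv_apply_one_eq_deriv, h.2, e] at h2
  simpa using h2

/-- Let `h_t` be `scaleSnd X F t`. Since `dB = 0`, the `t`-derivative of `h_t^*B` is the exterior
derivative of the integrand. Integration from `0` to `1` gives `h_1^*B - h_0^*B`; here `h_1` is the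
identity, and `h_0^*B` vanishes by the hypothesis on horizontal vectors along the zero section. The
integrand is regular at `t = 0`: it pairs with the velocity `(0, p.2)` of the scaling, so nothing is
divided by `t`. -/
theorem extDeriv_radialPrimitive (hT : IsOpen T) (hB : ContDiffOn ℝ ∞ B (T ×ˢ univ))
    (hd : ∀ p, p.1 ∈ T → extDeriv B p = 0)
    (h0 : ∀ y ∈ T, ∀ a b : X, B (y, 0) ![(a, 0), (b, 0)] = 0)
    {p : X × F} (hp : p.1 ∈ T) : extDeriv (radialPrimitive B) p = B p := by
  have hO := hT.prod (isOpen_univ (X := F))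
  have hKd : DifferentiableAt ℝ (radialPrimitive B) p :=
    ((contDiffOn_radialPrimitive hT hB).contDiffAt
      (hO.mem_nhds ⟨hp, mem_univ _⟩)).differentiableAt (by simp)
  have hf : ∀ u w : X × F, fderiv ℝ (fun q => radialPrimitive B q ![w]) p u =
      ∫ t in (0:ℝ)..1, fderiv ℝ (fun q : ℝ × (X × F) => radialIntegrand B q.2 w q.1) (t, p) (0, u) := by
    intro u w
    rw [← fderiv_integral_of_contDiffOn hO (contDiffOn_radialIntegrand hT hB w) ⟨hp, mem_univ _⟩ u]
    have : (fun q => radialPrimitive B q ![w]) =ᶠ[𝓝 p]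
        fun q => ∫ t in (0:ℝ)..1, radialIntegrand B q w t := by
      filter_upwards [hO.mem_nhds ⟨hp, mem_univ _⟩] with q hq
      rw [radialPrimitive_apply hT hB hq.1]
      rfl
    rw [this.fderiv_eq]
  have hint : ∀ u w : X × F, Continuous fun t : ℝ =>
      fderiv ℝ (fun q : ℝ × (X × F) => radialIntegrand B q.2 w q.1) (t, p) (0, u) := by
    intro u w
    have hd : ContinuousOn (fderiv ℝ fun q : ℝ × (X × F) => radialIntegrand B q.2 w q.1)
        (univ ×ˢ (T ×ˢ univ)) :=
      (contDiffOn_radialIntegrand hT hB w).continuousOn_fderiv_of_isOpen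
        (isOpen_univ.prod hO) (by simp)
    exact (hd.comp_continuous (f := fun t : ℝ => (t, p)) (by fun_prop)
      fun t => ⟨mem_univ _, hp, mem_univ _⟩).clm_apply continuous_const
  ext v
  have hv : v = ![v 0, v 1] := by funext i; fin_cases i <;> rfl
  rw [hv]
  generalize v 0 = u
  generalize v 1 = w
  rw [extDeriv_one_apply hKd, hf, hf, ← integral_sub ((hint u w).intervalIntegrable _ _)
    ((hint w u).intervalIntegrable _ _)]
  -- Cartan's formula for the scaling. The two sides differ by `dB` evaluated on the velocity and
  -- the two scaled vectors, which is zero.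
  have key : ∀ t : ℝ, HasDerivAt
      (fun t => B (scaleSnd X F t p) ![scaleSnd X F t u, scaleSnd X F t w])
      (fderiv ℝ (fun q : ℝ × (X × F) => radialIntegrand B q.2 w q.1) (t, p) (0, u) -
        fderiv ℝ (fun q : ℝ × (X × F) => radialIntegrand B q.2 u q.1) (t, p) (0, w)) t := by
    intro t
    have hBd := differentiableAt_scaleSnd hT hB hp t
    have h1 := extDeriv_two_apply hBd (0, p.2) (scaleSnd X F t u) (scaleSnd X F t w)
    rw [hd (scaleSnd X F t p) hp] at h1
    have h2 := hasDerivAt_scaleSnd_pair hT hB hp t u w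
    rw [fderiv_radialIntegrand hT hB hp, fderiv_radialIntegrand hT hB hp]
    convert h2 using 1
    rw [map_pair_swap _ (scaleSnd X F t u) (0, w.2)]
    change (0 : ℝ) = _ at h1
    linarith
  rw [integral_eq_sub_of_hasDerivAt (fun t _ => key t)
    (((hint u w).sub (hint w u)).intervalIntegrable _ _)]
  have h1 : ∀ q : X × F, scaleSnd X F 1 q = q := fun q => by simp
  have h2 : ∀ q : X × F, scaleSnd X F 0 q = (q.1, 0) := fun q => by simp
  rw [h1, h1, h1, h2, h2, h2, h0 _ hp, sub_zero]

theorem radialPrimitive_vertical (hT : IsOpen T) (hB : ContDiffOn ℝ ∞ B (T ×ˢ univ))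
    (hv : ∀ q : X × F, q.1 ∈ T → ∀ a b : F, B q ![(0, a), (0, b)] = 0)
    {p : X × F} (hp : p.1 ∈ T) (a : F) : radialPrimitive B p ![(0, a)] = 0 := by
  rw [radialPrimitive_apply hT hB hp]
  have h : ∀ t, radialIntegrand B p ((0 : X), a) t = 0 := fun t =>
    hv (scaleSnd X F t p) hp p.2 (t • a)
  simp only [Matrix.cons_val_fin_one, h, intervalIntegral.integral_zero]

theorem radialPrimitive_zero (hT : IsOpen T) (hB : ContDiffOn ℝ ∞ B (T ×ˢ univ))
    {y : X} (hy : y ∈ T) : radialPrimitive B (y, (0 : F)) = 0 := by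
  ext w
  rw [radialPrimitive_apply hT hB hy]
  have : ∀ t, radialIntegrand B (y, (0 : F)) (w 0) t = 0 := fun t =>
    (B _).map_coord_zero 0 rfl
  simp [this]

/-- Each coefficient `a(·)(w)` is constant along the ray through `p`. Its radial derivative is the
derivative along `w` of `a` on the constant vertical vector `(0, p.2)`, up to a value of `da`, and
both vanish. At `t = 0` the coefficient is zero. -/
theorem eq_zero_of_extDeriv_eq_zero {a : X × F → (X × F) [⋀^Fin 1]→L[ℝ] ℝ}
    (hT : IsOpen T) (ha : DifferentiableOn ℝ a (T ×ˢ univ))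
    {p : X × F} (hp : p.1 ∈ T) (hd : ∀ v, extDeriv a (p.1, v) = 0)
    (hv : ∀ q : X × F, q.1 ∈ T → ∀ b : F, a q ![(0, b)] = 0)
    (h0 : a (p.1, 0) = 0) : a p = 0 := by
  have hO := hT.prod (isOpen_univ (X := F))
  have had : ∀ q : X × F, q.1 ∈ T → DifferentiableAt ℝ a q := fun q hq =>
    ha.differentiableAt (hO.mem_nhds ⟨hq, mem_univ _⟩)
  have key : ∀ (w : X × F) (t : ℝ), HasDerivAt (fun t : ℝ => a (p.1, t • p.2) ![w]) 0 t := by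
    intro w t
    have h1 := extDeriv_one_apply (had (p.1, t • p.2) hp) (0, p.2) w
    rw [hd] at h1
    -- Horizontality holds on the whole open set, so this coefficient is zero as a germ and so is
    -- its derivative.
    have h2 : (fun q => a q ![((0 : X), p.2)]) =ᶠ[𝓝 (p.1, t • p.2)] fun _ => 0 := by
      filter_upwards [hO.mem_nhds (⟨hp, mem_univ _⟩ : (p.1, t • p.2) ∈ T ×ˢ univ)] with q hq
      exact hv q hq.1 _
    rw [h2.fderiv_eq] at h1
    change (0 : ℝ) = _ at h1
    have h3 : DifferentiableAt ℝ (fun q => a q ![w]) (p.1, t • p.2) :=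
      ((ContinuousAlternatingMap.apply ℝ (X × F) ℝ ![w]).differentiableAt).comp _ (had _ hp)
    have h : HasDerivAt (fun t : ℝ => (p.1, t • p.2)) ((0 : X), (1 : ℝ) • p.2) t :=
      (hasDerivAt_const t p.1).prodMk ((hasDerivAt_id t).smul_const p.2)
    have h4 := h3.hasFDerivAt.comp_hasDerivAt t h
    rw [one_smul] at h4
    have e : fderiv ℝ (fun _ : X × F => (0 : ℝ)) (p.1, t • p.2) w = 0 := by simp
    rw [e, sub_zero] at h1
    rw [← h1] at h4
    exact h4
  ext w
  have hw : w = ![w 0] := by funext i; fin_cases i; rfl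
  rw [hw]
  have hc := is_const_of_deriv_eq_zero (fun t => (key (w 0) t).differentiableAt)
    (fun t => (key (w 0) t).deriv) 1 0
  simp only [one_smul, zero_smul, h0] at hc
  exact hc

end Poincare

/-! ### Charts of the total space of a vector bundle -/

section BundleCharts

variable {EM : Type*} [NormedAddCommGroup EM] [NormedSpace ℝ EM]
  {M : Type*} [TopologicalSpace M] [ChartedSpace EM M]
  {F : Type*} [NormedAddCommGroup F] [NormedSpace ℝ F]
  {E : M → Type*} [∀ x, AddCommGroup (E x)] [∀ x, Module ℝ (E x)] [∀ x, TopologicalSpace (E x)]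
  [TopologicalSpace (TotalSpace F E)] [FiberBundle F E] [VectorBundle ℝ F E]

/-- The model with corners of the total space of a bundle. -/
local notation "𝓙" => ModelWithCorners.prod 𝓘(ℝ, EM) 𝓘(ℝ, F)

/-- The domain in the base of the bundle chart at `z₀`. -/
noncomputable def bundleChartBase (EM : Type*) [NormedAddCommGroup EM] [NormedSpace ℝ EM] [ChartedSpace EM M]
    (z₀ : TotalSpace F E) : Set EM :=
  (extChartAt 𝓘(ℝ, EM) z₀.proj).target ∩
    (extChartAt 𝓘(ℝ, EM) z₀.proj).symm ⁻¹' (trivializationAt F E z₀.proj).baseSet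

/-- Bundle charts contain entire fibers, so radial scaling never leaves the chart and the homotopy
operator can be applied in it. -/
theorem bundleChart_target (z₀ : TotalSpace F E) :
    (extChartAt 𝓙 z₀).target = bundleChartBase EM z₀ ×ˢ univ :=
  FiberBundle.extChartAt_target z₀

theorem isOpen_bundleChartBase (z₀ : TotalSpace F E) : IsOpen (bundleChartBase EM z₀) :=
  (continuousOn_extChartAt_symm z₀.proj).isOpen_inter_preimage
    (isOpen_extChartAt_target z₀.proj) (trivializationAt F E z₀.proj).open_baseSet

theorem bundleChart_symm (z₀ : TotalSpace F E) {p : EM × F} (hp : p.1 ∈ bundleChartBase EM z₀) :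
    (extChartAt 𝓙 z₀).symm p = ⟨(extChartAt 𝓘(ℝ, EM) z₀.proj).symm p.1,
      ((trivializationAt F E z₀.proj).continuousLinearEquivAt ℝ
        ((extChartAt 𝓘(ℝ, EM) z₀.proj).symm p.1) hp.2).symm p.2⟩ := by
  rw [FiberBundle.extChartAt]
  exact ((trivializationAt F E z₀.proj).mk_symm hp.2 p.2).symm

theorem bundleChart_symm_proj (z₀ : TotalSpace F E) {p : EM × F}
    (hp : p.1 ∈ bundleChartBase EM z₀) :
    ((extChartAt 𝓙 z₀).symm p).proj = (extChartAt 𝓘(ℝ, EM) z₀.proj).symm p.1 := by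
  rw [bundleChart_symm z₀ hp]

theorem bundleChart_symm_zero (z₀ : TotalSpace F E) {y : EM}
    (hy : y ∈ bundleChartBase EM z₀) :
    (extChartAt 𝓙 z₀).symm (y, 0) = ⟨(extChartAt 𝓘(ℝ, EM) z₀.proj).symm y, 0⟩ := by
  rw [bundleChart_symm z₀ (p := (y, 0)) hy]
  exact congrArg (TotalSpace.mk _) (map_zero ((trivializationAt F E z₀.proj).continuousLinearEquivAt
    ℝ _ hy.2).symm)

theorem bundleChart_apply (z₀ z : TotalSpace F E) :
    extChartAt 𝓙 z₀ z = (extChartAt 𝓘(ℝ, EM) z₀.proj (trivializationAt F E z₀.proj z).1,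
      (trivializationAt F E z₀.proj z).2) := by
  rw [FiberBundle.extChartAt]
  rfl

theorem bundleChart_source (z₀ z : TotalSpace F E) :
    z ∈ (extChartAt 𝓙 z₀).source ↔ z.proj ∈ (trivializationAt F E z₀.proj).baseSet ∧
      z.proj ∈ (extChartAt 𝓘(ℝ, EM) z₀.proj).source := by
  rw [FiberBundle.extChartAt]
  simp only [mfld_simps]
  constructor
  · rintro ⟨h1, h2⟩
    rw [(trivializationAt F E z₀.proj).coe_fst h1] at h2
    exact ⟨(trivializationAt F E z₀.proj).mem_source.1 h1, h2⟩
  · rintro ⟨h1, h2⟩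
    have h3 := (trivializationAt F E z₀.proj).mem_source.2 h1
    refine ⟨h3, ?_⟩
    rwa [(trivializationAt F E z₀.proj).coe_fst h3]

theorem bundleChart_apply_fst (z₀ : TotalSpace F E) {z : TotalSpace F E}
    (hz : z ∈ (extChartAt 𝓙 z₀).source) :
    (extChartAt 𝓙 z₀ z).1 = extChartAt 𝓘(ℝ, EM) z₀.proj z.proj := by
  rw [bundleChart_apply]
  simp only
  rw [(trivializationAt F E z₀.proj).coe_fst ((trivializationAt F E z₀.proj).mem_source.2
    ((bundleChart_source z₀ z).1 hz).1)]

/-- Fiberwise multiplication by a scalar. -/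
noncomputable def TotalSpace.scale (t : ℝ) (z : TotalSpace F E) : TotalSpace F E := ⟨z.proj, t • z.2⟩

/-- Local trivializations are linear in the fibers, so they intertwine the intrinsic scaling with
`scaleSnd`. -/
theorem TotalSpace.scale_bundleChart_symm (z₀ : TotalSpace F E) {p : EM × F}
    (hp : p.1 ∈ bundleChartBase EM z₀) (t : ℝ) :
    TotalSpace.scale t ((extChartAt 𝓙 z₀).symm p) = (extChartAt 𝓙 z₀).symm (scaleSnd EM F t p) := by
  have hp' : (scaleSnd EM F t p).1 ∈ bundleChartBase EM z₀ := hp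
  rw [bundleChart_symm z₀ hp, bundleChart_symm z₀ hp']
  exact congrArg (TotalSpace.mk _) (map_smul ((trivializationAt F E z₀.proj).continuousLinearEquivAt
    ℝ _ hp.2).symm t p.2).symm

variable [IsManifold 𝓘(ℝ, EM) ∞ M] [ContMDiffVectorBundle ∞ F E 𝓘(ℝ, EM)]

theorem TotalSpace.contMDiff_scale (t : ℝ) :
    ContMDiff 𝓙 𝓙 ∞ (TotalSpace.scale t : TotalSpace F E → TotalSpace F E) := by
  intro z
  have h1 : ContMDiffAt 𝓙 𝓙 ∞ ((extChartAt 𝓙 z).symm ∘ (scaleSnd EM F t ∘ extChartAt 𝓙 z)) z := by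
    have h2 := contMDiffAt_extChartAt (I := 𝓙) (n := ∞) (x := z)
    have h3 : ContMDiffAt 𝓘(ℝ, EM × F) 𝓘(ℝ, EM × F) ∞ (scaleSnd EM F t) (extChartAt 𝓙 z z) :=
      (scaleSnd EM F t).contDiff.contMDiff.contMDiffAt
    have h4 : scaleSnd EM F t (extChartAt 𝓙 z z) ∈ (extChartAt 𝓙 z).target := by
      have := mem_extChartAt_target (I := 𝓙) z
      rw [bundleChart_target] at this ⊢
      exact ⟨this.1, mem_univ _⟩
    exact ContMDiffAt.comp z (contMDiffAt_extChartAt_symm h4) (h3.comp z h2)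
  refine h1.congr_of_eventuallyEq ?_
  filter_upwards [extChartAt_source_mem_nhds (I := 𝓙) z] with w hw
  have h5 := (extChartAt 𝓙 z).map_source hw
  rw [bundleChart_target] at h5
  simp only [Function.comp_apply]
  rw [← TotalSpace.scale_bundleChart_symm z h5.1, (extChartAt 𝓙 z).left_inv hw]

theorem mfderiv_scale_bundleChart_symm (z₀ : TotalSpace F E) {p : EM × F}
    (hp : p.1 ∈ bundleChartBase EM z₀) (t : ℝ) (w : EM × F) :
    (mfderiv 𝓙 𝓙 (TotalSpace.scale t) ((extChartAt 𝓙 z₀).symm p)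
      (mfderiv 𝓘(ℝ, EM × F) 𝓙 (extChartAt 𝓙 z₀).symm p w) : EM × F) =
    mfderiv 𝓘(ℝ, EM × F) 𝓙 (extChartAt 𝓙 z₀).symm (scaleSnd EM F t p) (scaleSnd EM F t w) := by
  have hp1 : p ∈ (extChartAt 𝓙 z₀).target := by
    rw [bundleChart_target]; exact ⟨hp, mem_univ _⟩
  have hp2 : scaleSnd EM F t p ∈ (extChartAt 𝓙 z₀).target := by
    rw [bundleChart_target]; exact ⟨hp, mem_univ _⟩
  have h1 := mfderiv_comp (I' := 𝓙) (I'' := 𝓙) p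
    ((TotalSpace.contMDiff_scale (F := F) (E := E) t _).mdifferentiableAt (by simp))
    (mdifferentiableAt_extChartAt_symm hp1)
  have h2 := mfderiv_comp (I := 𝓘(ℝ, EM × F)) p (mdifferentiableAt_extChartAt_symm hp2)
    (scaleSnd EM F t).differentiableAt.mdifferentiableAt
  have h3 : TotalSpace.scale t ∘ (extChartAt 𝓙 z₀).symm =ᶠ[𝓝 p]
      (extChartAt 𝓙 z₀).symm ∘ scaleSnd EM F t := by
    filter_upwards [(isOpen_extChartAt_target z₀).mem_nhds hp1] with q hq
    rw [bundleChart_target] at hq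
    exact TotalSpace.scale_bundleChart_symm z₀ hq.1 t
  have h4 := h3.mfderiv_eq (I := 𝓘(ℝ, EM × F)) (I' := 𝓙)
  have h5 : mfderiv 𝓘(ℝ, EM × F) 𝓘(ℝ, EM × F) (scaleSnd EM F t) p = scaleSnd EM F t := by
    rw [mfderiv_eq_fderiv]
    exact (scaleSnd EM F t).fderiv
  rw [h5] at h2
  have h6 := congrArg (fun l : (EM × F) →L[ℝ] (EM × F) => l w) h1
  have h7 := congrArg (fun l : (EM × F) →L[ℝ] (EM × F) => l w) h2
  have h8 := congrArg (fun l : (EM × F) →L[ℝ] (EM × F) => l w) h4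
  exact h6.symm.trans (h8.trans h7)

theorem mfderiv_scale_param (z₀ : TotalSpace F E) {p : EM × F}
    (hp : p.1 ∈ bundleChartBase EM z₀) (t : ℝ) :
    (mfderiv 𝓘(ℝ, ℝ) 𝓙 (fun s => TotalSpace.scale s ((extChartAt 𝓙 z₀).symm p)) t (1 : ℝ) :
      EM × F) =
    mfderiv 𝓘(ℝ, EM × F) 𝓙 (extChartAt 𝓙 z₀).symm (scaleSnd EM F t p) ((0, p.2) : EM × F) := by
  have hp2 : scaleSnd EM F t p ∈ (extChartAt 𝓙 z₀).target := by
    rw [bundleChart_target]; exact ⟨hp, mem_univ _⟩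
  have h : HasDerivAt (fun t : ℝ => (p.1, t • p.2)) ((0 : EM), (1 : ℝ) • p.2) t :=
    (hasDerivAt_const t p.1).prodMk ((hasDerivAt_id t).smul_const p.2)
  have h2 := mfderiv_comp (I := 𝓘(ℝ, ℝ)) (f := fun t : ℝ => scaleSnd EM F t p) t
    (mdifferentiableAt_extChartAt_symm hp2) h.differentiableAt.mdifferentiableAt
  have h3 : (fun s => TotalSpace.scale s ((extChartAt 𝓙 z₀).symm p)) =
      (extChartAt 𝓙 z₀).symm ∘ fun t : ℝ => scaleSnd EM F t p :=
    funext fun s => TotalSpace.scale_bundleChart_symm z₀ hp s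
  rw [h3]
  refine (congrArg (fun l : ℝ →L[ℝ] (EM × F) => l 1) h2).trans ?_
  have h4 : mfderiv 𝓘(ℝ, ℝ) 𝓘(ℝ, EM × F) (fun t : ℝ => scaleSnd EM F t p) t (1 : ℝ) =
      ((0 : EM), p.2) := by
    rw [mfderiv_eq_fderiv]
    have : fderiv ℝ (fun t : ℝ => (p.1, t • p.2)) t 1 = _ := h.deriv
    rw [one_smul] at this
    exact this
  exact congrArg (mfderiv 𝓘(ℝ, EM × F) 𝓙 (extChartAt 𝓙 z₀).symm (scaleSnd EM F t p)) h4

theorem mfderiv_proj_bundleChart_symm (z₀ : TotalSpace F E) {p : EM × F}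
    (hp : p.1 ∈ bundleChartBase EM z₀) (w : EM × F) :
    (mfderiv 𝓙 𝓘(ℝ, EM) (TotalSpace.proj : TotalSpace F E → M) ((extChartAt 𝓙 z₀).symm p)
      (mfderiv 𝓘(ℝ, EM × F) 𝓙 (extChartAt 𝓙 z₀).symm p w) : EM) =
    mfderiv 𝓘(ℝ, EM) 𝓘(ℝ, EM) (extChartAt 𝓘(ℝ, EM) z₀.proj).symm p.1 w.1 := by
  have hp1 : p ∈ (extChartAt 𝓙 z₀).target := by
    rw [bundleChart_target]; exact ⟨hp, mem_univ _⟩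
  have h1 := mfderiv_comp (I' := 𝓙) (I'' := 𝓘(ℝ, EM)) p
    ((Bundle.contMDiffAt_proj E (n := ∞)).mdifferentiableAt (by simp))
    (mdifferentiableAt_extChartAt_symm hp1)
  have h2 := mfderiv_comp (I := 𝓘(ℝ, EM × F)) (f := (Prod.fst : EM × F → EM)) p
    (mdifferentiableAt_extChartAt_symm (x₀ := z₀.proj) (I := 𝓘(ℝ, EM)) hp.1)
    (differentiableAt_fst.mdifferentiableAt)
  have h3 : (TotalSpace.proj : TotalSpace F E → M) ∘ (extChartAt 𝓙 z₀).symm =ᶠ[𝓝 p]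
      (extChartAt 𝓘(ℝ, EM) z₀.proj).symm ∘ Prod.fst := by
    filter_upwards [(isOpen_extChartAt_target z₀).mem_nhds hp1] with q hq
    rw [bundleChart_target] at hq
    exact bundleChart_symm_proj z₀ hq.1
  have h4 := h3.mfderiv_eq (I := 𝓘(ℝ, EM × F)) (I' := 𝓘(ℝ, EM))
  have h5 : mfderiv 𝓘(ℝ, EM × F) 𝓘(ℝ, EM) (Prod.fst : EM × F → EM) p =
      ContinuousLinearMap.fst ℝ EM F := by
    rw [mfderiv_eq_fderiv]
    exact fderiv_fst
  rw [h5] at h2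
  have h6 := congrArg (fun l : (EM × F) →L[ℝ] EM => l w) h1
  have h7 := congrArg (fun l : (EM × F) →L[ℝ] EM => l w) h2
  have h8 := congrArg (fun l : (EM × F) →L[ℝ] EM => l w) h4
  exact h6.symm.trans (h8.trans h7)

theorem mfderiv_bundleChart_fst (z : TotalSpace F E) (v : TangentSpace 𝓙 z)
    (hv : mfderiv 𝓙 𝓘(ℝ, EM) (TotalSpace.proj : TotalSpace F E → M) z v = 0) :
    (mfderiv 𝓙 𝓘(ℝ, EM × F) (extChartAt 𝓙 z) z v : EM × F).1 = 0 := by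
  have hz := mem_extChartAt_source (I := 𝓙) z
  have h1 := mfderiv_comp (I := 𝓙) (I' := 𝓘(ℝ, EM × F)) (g := (Prod.fst : EM × F → EM)) z
    differentiableAt_fst.mdifferentiableAt (mdifferentiableAt_extChartAt_of_mem hz)
  have h2 := mfderiv_comp (I'' := 𝓘(ℝ, EM)) z
    (mdifferentiableAt_extChartAt_of_mem (mem_extChartAt_source (I := 𝓘(ℝ, EM)) z.proj))
    ((Bundle.contMDiffAt_proj E (n := ∞)).mdifferentiableAt (by simp))
  have h3 : Prod.fst ∘ extChartAt 𝓙 z =ᶠ[𝓝 z]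
      extChartAt 𝓘(ℝ, EM) z.proj ∘ (TotalSpace.proj : TotalSpace F E → M) := by
    filter_upwards [extChartAt_source_mem_nhds (I := 𝓙) z] with w hw
    exact bundleChart_apply_fst z hw
  have h4 := h3.mfderiv_eq (I := 𝓙) (I' := 𝓘(ℝ, EM))
  rw [mfderiv_eq_fderiv, fderiv_fst] at h1
  have h6 := congrArg (fun l : (EM × F) →L[ℝ] EM => l v) h1
  have h7 := congrArg (fun l : (EM × F) →L[ℝ] EM => l v) h2
  have h8 := congrArg (fun l : (EM × F) →L[ℝ] EM => l v) h4
  refine h6.symm.trans (h8.trans (h7.trans ?_))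
  refine (congrArg (mfderiv 𝓘(ℝ, EM) 𝓘(ℝ, EM) (extChartAt 𝓘(ℝ, EM) z.proj) z.proj) hv).trans ?_
  exact map_zero _

end BundleCharts

/-! ### The horizontal primitive -/

section HorizontalPrimitive

variable {EM : Type*} [NormedAddCommGroup EM] [NormedSpace ℝ EM] [FiniteDimensional ℝ EM]
  {M : Type*} [TopologicalSpace M] [ChartedSpace EM M] [IsManifold 𝓘(ℝ, EM) ∞ M]
  {F : Type*} [NormedAddCommGroup F] [NormedSpace ℝ F] [FiniteDimensional ℝ F]
  {E : M → Type*} [∀ x, AddCommGroup (E x)] [∀ x, Module ℝ (E x)] [∀ x, TopologicalSpace (E x)]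
  [TopologicalSpace (TotalSpace F E)] [FiberBundle F E] [VectorBundle ℝ F E]
  [ContMDiffVectorBundle ∞ F E 𝓘(ℝ, EM)]

/-- The model with corners of the total space of a bundle. -/
local notation "𝓙" => ModelWithCorners.prod 𝓘(ℝ, EM) 𝓘(ℝ, F)

/-- The vectors are compared in the common model space, which avoids transport between tangent
spaces at propositionally equal points. -/
theorem DiffForm.apply_congr_point {EN : Type*} [NormedAddCommGroup EN] [NormedSpace ℝ EN]
    {H' : Type*} [TopologicalSpace H'] {J : ModelWithCorners ℝ EN H'}
    {N : Type*} [TopologicalSpace N] [ChartedSpace H' N] {k : ℕ} (α : DiffForm J N k) {a b : N}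
    (hab : a = b) (v w : Fin k → EN) (h : ∀ i, v i = w i) :
    (α a : (TangentSpace J a) [⋀^Fin k]→L[ℝ] ℝ) v = α b w := by
  subst hab
  exact congrArg (α a) (funext h)

theorem smoothOn_inChart {β : DiffForm 𝓙 (TotalSpace F E) 2} (hβ : ∀ z, β.SmoothAt z)
    (z₀ : TotalSpace F E) :
    ContDiffOn ℝ ∞ (β.inChart z₀) (bundleChartBase EM z₀ ×ˢ univ) := by
  have := DiffForm.smoothOn_of_smoothAt (V := univ) (fun z _ => hβ z) z₀
  rwa [preimage_univ, inter_univ, bundleChart_target] at this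

/-- The right side depends on the chart only through a point and a tangent vector at it, since
scaling and its velocity are intrinsic to the vector bundle. Hence the homotopy operators of
different charts agree. -/
theorem radialIntegrand_inChart (β : DiffForm 𝓙 (TotalSpace F E) 2)
    (z₀ : TotalSpace F E) {p : EM × F} (hp : p.1 ∈ bundleChartBase EM z₀) (w : EM × F) (t : ℝ) :
    radialIntegrand (β.inChart z₀) p w t =
      β (TotalSpace.scale t ((extChartAt 𝓙 z₀).symm p))
        ![mfderiv 𝓘(ℝ, ℝ) 𝓙 (fun s => TotalSpace.scale s ((extChartAt 𝓙 z₀).symm p)) t (1 : ℝ),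
          mfderiv 𝓙 𝓙 (TotalSpace.scale t) ((extChartAt 𝓙 z₀).symm p)
            (mfderiv 𝓘(ℝ, EM × F) 𝓙 (extChartAt 𝓙 z₀).symm p w)] := by
  refine β.apply_congr_point (TotalSpace.scale_bundleChart_symm z₀ hp t).symm _ _ fun i => ?_
  fin_cases i
  · exact (mfderiv_scale_param z₀ hp t).symm
  · exact (mfderiv_scale_bundleChart_symm z₀ hp t w).symm

/-- The horizontal 1-form obtained from the 2-form `β` by the radial homotopy in the fibers. -/
noncomputable def fiberPrimitive (β : DiffForm 𝓙 (TotalSpace F E) 2) :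
    DiffForm 𝓙 (TotalSpace F E) 1 :=
  fun z => (radialPrimitive (β.inChart z) (extChartAt 𝓙 z z)).compContinuousLinearMap
    (mfderiv 𝓙 𝓘(ℝ, EM × F) (extChartAt 𝓙 z) z)

theorem fst_bundleChart_mem (z : TotalSpace F E) : (extChartAt 𝓙 z z).1 ∈ bundleChartBase EM z := by
  have := mem_extChartAt_target (I := 𝓙) z
  rw [bundleChart_target] at this
  exact this.1

/-- `fiberPrimitive` is defined at each point through the chart at that very point, so its
smoothness is not visible. Comparison of both integrals with the intrinsic integrand identifies it,
in one fixed chart, with the smooth `radialPrimitive`. -/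
theorem fiberPrimitive_inChart {β : DiffForm 𝓙 (TotalSpace F E) 2} (hβ : ∀ z, β.SmoothAt z)
    (z₀ : TotalSpace F E) {p : EM × F} (hp : p.1 ∈ bundleChartBase EM z₀) :
    (fiberPrimitive β).inChart z₀ p = radialPrimitive (β.inChart z₀) p := by
  ext w
  rw [radialPrimitive_apply (isOpen_bundleChartBase z₀) (smoothOn_inChart hβ z₀) hp]
  have e1 : (fiberPrimitive β).inChart z₀ p w =
      radialPrimitive (β.inChart ((extChartAt 𝓙 z₀).symm p))
        (extChartAt 𝓙 ((extChartAt 𝓙 z₀).symm p) ((extChartAt 𝓙 z₀).symm p))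
        (fun i => mfderiv 𝓙 𝓘(ℝ, EM × F) (extChartAt 𝓙 ((extChartAt 𝓙 z₀).symm p))
          ((extChartAt 𝓙 z₀).symm p)
          (mfderiv 𝓘(ℝ, EM × F) 𝓙 (extChartAt 𝓙 z₀).symm p (w i))) := rfl
  rw [e1]
  set z := (extChartAt 𝓙 z₀).symm p with hz
  refine (radialPrimitive_apply (isOpen_bundleChartBase z) (smoothOn_inChart hβ z)
    (fst_bundleChart_mem z) _).trans ?_
  congr 1
  funext t
  rw [radialIntegrand_inChart β z₀ hp]
  refine (radialIntegrand_inChart β z (fst_bundleChart_mem z) _ t).trans ?_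
  have e2 : (extChartAt 𝓙 z).symm (extChartAt 𝓙 z z) = z := extChartAt_to_inv z
  refine β.apply_congr_point (by rw [e2]) _ _ fun i => ?_
  have e3 := mfderiv_extChartAt_symm_comp (mem_extChartAt_source (I := 𝓙) z)
    (mfderiv 𝓘(ℝ, EM × F) 𝓙 (extChartAt 𝓙 z₀).symm p (w 0))
  fin_cases i
  · have : ∀ a b : TotalSpace F E, a = b →
        (mfderiv 𝓘(ℝ, ℝ) 𝓙 (fun s => TotalSpace.scale s a) t (1 : ℝ) : EM × F) =
          mfderiv 𝓘(ℝ, ℝ) 𝓙 (fun s => TotalSpace.scale s b) t (1 : ℝ) := by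
      rintro a _ rfl
      rfl
    exact this _ _ e2
  · have : ∀ a b : TotalSpace F E, a = b → ∀ v w : EM × F, v = w →
        (mfderiv 𝓙 𝓙 (TotalSpace.scale t) a v : EM × F) =
          mfderiv 𝓙 𝓙 (TotalSpace.scale t) b w := by
      rintro a _ rfl v _ rfl
      rfl
    exact this _ _ e2 _ _ e3

theorem fiberPrimitive_smoothAt {β : DiffForm 𝓙 (TotalSpace F E) 2} (hβ : ∀ z, β.SmoothAt z)
    (z : TotalSpace F E) : (fiberPrimitive β).SmoothAt z := by
  have hO := (isOpen_bundleChartBase (EM := EM) z).prod (isOpen_univ (X := F))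
  have hm := hO.mem_nhds ⟨fst_bundleChart_mem z, mem_univ _⟩
  refine ((contDiffOn_radialPrimitive (isOpen_bundleChartBase z)
    (smoothOn_inChart hβ z)).contDiffAt hm).congr_of_eventuallyEq ?_
  filter_upwards [hm] with p hp
  exact fiberPrimitive_inChart hβ z hp.1

/-- A smooth closed 2-form which vanishes on vertical vectors and on the zero section is the
differential of its fiberwise primitive. -/
theorem extD_fiberPrimitive {β : DiffForm 𝓙 (TotalSpace F E) 2} (hβ : ∀ z, β.SmoothAt z)
    (hd : β.extD = 0)
    (h0 : ∀ x, β.pullback (J := 𝓘(ℝ, EM)) (zeroSection F E) x = 0) (z : TotalSpace F E) :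
    (fiberPrimitive β).extD z = β z := by
  have hO := (isOpen_bundleChartBase (EM := EM) z).prod (isOpen_univ (X := F))
  have hm := hO.mem_nhds ⟨fst_bundleChart_mem z, mem_univ _⟩
  refine DiffForm.eq_of_inChart_eq (mem_extChartAt_source z) ?_
  rw [DiffForm.extD_inChart (mem_extChartAt_target z) (fiberPrimitive_smoothAt hβ _)]
  have e : (fiberPrimitive β).inChart z =ᶠ[𝓝 (extChartAt 𝓙 z z)]
      radialPrimitive (β.inChart z) := by
    filter_upwards [hm] with p hp
    exact fiberPrimitive_inChart hβ z hp.1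
  rw [e.extDeriv_eq]
  refine extDeriv_radialPrimitive (isOpen_bundleChartBase z) (smoothOn_inChart hβ z) ?_ ?_
    (fst_bundleChart_mem z)
  · intro p hp
    have hp' : p ∈ (extChartAt 𝓙 z).target := by
      rw [bundleChart_target]; exact ⟨hp, mem_univ _⟩
    rw [← DiffForm.extD_inChart hp' (hβ _), hd]
    rfl
  -- On horizontal vectors at `(y, 0)` the chart expression of `β` is that of its pullback by the
  -- zero section.
  · intro y hy a b
    have hy' : (y, (0 : F)) ∈ (extChartAt 𝓙 z).target := by
      rw [bundleChart_target]; exact ⟨hy, mem_univ _⟩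
    have i1 : HasFDerivAt (fun y : EM => (y, (0 : F))) (ContinuousLinearMap.inl ℝ EM F) y :=
      hasFDerivAt_prodMk_left y (0 : F)
    have h1 := DiffForm.pullback_pullback (J := 𝓘(ℝ, EM × F)) (K := 𝓘(ℝ, EM))
      (g := fun y : EM => (y, (0 : F))) (q := y) β
      (mdifferentiableAt_extChartAt_symm hy') i1.differentiableAt.mdifferentiableAt
    have h2 := DiffForm.pullback_pullback (J := 𝓘(ℝ, EM)) (K := 𝓘(ℝ, EM)) (f := zeroSection F E)
      (q := y) β ((Bundle.contMDiff_zeroSection ℝ E (n := ∞)).mdifferentiableAt (by simp))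
      (mdifferentiableAt_extChartAt_symm (x₀ := z.proj) (I := 𝓘(ℝ, EM)) hy.1)
    have h3 : (extChartAt 𝓙 z).symm ∘ (fun y : EM => (y, (0 : F))) =ᶠ[𝓝 y]
        zeroSection F E ∘ (extChartAt 𝓘(ℝ, EM) z.proj).symm := by
      filter_upwards [(isOpen_bundleChartBase z).mem_nhds hy] with y' hy'
      exact bundleChart_symm_zero z hy'
    have h4 := DiffForm.pullback_congr (J := 𝓘(ℝ, EM)) β h3
    have h5 := h1.trans (h4.trans (h2.symm.trans (DiffForm.pullback_eq_of_eq
      (α := β.pullback (zeroSection F E)) (β := 0) (h0 _))))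
    have h6 := congrArg (fun m => m ![a, b]) h5
    have h7 : mfderiv 𝓘(ℝ, EM) 𝓘(ℝ, EM × F) (fun y : EM => (y, (0 : F))) y =
      ContinuousLinearMap.inl ℝ EM F := by rw [mfderiv_eq_fderiv, i1.fderiv]
    refine Eq.trans ?_ h6
    refine congrArg (β.inChart z (y, 0)) (funext fun i => ?_)
    refine Eq.trans ?_ (congrArg (fun l : EM →L[ℝ] EM × F => l (![a, b] i)) h7).symm
    fin_cases i <;> rfl

theorem trivializationAt_fiberEquiv (x : M) (w : F) :
    (trivializationAt F E x (⟨x, fiberEquiv F E x w⟩ : TotalSpace F E)).2 = w :=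
  ((trivializationAt F E x).continuousLinearEquivAt ℝ x
    (mem_baseSet_trivializationAt F E x)).apply_symm_apply w

theorem contMDiff_fiberEquiv (x : M) : ContMDiff 𝓘(ℝ, F) 𝓙 ∞
    (fun w : F => (⟨x, fiberEquiv F E x w⟩ : TotalSpace F E)) := by
  intro w
  rw [contMDiffAt_totalSpace]
  refine ⟨contMDiffAt_const, ?_⟩
  simp only [trivializationAt_fiberEquiv]
  exact contMDiffAt_id

theorem DiffForm.pullback_const {EN : Type*} [NormedAddCommGroup EN] [NormedSpace ℝ EN]
    {H' : Type*} [TopologicalSpace H'] {J : ModelWithCorners ℝ EN H'}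
    {N : Type*} [TopologicalSpace N] [ChartedSpace H' N] {k : ℕ} (x : M)
    (α : DiffForm 𝓘(ℝ, EM) M (k + 1)) (y : N) : α.pullback (J := J) (fun _ => x) y = 0 := by
  ext v
  rw [DiffForm.pullback_apply, mfderiv_const]
  exact (α x).map_coord_zero 0 rfl

/-- A vertical vector has the form `(0, a)` in the chart, and scaling keeps it vertical, so the
integrand only sees the restriction of `β` to a fiber. -/
theorem fiberPrimitive_horizontal {β : DiffForm 𝓙 (TotalSpace F E) 2} (hβ : ∀ z, β.SmoothAt z)
    (hv : ∀ x (w : F), β.pullback (J := 𝓘(ℝ, F))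
      (fun w : F => (⟨x, fiberEquiv F E x w⟩ : TotalSpace F E)) w = 0)
    (z : TotalSpace F E) (v : TangentSpace 𝓙 z)
    (h : mfderiv 𝓙 𝓘(ℝ, EM) (TotalSpace.proj : TotalSpace F E → M) z v = 0) :
    fiberPrimitive β z ![v] = 0 := by
  have h1 := mfderiv_bundleChart_fst z v h
  have e : fiberPrimitive β z ![v] = radialPrimitive (β.inChart z) (extChartAt 𝓙 z z)
      ![(0, (mfderiv 𝓙 𝓘(ℝ, EM × F) (extChartAt 𝓙 z) z v : EM × F).2)] := by
    refine congrArg (radialPrimitive (β.inChart z) (extChartAt 𝓙 z z)) (funext fun i => ?_)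
    fin_cases i
    exact Prod.ext h1 rfl
  rw [e]
  refine radialPrimitive_vertical (isOpen_bundleChartBase z) (smoothOn_inChart hβ z) ?_
    (fst_bundleChart_mem z) _
  rintro ⟨y, v₀⟩ hy a b
  have hy' : (y, v₀) ∈ (extChartAt 𝓙 z).target := by
    rw [bundleChart_target]; exact ⟨hy, mem_univ _⟩
  have i1 : HasFDerivAt (fun v : F => (y, v)) (ContinuousLinearMap.inr ℝ EM F) v₀ :=
    hasFDerivAt_prodMk_right y v₀
  have h1 := DiffForm.pullback_pullback (J := 𝓘(ℝ, EM × F)) (K := 𝓘(ℝ, F))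
    (g := fun v : F => (y, v)) (q := v₀) β
    (mdifferentiableAt_extChartAt_symm hy') i1.differentiableAt.mdifferentiableAt
  let x := (extChartAt 𝓘(ℝ, EM) z.proj).symm y
  -- The fiber coordinate of the chart at `z` and that of `fiberEquiv` at `x` differ by a linear
  -- isomorphism, through which the hypothesis `hv` is transferred.
  let L : F ≃L[ℝ] F := ((trivializationAt F E z.proj).continuousLinearEquivAt ℝ x hy.2).symm.trans
    (fiberEquiv F E x).symm
  have h3 : (extChartAt 𝓙 z).symm ∘ (fun v : F => (y, v)) =
      (fun w : F => (⟨x, fiberEquiv F E x w⟩ : TotalSpace F E)) ∘ L := by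
    funext v
    have := bundleChart_symm z (p := (y, v)) hy
    simp only [Function.comp_apply, L, ContinuousLinearEquiv.trans_apply,
      ContinuousLinearEquiv.apply_symm_apply]
    exact this
  have hsm : MDifferentiableAt 𝓘(ℝ, F) 𝓙
      (fun w : F => (⟨x, fiberEquiv F E x w⟩ : TotalSpace F E)) (L v₀) :=
    (contMDiff_fiberEquiv (EM := EM) x _).mdifferentiableAt (by simp)
  have h2 := DiffForm.pullback_pullback (J := 𝓘(ℝ, F)) (K := 𝓘(ℝ, F))
    (g := L) (q := v₀) β hsm L.differentiableAt.mdifferentiableAt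
  rw [h3] at h1
  have h5 := h1.trans (h2.symm.trans (DiffForm.pullback_eq_of_eq
      (α := β.pullback _) (β := 0) (hv x _)))
  have h6 := congrArg (fun m => m ![a, b]) h5
  have h7 : mfderiv 𝓘(ℝ, F) 𝓘(ℝ, EM × F) (fun v : F => (y, v)) v₀ =
    ContinuousLinearMap.inr ℝ EM F := by rw [mfderiv_eq_fderiv, i1.fderiv]
  refine Eq.trans ?_ h6
  refine congrArg (β.inChart z (y, v₀)) (funext fun i => ?_)
  refine Eq.trans ?_ (congrArg (fun l : F →L[ℝ] EM × F => l (![a, b] i)) h7).symm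
  fin_cases i <;> rfl

theorem fiberPrimitive_zero {β : DiffForm 𝓙 (TotalSpace F E) 2} (hβ : ∀ z, β.SmoothAt z) (x : M) :
    fiberPrimitive β (⟨x, 0⟩ : TotalSpace F E) = 0 := by
  set z : TotalSpace F E := ⟨x, 0⟩
  have e : extChartAt 𝓙 z z = ((extChartAt 𝓙 z z).1, 0) := by
    refine Prod.ext rfl ?_
    rw [bundleChart_apply]
    exact (trivializationAt F E x).linear ℝ (mem_baseSet_trivializationAt F E x) |>.map_zero
  rw [fiberPrimitive, e, radialPrimitive_zero (isOpen_bundleChartBase z) (smoothOn_inChart hβ z)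
    (fst_bundleChart_mem z)]
  rfl

/-- A closed horizontal 1-form which vanishes along the zero section is zero. -/
theorem eq_zero_of_horizontal_of_extD_eq_zero {ψ : DiffForm 𝓙 (TotalSpace F E) 1}
    (hψ : ∀ z, ψ.SmoothAt z)
    (hh : ∀ (z : TotalSpace F E) (v : TangentSpace 𝓙 z),
      mfderiv 𝓙 𝓘(ℝ, EM) (TotalSpace.proj : TotalSpace F E → M) z v = 0 → ψ z ![v] = 0)
    (h0 : ∀ x, ψ ⟨x, 0⟩ = 0) (hd : ψ.extD = 0) : ψ = 0 := by
  funext z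
  refine DiffForm.eq_of_inChart_eq (mem_extChartAt_source (I := 𝓙) z) ?_
  have hs : ContDiffOn ℝ ∞ (ψ.inChart z) (bundleChartBase EM z ×ˢ univ) := by
    have := DiffForm.smoothOn_of_smoothAt (V := univ) (fun z _ => hψ z) z
    rwa [preimage_univ, inter_univ, bundleChart_target] at this
  have ht : ∀ p : EM × F, p.1 ∈ bundleChartBase EM z → p ∈ (extChartAt 𝓙 z).target := by
    intro p hp
    rw [bundleChart_target]; exact ⟨hp, mem_univ _⟩
  refine (eq_zero_of_extDeriv_eq_zero (isOpen_bundleChartBase z) (hs.differentiableOn (by simp))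
    (fst_bundleChart_mem z) ?_ ?_ ?_).trans ?_
  · intro v
    rw [← DiffForm.extD_inChart (ht (_, v) (fst_bundleChart_mem z)) (hψ _), hd]
    rfl
  · intro q hq b
    have e : ψ.inChart z q ![(0, b)] = ψ ((extChartAt 𝓙 z).symm q)
        ![mfderiv 𝓘(ℝ, EM × F) 𝓙 (extChartAt 𝓙 z).symm q ((0, b) : EM × F)] := by
      refine congrArg (ψ ((extChartAt 𝓙 z).symm q)) (funext fun i => ?_)
      fin_cases i
      rfl
    rw [e]
    refine hh _ _ ?_
    refine (mfderiv_proj_bundleChart_symm z hq _).trans ?_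
    exact map_zero _
  · have : ψ ((extChartAt 𝓙 z).symm ((extChartAt 𝓙 z z).1, (0 : F))) = 0 := by
      rw [bundleChart_symm_zero z (fst_bundleChart_mem z)]
      exact h0 _
    simp only [DiffForm.inChart, this]
    rfl
  · rfl

namespace LagrangianField

variable {om : DiffForm 𝓘(ℝ, EM) M 2}

theorem IsHorizontalPrimitive.smoothAt {Λ : LagrangianField om F E}
    {φ : DiffForm 𝓙 (TotalSpace F E) 1} (h : Λ.IsHorizontalPrimitive φ) (z : TotalSpace F E) :
    φ.SmoothAt z := h.smooth.smoothAt Filter.univ_mem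

/-- The 2-form `lam^* om - π^* om`. -/
noncomputable def defect (Λ : LagrangianField om F E) : DiffForm 𝓙 (TotalSpace F E) 2 :=
  om.pullback Λ.lam - om.pullback (TotalSpace.proj : TotalSpace F E → M)

theorem exists_isHorizontalPrimitive (hom : om.IsSymplecticOn univ) (Λ : LagrangianField om F E) :
    ∃ φ, Λ.IsHorizontalPrimitive φ := by
  have hs : ∀ x, om.SmoothAt x := fun x => hom.smooth.smoothAt Filter.univ_mem
  have hπ : ContMDiff 𝓙 𝓘(ℝ, EM) ∞ (TotalSpace.proj : TotalSpace F E → M) :=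
    Bundle.contMDiff_proj E
  have h1 : ∀ z, (om.pullback (J := 𝓙) Λ.lam).SmoothAt z := fun z =>
    (hs _).pullback (Filter.Eventually.of_forall fun w => Λ.smooth w)
  have h2 : ∀ z, (om.pullback (J := 𝓙) (TotalSpace.proj : TotalSpace F E → M)).SmoothAt z :=
    fun z => (hs _).pullback (Filter.Eventually.of_forall fun w => hπ w)
  have hβ : ∀ z, Λ.defect.SmoothAt z := fun z => (h1 z).sub (h2 z)
  have hc : om.extD = 0 := funext fun x => hom.closed x (mem_univ x)
  have hd : Λ.defect.extD = 0 := by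
    funext z
    rw [defect, DiffForm.extD_sub (h1 z) (h2 z),
      DiffForm.extD_pullback (hs _) (Filter.Eventually.of_forall fun w => Λ.smooth w),
      DiffForm.extD_pullback (hs _) (Filter.Eventually.of_forall fun w => hπ w), hc]
    exact sub_self _
  have h0 : ∀ x, Λ.defect.pullback (J := 𝓘(ℝ, EM)) (zeroSection F E) x = 0 := by
    intro x
    have hz : MDifferentiableAt 𝓘(ℝ, EM) 𝓙 (zeroSection F E) x :=
      (Bundle.contMDiff_zeroSection ℝ E (n := ∞)).mdifferentiableAt (by simp)
    rw [defect, DiffForm.pullback_sub]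
    change DiffForm.pullback _ (DiffForm.pullback _ _) x - DiffForm.pullback _ (DiffForm.pullback _ _) x = 0
    rw [DiffForm.pullback_pullback om ((Λ.smooth _).mdifferentiableAt (by simp)) hz,
      DiffForm.pullback_pullback om ((hπ _).mdifferentiableAt (by simp)) hz]
    have e1 : Λ.lam ∘ zeroSection F E = id := funext Λ.zero
    have e2 : (TotalSpace.proj : TotalSpace F E → M) ∘ zeroSection F E = id := rfl
    rw [e1, e2, sub_self]
  have hv : ∀ x (w : F), Λ.defect.pullback (J := 𝓘(ℝ, F))
      (fun w : F => (⟨x, fiberEquiv F E x w⟩ : TotalSpace F E)) w = 0 := by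
    intro x w
    have hi : MDifferentiableAt 𝓘(ℝ, F) 𝓙
        (fun w : F => (⟨x, fiberEquiv F E x w⟩ : TotalSpace F E)) w :=
      (contMDiff_fiberEquiv (EM := EM) x _).mdifferentiableAt (by simp)
    rw [defect, DiffForm.pullback_sub]
    change DiffForm.pullback _ (DiffForm.pullback _ _) w -
      DiffForm.pullback _ (DiffForm.pullback _ _) w = 0
    rw [DiffForm.pullback_pullback om ((Λ.smooth _).mdifferentiableAt (by simp)) hi,
      DiffForm.pullback_pullback om ((hπ _).mdifferentiableAt (by simp)) hi]
    have e1 : om.pullback (J := 𝓘(ℝ, F))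
        (Λ.lam ∘ fun w : F => (⟨x, fiberEquiv F E x w⟩ : TotalSpace F E)) w = 0 := Λ.isotropic x w
    have e2 : om.pullback (J := 𝓘(ℝ, F)) ((TotalSpace.proj : TotalSpace F E → M) ∘
        fun w : F => (⟨x, fiberEquiv F E x w⟩ : TotalSpace F E)) w = 0 :=
      DiffForm.pullback_const x om w
    rw [e1, e2, sub_self]
  refine ⟨fiberPrimitive Λ.defect, DiffForm.smoothOn_of_smoothAt fun z _ =>
    fiberPrimitive_smoothAt hβ z, fiberPrimitive_horizontal hβ hv, fiberPrimitive_zero hβ, ?_⟩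
  funext z
  exact (extD_fiberPrimitive hβ hd h0 z).symm

theorem IsHorizontalPrimitive.unique {Λ : LagrangianField om F E}
    {φ φ' : DiffForm 𝓙 (TotalSpace F E) 1} (h : Λ.IsHorizontalPrimitive φ)
    (h' : Λ.IsHorizontalPrimitive φ') : φ = φ' := by
  refine sub_eq_zero.1 (eq_zero_of_horizontal_of_extD_eq_zero
    (fun z => (h.smoothAt z).sub (h'.smoothAt z)) ?_ ?_ ?_)
  · intro z v hv
    change φ z ![v] - φ' z ![v] = 0
    rw [h.horizontal z v hv, h'.horizontal z v hv, sub_zero]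
  · intro x
    change φ _ - φ' _ = 0
    rw [h.zero, h'.zero, sub_zero]
  · funext z
    rw [DiffForm.extD_sub (h.smoothAt z) (h'.smoothAt z), ← h.eq_d, ← h'.eq_d]
    exact sub_self _

end LagrangianField

end HorizontalPrimitive

/-! ### The canonical form of the cotangent bundle -/

section Cotangent

variable {EM : Type*} [NormedAddCommGroup EM] [NormedSpace ℝ EM] [FiniteDimensional ℝ EM]
  {M : Type*} [TopologicalSpace M] [ChartedSpace EM M] [IsManifold 𝓘(ℝ, EM) ∞ M]

/-- A trivialization of the dual bundle precomposes a covector with the inverse of the tangent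
trivialization, which is the derivative of the inverse chart. -/
theorem cotangent_trivializationAt_apply (x₀ : M) (α : CotangentBundle EM M)
    (h : α.proj ∈ (extChartAt 𝓘(ℝ, EM) x₀).source) (w : EM) :
    (trivializationAt (EM →L[ℝ] ℝ) (fun x : M => TangentSpace 𝓘(ℝ, EM) x →L[ℝ] ℝ) x₀ α).2 w =
      α.2 (mfderiv 𝓘(ℝ, EM) 𝓘(ℝ, EM) (extChartAt 𝓘(ℝ, EM) x₀).symm
        (extChartAt 𝓘(ℝ, EM) x₀ α.proj) w) := by
  have : IsManifold 𝓘(ℝ, EM) 1 M := .of_le (n := ∞) (by simp)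
  rw [extChartAt_source] at h
  have h1 := TangentBundle.symmL_trivializationAt (I := 𝓘(ℝ, EM)) h
  rw [ModelWithCorners.range_eq_univ, mfderivWithin_univ] at h1
  have h2 : (trivializationAt (EM →L[ℝ] ℝ)
      (fun x : M => TangentSpace 𝓘(ℝ, EM) x →L[ℝ] ℝ) x₀ α).2 w =
      (trivializationAt ℝ (Bundle.Trivial M ℝ) x₀).continuousLinearMapAt ℝ α.proj
        (α.2 ((trivializationAt EM (TangentSpace 𝓘(ℝ, EM)) x₀).symmL ℝ α.proj w)) := rfl
  have h3 := Bundle.Trivial.continuousLinearMapAt_trivialization (𝕜 := ℝ) M ℝ α.proj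
  refine h2.trans ((congrArg (fun l : ℝ →L[ℝ] ℝ => l _) h3).trans ?_)
  exact congrArg (fun l : EM →L[ℝ] EM => (α.2 : EM →L[ℝ] ℝ) (l w)) h1

/-- The classical `p dq`: in the chart induced on the cotangent bundle the coefficients of `θ` are
linear in the fiber coordinate, which gives its smoothness. -/
theorem canonicalOneForm_inChart (α₀ : CotangentBundle EM M) {q : EM × (EM →L[ℝ] ℝ)}
    (hq : q.1 ∈ bundleChartBase EM α₀) (w : Fin 1 → EM × (EM →L[ℝ] ℝ)) :
    (canonicalOneForm M).inChart α₀ q w = q.2 (w 0).1 := by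
  have hq' : q ∈ (extChartAt (cotangentModel EM) α₀).target := by
    rw [bundleChart_target]; exact ⟨hq, mem_univ _⟩
  set α := (extChartAt (cotangentModel EM) α₀).symm q with hα
  have h1 : (canonicalOneForm M).inChart α₀ q w = α.2 (mfderiv (cotangentModel EM) 𝓘(ℝ, EM)
      (TotalSpace.proj : CotangentBundle EM M → M) α
      (mfderiv 𝓘(ℝ, EM × (EM →L[ℝ] ℝ)) (cotangentModel EM)
        (extChartAt (cotangentModel EM) α₀).symm q (w 0))) := rfl
  have h2 := mfderiv_proj_bundleChart_symm α₀ hq (w 0)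
  have hp : α.proj = (extChartAt 𝓘(ℝ, EM) α₀.proj).symm q.1 := bundleChart_symm_proj α₀ hq
  have hs : α.proj ∈ (extChartAt 𝓘(ℝ, EM) α₀.proj).source := by
    rw [hp]; exact (extChartAt 𝓘(ℝ, EM) α₀.proj).map_target hq.1
  have h3 := cotangent_trivializationAt_apply α₀.proj α hs (w 0).1
  have h4 : extChartAt 𝓘(ℝ, EM) α₀.proj α.proj = q.1 := by
    rw [hp, (extChartAt 𝓘(ℝ, EM) α₀.proj).right_inv hq.1]
  have h5 : (trivializationAt (EM →L[ℝ] ℝ)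
      (fun x : M => TangentSpace 𝓘(ℝ, EM) x →L[ℝ] ℝ) α₀.proj α).2 = q.2 := by
    have := (extChartAt (cotangentModel EM) α₀).right_inv hq'
    rw [← hα, bundleChart_apply] at this
    exact congrArg Prod.snd this
  rw [h1, ← h5]
  rw [h4] at h3
  refine Eq.trans ?_ h3.symm
  exact congrArg (α.2 : EM →L[ℝ] ℝ) h2

theorem canonicalOneForm_smoothAt (α : CotangentBundle EM M) : (canonicalOneForm M).SmoothAt α := by
  have hm : bundleChartBase EM α ×ˢ univ ∈ 𝓝 (extChartAt (cotangentModel EM) α α) := by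
    rw [← bundleChart_target]
    exact extChartAt_target_mem_nhds α
  refine contDiffAt_alternating_iff.2 fun w => ?_
  have h : ContDiffAt ℝ ∞ (fun q : EM × (EM →L[ℝ] ℝ) => q.2 (w 0).1)
      (extChartAt (cotangentModel EM) α α) :=
    (contDiff_snd.clm_apply contDiff_const).contDiffAt
  refine h.congr_of_eventuallyEq ?_
  filter_upwards [hm] with q hq
  exact canonicalOneForm_inChart α hq.1 w

end Cotangent

/-! ### Horizontal 1-forms as maps to the cotangent bundle -/

section Horizontal

variable {EM : Type*} [NormedAddCommGroup EM] [NormedSpace ℝ EM] [FiniteDimensional ℝ EM]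
  {M : Type*} [TopologicalSpace M] [ChartedSpace EM M] [IsManifold 𝓘(ℝ, EM) ∞ M]
  {F : Type*} [NormedAddCommGroup F] [NormedSpace ℝ F] [FiniteDimensional ℝ F]
  {E : M → Type*} [∀ x, AddCommGroup (E x)] [∀ x, Module ℝ (E x)] [∀ x, TopologicalSpace (E x)]
  [TopologicalSpace (TotalSpace F E)] [FiberBundle F E] [VectorBundle ℝ F E]
  [ContMDiffVectorBundle ∞ F E 𝓘(ℝ, EM)]

/-- The model with corners of the total space of a bundle. -/
local notation "𝓙" => ModelWithCorners.prod 𝓘(ℝ, EM) 𝓘(ℝ, F)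

/-- A linear section of the derivative at `z` of the projection of a vector bundle. -/
noncomputable def horizontalLift (z : TotalSpace F E) : EM →L[ℝ] EM × F :=
  ContinuousLinearMap.comp (mfderiv 𝓘(ℝ, EM × F) 𝓙 (extChartAt 𝓙 z).symm (extChartAt 𝓙 z z))
    ((ContinuousLinearMap.inl ℝ EM F).comp
      (mfderiv 𝓘(ℝ, EM) 𝓘(ℝ, EM) (extChartAt 𝓘(ℝ, EM) z.proj) z.proj))

theorem mfderiv_proj_horizontalLift (z : TotalSpace F E) (w : EM) :
    (mfderiv 𝓙 𝓘(ℝ, EM) (TotalSpace.proj : TotalSpace F E → M) z (horizontalLift z w) : EM) =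
      w := by
  let w' : EM := mfderiv 𝓘(ℝ, EM) 𝓘(ℝ, EM) (extChartAt 𝓘(ℝ, EM) z.proj) z.proj w
  have h : ∀ z', z' = z → (mfderiv 𝓙 𝓘(ℝ, EM) (TotalSpace.proj : TotalSpace F E → M) z'
      (horizontalLift z w) : EM) = mfderiv 𝓘(ℝ, EM) 𝓘(ℝ, EM) (extChartAt 𝓘(ℝ, EM) z.proj).symm
        (extChartAt 𝓙 z z).1 w' →
      (mfderiv 𝓙 𝓘(ℝ, EM) (TotalSpace.proj : TotalSpace F E → M) z (horizontalLift z w) : EM) =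
        w := by
    rintro _ rfl h
    rw [bundleChart_apply_fst _ (mem_extChartAt_source _)] at h
    exact h.trans (mfderiv_extChartAt_symm_comp (mem_extChartAt_source (I := 𝓘(ℝ, EM)) _) w)
  exact h _ (extChartAt_to_inv z)
    (mfderiv_proj_bundleChart_symm z (fst_bundleChart_mem z) (w', (0 : F)))

/-- Alternating 1-forms are linear forms. -/
noncomputable def linearFormEquiv (X : Type*) [NormedAddCommGroup X] [NormedSpace ℝ X] :
    (X [⋀^Fin 1]→L[ℝ] ℝ) ≃ₗᵢ[ℝ] (X →L[ℝ] ℝ) :=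
  (ContinuousAlternatingMap.ofSubsingletonLIE (𝕜 := ℝ) (E := X) (F := ℝ) (0 : Fin 1)).symm

theorem linearFormEquiv_apply {X : Type*} [NormedAddCommGroup X] [NormedSpace ℝ X]
    (l : X [⋀^Fin 1]→L[ℝ] ℝ) (v : X) : linearFormEquiv X l v = l ![v] := by
  obtain ⟨l, rfl⟩ := (linearFormEquiv X).symm.surjective l
  rw [LinearIsometryEquiv.apply_symm_apply]
  rfl

/-- A tangent vector differs from the horizontal lift of its projection by a vertical vector, which
`ψ` annihilates; so `ψ` factors through the projection. The lift also shows that the projection is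
onto on tangent spaces, hence uniqueness. -/
theorem existsUnique_covector_of_horizontal {ψ : DiffForm 𝓙 (TotalSpace F E) 1}
    (hh : ∀ (z : TotalSpace F E) (v : TangentSpace 𝓙 z),
      mfderiv 𝓙 𝓘(ℝ, EM) (TotalSpace.proj : TotalSpace F E → M) z v = 0 → ψ z ![v] = 0) :
    ∃! c : ∀ p : TotalSpace F E, TangentSpace 𝓘(ℝ, EM) p.proj →L[ℝ] ℝ,
      ∀ (p : TotalSpace F E) (v : TangentSpace 𝓙 p),
        c p (mfderiv 𝓙 𝓘(ℝ, EM) (TotalSpace.proj : TotalSpace F E → M) p v) = ψ p ![v] := by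
  refine ⟨fun p => (ContinuousLinearMap.comp (linearFormEquiv (EM × F) (ψ p)) (horizontalLift p) : EM →L[ℝ] ℝ), ?_, ?_⟩
  · intro p v
    set w : EM := mfderiv 𝓙 𝓘(ℝ, EM) (TotalSpace.proj : TotalSpace F E → M) p v with hw
    have h1 : mfderiv 𝓙 𝓘(ℝ, EM) (TotalSpace.proj : TotalSpace F E → M) p
        (id (α := EM × F) v - horizontalLift p w) = 0 := by
      refine (map_sub (mfderiv 𝓙 𝓘(ℝ, EM) (TotalSpace.proj : TotalSpace F E → M) p) v
        (horizontalLift p w)).trans ?_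
      exact sub_eq_zero.2 (mfderiv_proj_horizontalLift p w).symm
    have h2 := hh p _ h1
    have h3 := (linearFormEquiv_apply (X := EM × F) (ψ p) (id (α := EM × F) v - horizontalLift p w)).trans h2
    rw [map_sub, sub_eq_zero] at h3
    exact h3.symm.trans (linearFormEquiv_apply (X := EM × F) (ψ p) v)
  · intro c hc
    funext p
    refine ContinuousLinearMap.ext fun (w : EM) => ?_
    refine Eq.trans ?_ ((hc p (horizontalLift p w)).trans (linearFormEquiv_apply (X := EM × F) (ψ p) _).symm)
    exact congrArg (c p : EM →L[ℝ] ℝ) (mfderiv_proj_horizontalLift p w).symm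

/-- In charts the fiber coordinate of the map is the restriction `G` of the coefficients of `ψ` to
base directions. -/
theorem contMDiff_covector {ψ : DiffForm 𝓙 (TotalSpace F E) 1}
    {c : ∀ p : TotalSpace F E, TangentSpace 𝓘(ℝ, EM) p.proj →L[ℝ] ℝ}
    (hψ : ∀ z, ψ.SmoothAt z)
    (hc : ∀ (p : TotalSpace F E) (v : TangentSpace 𝓙 p),
      c p (mfderiv 𝓙 𝓘(ℝ, EM) (TotalSpace.proj : TotalSpace F E → M) p v) = ψ p ![v]) :
    ContMDiff 𝓙 (cotangentModel EM) ∞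
      (fun p => ⟨p.proj, c p⟩ : TotalSpace F E → CotangentBundle EM M) := by
  intro p₀
  rw [contMDiffAt_totalSpace]
  refine ⟨Bundle.contMDiff_proj E p₀, ?_⟩
  let G : EM × F → EM →L[ℝ] ℝ := fun q =>
    (linearFormEquiv (EM × F) (ψ.inChart p₀ q)).comp (ContinuousLinearMap.inl ℝ EM F)
  have hG : ContDiffAt ℝ ∞ G (extChartAt 𝓙 p₀ p₀) :=
    ((linearFormEquiv (EM × F)).contDiff.contDiffAt.comp _ (hψ p₀)).clm_comp contDiffAt_const
  have h1 := hG.contMDiffAt.comp p₀ (contMDiffAt_extChartAt (I := 𝓙) (n := ∞) (x := p₀))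
  refine h1.congr_of_eventuallyEq ?_
  filter_upwards [extChartAt_source_mem_nhds (I := 𝓙) p₀] with p hp
  refine ContinuousLinearMap.ext fun w => ?_
  have hs := ((bundleChart_source (EM := EM) p₀ p).1 hp).2
  refine (cotangent_trivializationAt_apply p₀.proj ⟨p.proj, c p⟩ hs w).trans ?_
  have ht := (extChartAt 𝓙 p₀).map_source hp
  have hb : (extChartAt 𝓙 p₀ p).1 ∈ bundleChartBase EM p₀ := by
    rw [bundleChart_target] at ht; exact ht.1
  have h2 := mfderiv_proj_bundleChart_symm p₀ hb (w, 0)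
  have h3 : G (extChartAt 𝓙 p₀ p) w = ψ ((extChartAt 𝓙 p₀).symm (extChartAt 𝓙 p₀ p))
    ![mfderiv 𝓘(ℝ, EM × F) 𝓙 (extChartAt 𝓙 p₀).symm (extChartAt 𝓙 p₀ p) ((w, 0) : EM × F)] := by
    refine (linearFormEquiv_apply (X := EM × F) (ψ.inChart p₀ _) _).trans (congrArg (ψ ((extChartAt 𝓙 p₀).symm (extChartAt 𝓙 p₀ p))) (funext fun i => ?_))
    fin_cases i
    rfl
  refine Eq.trans ?_ h3.symm
  refine Eq.trans ?_ (hc _ _)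
  have h4 : ∀ p' : TotalSpace F E, p' = p → ∀ w₁ w₂ : EM, w₁ = w₂ →
      (c p : EM →L[ℝ] ℝ) w₁ = (c p' : EM →L[ℝ] ℝ) w₂ := by
    rintro _ rfl _ _ rfl
    rfl
  refine h4 _ ((extChartAt 𝓙 p₀).left_inv hp) _ _ ?_
  refine Eq.trans ?_ h2.symm
  exact congrArg (fun y => mfderiv 𝓘(ℝ, EM) 𝓘(ℝ, EM) (extChartAt 𝓘(ℝ, EM) p₀.proj).symm y w)
    (bundleChart_apply_fst p₀ hp).symm

/-- The tautological property of `θ`. It rests on the fact that the map to the cotangent bundle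
covers the identity of `M`. -/
theorem pullback_canonicalOneForm {ψ : DiffForm 𝓙 (TotalSpace F E) 1}
    {c : ∀ p : TotalSpace F E, TangentSpace 𝓘(ℝ, EM) p.proj →L[ℝ] ℝ}
    (hχ : ContMDiff 𝓙 (cotangentModel EM) ∞
      (fun p => ⟨p.proj, c p⟩ : TotalSpace F E → CotangentBundle EM M))
    (hc : ∀ (p : TotalSpace F E) (v : TangentSpace 𝓙 p),
      c p (mfderiv 𝓙 𝓘(ℝ, EM) (TotalSpace.proj : TotalSpace F E → M) p v) = ψ p ![v]) :
    (canonicalOneForm M).pullback (J := 𝓙)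
      (fun p => ⟨p.proj, c p⟩ : TotalSpace F E → CotangentBundle EM M) = ψ := by
  funext p
  refine ContinuousAlternatingMap.ext fun v => ?_
  have h1 := mfderiv_comp (I := 𝓙) (I' := cotangentModel EM) (I'' := 𝓘(ℝ, EM)) p
    (f := (fun p => ⟨p.proj, c p⟩ : TotalSpace F E → CotangentBundle EM M))
    (g := (TotalSpace.proj : CotangentBundle EM M → M))
    ((Bundle.contMDiffAt_proj _ (n := ∞)).mdifferentiableAt (by simp))
    ((hχ p).mdifferentiableAt (by simp))
  have h2 := congrArg (fun l : EM × F →L[ℝ] EM => (c p : EM →L[ℝ] ℝ) (l (v 0))) h1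
  have h3 : v = ![v 0] := by
    funext i; fin_cases i; rfl
  refine Eq.trans ?_ (((hc p (v 0)).trans (congrArg (ψ p) h3.symm)))
  exact h2.symm

end Horizontal

/-! ### The map to the cotangent bundle -/

section SumBundle

variable {EM : Type*} [NormedAddCommGroup EM] [NormedSpace ℝ EM] [FiniteDimensional ℝ EM]
  {M : Type*} [TopologicalSpace M] [ChartedSpace EM M] [IsManifold 𝓘(ℝ, EM) ∞ M]
  {F : Type*} [NormedAddCommGroup F] [NormedSpace ℝ F] [FiniteDimensional ℝ F]
  {E : M → Type*} [∀ x, AddCommGroup (E x)] [∀ x, Module ℝ (E x)] [∀ x, TopologicalSpace (E x)]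
  [TopologicalSpace (TotalSpace F E)] [FiberBundle F E] [VectorBundle ℝ F E]
  [ContMDiffVectorBundle ∞ F E 𝓘(ℝ, EM)]
  {F' : Type*} [NormedAddCommGroup F'] [NormedSpace ℝ F'] [FiniteDimensional ℝ F']
  {E' : M → Type*} [∀ x, AddCommGroup (E' x)] [∀ x, Module ℝ (E' x)]
  [∀ x, TopologicalSpace (E' x)] [TopologicalSpace (TotalSpace F' E')]
  [FiberBundle F' E'] [VectorBundle ℝ F' E'] [ContMDiffVectorBundle ∞ F' E' 𝓘(ℝ, EM)]

local notation "𝓙" => ModelWithCorners.prod 𝓘(ℝ, EM) 𝓘(ℝ, F)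
local notation "𝓙'" => ModelWithCorners.prod 𝓘(ℝ, EM) 𝓘(ℝ, F')
local notation "𝓚" => ModelWithCorners.prod 𝓘(ℝ, EM) 𝓘(ℝ, F × F')

theorem contMDiff_sumFst : ContMDiff 𝓚 𝓙 ∞ (sumFst F E F' E') := by
  intro p
  rw [contMDiffAt_totalSpace]
  have h := (contMDiffAt_totalSpace (F := F × F') (E := E ×ᵇ E') (IM := 𝓚) (IB := 𝓘(ℝ, EM))
    (n := ∞) (f := id) (x₀ := p)).1 contMDiffAt_id
  have h2 := (contDiff_fst (𝕜 := ℝ) (E := F) (F := F') (n := ∞)).contMDiff.contMDiffAt.comp p h.2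
  exact ⟨h.1, h2⟩

theorem contMDiff_sumSnd : ContMDiff 𝓚 𝓙' ∞ (sumSnd F E F' E') := by
  intro p
  rw [contMDiffAt_totalSpace]
  have h := (contMDiffAt_totalSpace (F := F × F') (E := E ×ᵇ E') (IM := 𝓚) (IB := 𝓘(ℝ, EM))
    (n := ∞) (f := id) (x₀ := p)).1 contMDiffAt_id
  have h2 := (contDiff_snd (𝕜 := ℝ) (E := F) (F := F') (n := ∞)).contMDiff.contMDiffAt.comp p h.2
  exact ⟨h.1, h2⟩

/-- The difference `τ'^* φ' - τ^* φ`. -/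
noncomputable def differenceForm (φ : DiffForm 𝓙 (TotalSpace F E) 1)
    (φ' : DiffForm 𝓙' (TotalSpace F' E') 1) :
    DiffForm 𝓚 (TotalSpace (F × F') (E ×ᵇ E')) 1 :=
  φ'.pullback (sumSnd F E F' E') - φ.pullback (sumFst F E F' E')

end SumBundle

/-! ### The derivative of a Lagrangian field along the zero section -/

section ZeroSection

variable {EM : Type*} [NormedAddCommGroup EM] [NormedSpace ℝ EM] [FiniteDimensional ℝ EM]
  {M : Type*} [TopologicalSpace M] [ChartedSpace EM M] [IsManifold 𝓘(ℝ, EM) ∞ M]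
  {F : Type*} [NormedAddCommGroup F] [NormedSpace ℝ F] [FiniteDimensional ℝ F]
  {E : M → Type*} [∀ x, AddCommGroup (E x)] [∀ x, Module ℝ (E x)] [∀ x, TopologicalSpace (E x)]
  [TopologicalSpace (TotalSpace F E)] [FiberBundle F E] [VectorBundle ℝ F E]
  [ContMDiffVectorBundle ∞ F E 𝓘(ℝ, EM)] {om : DiffForm 𝓘(ℝ, EM) M 2}

/-- The model with corners of the total space of a bundle. -/
local notation "𝓙" => ModelWithCorners.prod 𝓘(ℝ, EM) 𝓘(ℝ, F)

/-- The derivative at `0` of `lam` restricted to the fiber at `x`. -/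
noncomputable def LagrangianField.fiberDeriv (Λ : LagrangianField om F E) (x : M) : F →L[ℝ] EM :=
  mfderiv 𝓘(ℝ, F) 𝓘(ℝ, EM) (fun w : F => Λ.lam ⟨x, fiberEquiv F E x w⟩) 0

theorem bundleChart_zero (x : M) : extChartAt 𝓙 (⟨x, 0⟩ : TotalSpace F E) ⟨x, 0⟩ =
    (extChartAt 𝓘(ℝ, EM) x x, 0) := by
  refine Prod.ext (bundleChart_apply_fst _ (mem_extChartAt_source _)) ?_
  rw [bundleChart_apply]
  exact (trivializationAt F E x).linear ℝ (mem_baseSet_trivializationAt F E x) |>.map_zero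

/-- In the bundle chart the tangent space splits into base and fiber directions. Along the zero
section `lam` is the identity of `M`, which accounts for the first term; on the fiber its derivative
is `fiberDeriv` by definition. -/
theorem LagrangianField.mfderiv_lam_zero (Λ : LagrangianField om F E) (x : M) (u : EM × F) :
    (mfderiv 𝓙 𝓘(ℝ, EM) Λ.lam ⟨x, 0⟩ u : EM) =
      id (α := EM) (mfderiv 𝓙 𝓘(ℝ, EM) (TotalSpace.proj : TotalSpace F E → M) ⟨x, 0⟩ u) +
      Λ.fiberDeriv x (id (α := EM × F)
        (mfderiv 𝓙 𝓘(ℝ, EM × F) (extChartAt 𝓙 (⟨x, 0⟩ : TotalSpace F E)) ⟨x, 0⟩ u)).2 := by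
  set z : TotalSpace F E := ⟨x, 0⟩ with hz
  set y₀ : EM := extChartAt 𝓘(ℝ, EM) x x with hy₀
  have hy : y₀ ∈ bundleChartBase EM z := by
    have := fst_bundleChart_mem (EM := EM) z
    rwa [bundleChart_zero] at this
  have ht : (y₀, (0 : F)) ∈ (extChartAt 𝓙 z).target := by
    rw [bundleChart_target]; exact ⟨hy, mem_univ _⟩
  have hsz : (extChartAt 𝓙 z).symm (y₀, (0 : F)) = z := by
    rw [bundleChart_symm_zero z hy, hy₀, extChartAt_to_inv]
  let g : EM × F → M := Λ.lam ∘ (extChartAt 𝓙 z).symm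
  have hg : MDifferentiableAt 𝓘(ℝ, EM × F) 𝓘(ℝ, EM) g (y₀, (0 : F)) :=
    ((Λ.smooth _).mdifferentiableAt (by simp)).comp _ (mdifferentiableAt_extChartAt_symm ht)
  let D : EM × F →L[ℝ] EM := mfderiv 𝓘(ℝ, EM × F) 𝓘(ℝ, EM) g (y₀, (0 : F))
  -- horizontal part
  have h1 : ∀ w : EM, D (w, 0) =
      mfderiv 𝓘(ℝ, EM) 𝓘(ℝ, EM) (extChartAt 𝓘(ℝ, EM) x).symm y₀ w := by
    intro w
    have i1 : HasFDerivAt (fun y : EM => (y, (0 : F))) (ContinuousLinearMap.inl ℝ EM F) y₀ :=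
      hasFDerivAt_prodMk_left y₀ (0 : F)
    have h2 := mfderiv_comp (I := 𝓘(ℝ, EM)) (f := fun y : EM => (y, (0 : F))) y₀ hg
      i1.differentiableAt.mdifferentiableAt
    have h3 : g ∘ (fun y : EM => (y, (0 : F))) =ᶠ[𝓝 y₀] (extChartAt 𝓘(ℝ, EM) x).symm := by
      filter_upwards [(isOpen_bundleChartBase z).mem_nhds hy] with y' hy'
      simp only [g, Function.comp_apply]
      rw [bundleChart_symm_zero z hy']
      exact Λ.zero _
    have h4 := h3.mfderiv_eq (I := 𝓘(ℝ, EM)) (I' := 𝓘(ℝ, EM))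
    rw [mfderiv_eq_fderiv, i1.fderiv] at h2
    exact congrArg (fun l : EM →L[ℝ] EM => l w) (h2.symm.trans h4)
  -- vertical part
  have h2 : ∀ η : F, D (0, η) = Λ.fiberDeriv x η := by
    intro η
    have i1 : HasFDerivAt (fun w : F => (y₀, w)) (ContinuousLinearMap.inr ℝ EM F) 0 :=
      hasFDerivAt_prodMk_right y₀ 0
    have h2 := mfderiv_comp (I := 𝓘(ℝ, F)) (f := fun w : F => (y₀, w)) 0 hg
      i1.differentiableAt.mdifferentiableAt
    have h3 : g ∘ (fun w : F => (y₀, w)) = fun w : F => Λ.lam ⟨x, fiberEquiv F E x w⟩ := by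
      funext w
      simp only [g, Function.comp_apply]
      congr 1
      refine (extChartAt 𝓙 z).injOn ((extChartAt 𝓙 z).map_target ?_) ?_ ?_
      · rw [bundleChart_target]; exact ⟨hy, mem_univ _⟩
      · rw [bundleChart_source]
        exact ⟨mem_baseSet_trivializationAt F E x, mem_extChartAt_source (I := 𝓘(ℝ, EM)) x⟩
      · rw [(extChartAt 𝓙 z).right_inv (by rw [bundleChart_target]; exact ⟨hy, mem_univ _⟩)]
        have h5 : (⟨x, fiberEquiv F E x w⟩ : TotalSpace F E) ∈ (extChartAt 𝓙 z).source := by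
          rw [bundleChart_source]
          exact ⟨mem_baseSet_trivializationAt F E x, mem_extChartAt_source (I := 𝓘(ℝ, EM)) x⟩
        refine Prod.ext (bundleChart_apply_fst z h5).symm ?_
        rw [bundleChart_apply]
        exact (trivializationAt_fiberEquiv x w).symm
    rw [mfderiv_eq_fderiv, i1.fderiv, h3] at h2
    exact (congrArg (fun l : F →L[ℝ] EM => l η) h2).symm
  let v : EM × F := mfderiv 𝓙 𝓘(ℝ, EM × F) (extChartAt 𝓙 z) z u
  have h3 : (mfderiv 𝓙 𝓘(ℝ, EM) Λ.lam z u : EM) = D v := by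
    have e : extChartAt 𝓙 z z = (y₀, (0 : F)) := bundleChart_zero x
    have h4 := mfderiv_comp (I := 𝓙) (I' := 𝓘(ℝ, EM × F)) (g := g) z
      (by rw [e]; exact hg) (mdifferentiableAt_extChartAt_of_mem (mem_extChartAt_source z))
    have h5 : g ∘ extChartAt 𝓙 z =ᶠ[𝓝 z] Λ.lam := by
      filter_upwards [extChartAt_source_mem_nhds (I := 𝓙) z] with p hp
      simp only [g, Function.comp_apply]
      rw [(extChartAt 𝓙 z).left_inv hp]
    have h6 := h5.mfderiv_eq (I := 𝓙) (I' := 𝓘(ℝ, EM))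
    have h7 := congrArg (fun l : EM × F →L[ℝ] EM => l u) (h6.symm.trans h4)
    refine h7.trans ?_
    exact congrArg (fun y => (mfderiv 𝓘(ℝ, EM × F) 𝓘(ℝ, EM) g y : EM × F →L[ℝ] EM) v) e
  have h4 : (mfderiv 𝓙 𝓘(ℝ, EM) (TotalSpace.proj : TotalSpace F E → M) z u : EM) =
      mfderiv 𝓘(ℝ, EM) 𝓘(ℝ, EM) (extChartAt 𝓘(ℝ, EM) x).symm y₀ v.1 := by
    have h5 := mfderiv_proj_bundleChart_symm z (p := (y₀, (0 : F))) hy v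
    refine Eq.trans ?_ h5
    have h6 : ∀ z' p, z' = z → p = extChartAt 𝓙 z z →
        (mfderiv 𝓙 𝓘(ℝ, EM) (TotalSpace.proj : TotalSpace F E → M) z u : EM) =
        (mfderiv 𝓙 𝓘(ℝ, EM) (TotalSpace.proj : TotalSpace F E → M) z'
          (mfderiv 𝓘(ℝ, EM × F) 𝓙 (extChartAt 𝓙 z).symm p v) : EM) := by
      rintro _ _ rfl rfl
      exact congrArg (mfderiv 𝓙 𝓘(ℝ, EM) (TotalSpace.proj : TotalSpace F E → M) _)
        (mfderiv_extChartAt_symm_comp (I := 𝓙) (mem_extChartAt_source _) u).symm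
    exact h6 _ _ hsz (bundleChart_zero x).symm
  have h5 : D v = D (v.1, 0) + D (0, v.2) := by
    rw [← map_add]; simp
  refine h3.trans (h5.trans ?_)
  rw [h2, h1]
  exact congrArg (· + Λ.fiberDeriv x v.2) h4.symm

end ZeroSection

/-! ### The endpoint map and the map `χ` on `E ⊕ E'`, and their derivatives along the zero section
-/

section Sum

variable {EM : Type*} [NormedAddCommGroup EM] [NormedSpace ℝ EM] [FiniteDimensional ℝ EM]
  {M : Type*} [TopologicalSpace M] [ChartedSpace EM M] [IsManifold 𝓘(ℝ, EM) ∞ M]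
  {F : Type*} [NormedAddCommGroup F] [NormedSpace ℝ F] [FiniteDimensional ℝ F]
  {E : M → Type*} [∀ x, AddCommGroup (E x)] [∀ x, Module ℝ (E x)] [∀ x, TopologicalSpace (E x)]
  [TopologicalSpace (TotalSpace F E)] [FiberBundle F E] [VectorBundle ℝ F E]
  [ContMDiffVectorBundle ∞ F E 𝓘(ℝ, EM)]
  {F' : Type*} [NormedAddCommGroup F'] [NormedSpace ℝ F'] [FiniteDimensional ℝ F']
  {E' : M → Type*} [∀ x, AddCommGroup (E' x)] [∀ x, Module ℝ (E' x)]
  [∀ x, TopologicalSpace (E' x)] [TopologicalSpace (TotalSpace F' E')]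
  [FiberBundle F' E'] [VectorBundle ℝ F' E'] [ContMDiffVectorBundle ∞ F' E' 𝓘(ℝ, EM)]
  {om : DiffForm 𝓘(ℝ, EM) M 2} {Λ : LagrangianField om F E} {Λ' : LagrangianField om F' E'}
  {φ : DiffForm (ModelWithCorners.prod 𝓘(ℝ, EM) 𝓘(ℝ, F)) (TotalSpace F E) 1}
  {φ' : DiffForm (ModelWithCorners.prod 𝓘(ℝ, EM) 𝓘(ℝ, F')) (TotalSpace F' E') 1}

local notation "𝓙" => ModelWithCorners.prod 𝓘(ℝ, EM) 𝓘(ℝ, F)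
local notation "𝓙'" => ModelWithCorners.prod 𝓘(ℝ, EM) 𝓘(ℝ, F')
local notation "𝓚" => ModelWithCorners.prod 𝓘(ℝ, EM) 𝓘(ℝ, F × F')

theorem mdifferentiableAt_sumFst (p : TotalSpace (F × F') (E ×ᵇ E')) :
    MDifferentiableAt 𝓚 𝓙 (sumFst F E F' E') p := (contMDiff_sumFst p).mdifferentiableAt (by simp)

theorem mdifferentiableAt_sumSnd (p : TotalSpace (F × F') (E ×ᵇ E')) :
    MDifferentiableAt 𝓚 𝓙' (sumSnd F E F' E') p := (contMDiff_sumSnd p).mdifferentiableAt (by simp)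

theorem differenceForm_smoothAt (hφ : Λ.IsHorizontalPrimitive φ)
    (hφ' : Λ'.IsHorizontalPrimitive φ') (p : TotalSpace (F × F') (E ×ᵇ E')) :
    (differenceForm φ φ').SmoothAt p :=
  ((hφ'.smoothAt _).pullback (Filter.Eventually.of_forall fun w => contMDiff_sumSnd w)).sub
    ((hφ.smoothAt _).pullback (Filter.Eventually.of_forall fun w => contMDiff_sumFst w))

theorem mfderiv_proj_sumFst (p : TotalSpace (F × F') (E ×ᵇ E')) (v : TangentSpace 𝓚 p) :
    (mfderiv 𝓙 𝓘(ℝ, EM) (TotalSpace.proj : TotalSpace F E → M) (sumFst F E F' E' p)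
      (mfderiv 𝓚 𝓙 (sumFst F E F' E') p v) : EM) =
    mfderiv 𝓚 𝓘(ℝ, EM) (TotalSpace.proj : TotalSpace (F × F') (E ×ᵇ E') → M) p v := by
  have h := mfderiv_comp (I := 𝓚) (I' := 𝓙) (I'' := 𝓘(ℝ, EM)) p
    ((Bundle.contMDiffAt_proj E (n := ∞)).mdifferentiableAt (by simp))
    (mdifferentiableAt_sumFst (E := E) (E' := E') p)
  exact (congrArg (fun l : EM × (F × F') →L[ℝ] EM => l v) h).symm

theorem mfderiv_proj_sumSnd (p : TotalSpace (F × F') (E ×ᵇ E')) (v : TangentSpace 𝓚 p) :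
    (mfderiv 𝓙' 𝓘(ℝ, EM) (TotalSpace.proj : TotalSpace F' E' → M) (sumSnd F E F' E' p)
      (mfderiv 𝓚 𝓙' (sumSnd F E F' E') p v) : EM) =
    mfderiv 𝓚 𝓘(ℝ, EM) (TotalSpace.proj : TotalSpace (F × F') (E ×ᵇ E') → M) p v := by
  have h := mfderiv_comp (I := 𝓚) (I' := 𝓙') (I'' := 𝓘(ℝ, EM)) p
    ((Bundle.contMDiffAt_proj E' (n := ∞)).mdifferentiableAt (by simp))
    (mdifferentiableAt_sumSnd (E := E) (E' := E') p)
  exact (congrArg (fun l : EM × (F × F') →L[ℝ] EM => l v) h).symm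

theorem differenceForm_horizontal (hφ : Λ.IsHorizontalPrimitive φ)
    (hφ' : Λ'.IsHorizontalPrimitive φ') (p : TotalSpace (F × F') (E ×ᵇ E'))
    (v : TangentSpace 𝓚 p)
    (h : mfderiv 𝓚 𝓘(ℝ, EM) (TotalSpace.proj : TotalSpace (F × F') (E ×ᵇ E') → M) p v = 0) :
    differenceForm φ φ' p ![v] = 0 := by
  have h1 := hφ.horizontal (sumFst F E F' E' p) (mfderiv 𝓚 𝓙 (sumFst F E F' E') p v)
    ((mfderiv_proj_sumFst p v).trans h)
  have h2 := hφ'.horizontal (sumSnd F E F' E' p) (mfderiv 𝓚 𝓙' (sumSnd F E F' E') p v)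
    ((mfderiv_proj_sumSnd p v).trans h)
  have e1 : (φ.pullback (J := 𝓚) (sumFst F E F' E')) p ![v] = 0 := by
    refine Eq.trans (congrArg (φ (sumFst F E F' E' p)) (funext fun i => ?_)) h1
    fin_cases i; rfl
  have e2 : (φ'.pullback (J := 𝓚) (sumSnd F E F' E')) p ![v] = 0 := by
    refine Eq.trans (congrArg (φ' (sumSnd F E F' E' p)) (funext fun i => ?_)) h2
    fin_cases i; rfl
  change (φ'.pullback (J := 𝓚) (sumSnd F E F' E')) p ![v] -
    (φ.pullback (J := 𝓚) (sumFst F E F' E')) p ![v] = 0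
  rw [e1, e2, sub_zero]

theorem differenceForm_zero (hφ : Λ.IsHorizontalPrimitive φ)
    (hφ' : Λ'.IsHorizontalPrimitive φ') (x : M) :
    differenceForm φ φ' (⟨x, 0⟩ : TotalSpace (F × F') (E ×ᵇ E')) = 0 := by
  have e1 : (φ.pullback (J := 𝓚) (sumFst F E F' E')) ⟨x, 0⟩ = 0 :=
    DiffForm.pullback_eq_of_eq (β := 0) (hφ.zero x)
  have e2 : (φ'.pullback (J := 𝓚) (sumSnd F E F' E')) ⟨x, 0⟩ = 0 :=
    DiffForm.pullback_eq_of_eq (β := 0) (hφ'.zero x)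
  change (φ'.pullback (J := 𝓚) (sumSnd F E F' E')) _ -
    (φ.pullback (J := 𝓚) (sumFst F E F' E')) _ = 0
  rw [e1, e2, sub_zero]

theorem contMDiff_endpointMap : ContMDiff 𝓚 (𝓘(ℝ, EM).prod 𝓘(ℝ, EM)) ∞ (endpointMap Λ Λ') :=
  (Λ'.smooth.comp contMDiff_sumSnd).prodMk (Λ.smooth.comp contMDiff_sumFst)

theorem pullback_pairForm {EN : Type*} [NormedAddCommGroup EN] [NormedSpace ℝ EN]
    {H' : Type*} [TopologicalSpace H'] {J : ModelWithCorners ℝ EN H'}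
    {N : Type*} [TopologicalSpace N] [ChartedSpace H' N] {f : N → M × M} {y : N}
    (hf : MDifferentiableAt J (𝓘(ℝ, EM).prod 𝓘(ℝ, EM)) f y) :
    om.pairForm.pullback (J := J) f y =
      om.pullback (J := J) (fun y => (f y).2) y - om.pullback (J := J) (fun y => (f y).1) y := by
  rw [DiffForm.pairForm, DiffForm.pullback_sub]
  change DiffForm.pullback _ (DiffForm.pullback _ _) y -
    DiffForm.pullback _ (DiffForm.pullback _ _) y = _
  rw [DiffForm.pullback_pullback om mdifferentiableAt_snd hf,
    DiffForm.pullback_pullback om mdifferentiableAt_fst hf]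
  rfl

/-- Both composites `E ⊕ E' → M` through the bundle projections of `E` and `E'` are equal, so the
terms `π^*ω` cancel. The sign comes from the order of the endpoints: `lam'` is the first, `lam` the
second. -/
theorem extD_differenceForm (hφ : Λ.IsHorizontalPrimitive φ)
    (hφ' : Λ'.IsHorizontalPrimitive φ') (p : TotalSpace (F × F') (E ×ᵇ E')) :
    (differenceForm φ φ').extD p = - om.pairForm.pullback (J := 𝓚) (endpointMap Λ Λ') p := by
  have hs : ∀ᶠ w in 𝓝 p, ContMDiffAt 𝓚 𝓙 ∞ (sumFst F E F' E') w :=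
    Filter.Eventually.of_forall fun w => contMDiff_sumFst w
  have hs' : ∀ᶠ w in 𝓝 p, ContMDiffAt 𝓚 𝓙' ∞ (sumSnd F E F' E') w :=
    Filter.Eventually.of_forall fun w => contMDiff_sumSnd w
  rw [pullback_pairForm ((contMDiff_endpointMap p).mdifferentiableAt (by simp)), differenceForm,
    DiffForm.extD_sub ((hφ'.smoothAt _).pullback hs') ((hφ.smoothAt _).pullback hs),
    DiffForm.extD_pullback (hφ'.smoothAt _) hs', DiffForm.extD_pullback (hφ.smoothAt _) hs,
    ← hφ.eq_d, ← hφ'.eq_d]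
  change (DiffForm.pullback _ (DiffForm.pullback _ _) p - DiffForm.pullback _ (DiffForm.pullback _ _) p)
    - (DiffForm.pullback _ (DiffForm.pullback _ _) p - DiffForm.pullback _ (DiffForm.pullback _ _) p)
    = _
  rw [DiffForm.pullback_pullback om ((Λ'.smooth _).mdifferentiableAt (by simp))
      (mdifferentiableAt_sumSnd p),
    DiffForm.pullback_pullback om ((Bundle.contMDiffAt_proj E' (n := ∞)).mdifferentiableAt (by simp))
      (mdifferentiableAt_sumSnd p),
    DiffForm.pullback_pullback om ((Λ.smooth _).mdifferentiableAt (by simp))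
      (mdifferentiableAt_sumFst p),
    DiffForm.pullback_pullback om ((Bundle.contMDiffAt_proj E (n := ∞)).mdifferentiableAt (by simp))
      (mdifferentiableAt_sumFst p)]
  have e : (TotalSpace.proj : TotalSpace F' E' → M) ∘ sumSnd F E F' E' =
    (TotalSpace.proj : TotalSpace F E → M) ∘ sumFst F E F' E' := rfl
  rw [e]
  refine (sub_sub_sub_cancel_right _ _ _).trans ?_
  exact (neg_sub _ _).symm

/-- Each range has dimension at most `m` and together they span a space of dimension `2m`, so they
meet only in zero. Injectivity of the derivatives in the fibers then gives `a = 0` and `b = 0`. -/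
theorem LagrangianField.range_fiberDeriv_disjoint (hΛ : Λ.Transversal Λ') (x : M) {a : F} {b : F'}
    (h : Λ.fiberDeriv x a = Λ'.fiberDeriv x b) : a = 0 ∧ b = 0 := by
  let R : Submodule ℝ EM := LinearMap.range (Λ.fiberDeriv x).toLinearMap
  let R' : Submodule ℝ EM := LinearMap.range (Λ'.fiberDeriv x).toLinearMap
  have h1 : R ⊔ R' = ⊤ := hΛ x
  have h2 := Submodule.finrank_sup_add_finrank_inf_eq R R'
  have h3 : Module.finrank ℝ R ≤ Module.finrank ℝ F := LinearMap.finrank_range_le _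
  have h4 : Module.finrank ℝ R' ≤ Module.finrank ℝ F' := LinearMap.finrank_range_le _
  rw [h1, finrank_top] at h2
  have h5 := Λ.rank
  have h6 := Λ'.rank
  have h7 : R ⊓ R' = ⊥ := Submodule.finrank_eq_zero.1 (by omega)
  have h8 : Λ.fiberDeriv x a ∈ R ⊓ R' := ⟨⟨a, rfl⟩, ⟨b, h.symm⟩⟩
  rw [h7, Submodule.mem_bot] at h8
  refine ⟨Λ.immersion x 0 (h8.trans (map_zero (Λ.fiberDeriv x)).symm),
    Λ'.immersion x 0 ((h.symm.trans h8).trans (map_zero (Λ'.fiberDeriv x)).symm)⟩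

theorem mfderiv_bundleChart_sumFst (x : M) (u : EM × (F × F')) :
    (id (α := EM × F) (mfderiv 𝓙 𝓘(ℝ, EM × F) (extChartAt 𝓙 (⟨x, 0⟩ : TotalSpace F E)) ⟨x, 0⟩
      (mfderiv 𝓚 𝓙 (sumFst F E F' E') ⟨x, 0⟩ u))).2 =
    (id (α := EM × (F × F')) (mfderiv 𝓚 𝓘(ℝ, EM × (F × F'))
      (extChartAt 𝓚 (⟨x, 0⟩ : TotalSpace (F × F') (E ×ᵇ E'))) ⟨x, 0⟩ u)).2.1 := by
  set p : TotalSpace (F × F') (E ×ᵇ E') := ⟨x, 0⟩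
  have h1 := mfderiv_comp (I := 𝓚) (I' := 𝓙) (I'' := 𝓘(ℝ, EM × F)) p
    (mdifferentiableAt_extChartAt_of_mem (mem_extChartAt_source (I := 𝓙) (sumFst F E F' E' p)))
    (mdifferentiableAt_sumFst p)
  have h2 := mfderiv_comp (I := 𝓚) (I' := 𝓘(ℝ, EM × F)) (I'' := 𝓘(ℝ, F)) p
    (g := (Prod.snd : EM × F → F)) differentiableAt_snd.mdifferentiableAt
    (MDifferentiableAt.comp p
      (mdifferentiableAt_extChartAt_of_mem (mem_extChartAt_source (I := 𝓙) (sumFst F E F' E' p)))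
      (mdifferentiableAt_sumFst p))
  let G : EM × (F × F') →L[ℝ] F :=
    (ContinuousLinearMap.fst ℝ F F').comp (ContinuousLinearMap.snd ℝ EM (F × F'))
  have h3 := mfderiv_comp (I := 𝓚) (I' := 𝓘(ℝ, EM × (F × F'))) (I'' := 𝓘(ℝ, F)) p
    (g := G) G.differentiableAt.mdifferentiableAt
    (mdifferentiableAt_extChartAt_of_mem (mem_extChartAt_source (I := 𝓚) p))
  have h4 : (Prod.snd : EM × F → F) ∘ (extChartAt 𝓙 (sumFst F E F' E' p) ∘ sumFst F E F' E') =
      G ∘ extChartAt 𝓚 p := by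
    funext q
    simp only [Function.comp_apply]
    rw [bundleChart_apply, bundleChart_apply]
    rfl
  rw [h4, h3, mfderiv_eq_fderiv, mfderiv_eq_fderiv, G.fderiv, fderiv_snd, h1] at h2
  exact (congrArg (fun l : EM × (F × F') →L[ℝ] F => l u) h2).symm

theorem mfderiv_bundleChart_sumSnd (x : M) (u : EM × (F × F')) :
    (id (α := EM × F') (mfderiv 𝓙' 𝓘(ℝ, EM × F') (extChartAt 𝓙' (⟨x, 0⟩ : TotalSpace F' E')) ⟨x, 0⟩
      (mfderiv 𝓚 𝓙' (sumSnd F E F' E') ⟨x, 0⟩ u))).2 =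
    (id (α := EM × (F × F')) (mfderiv 𝓚 𝓘(ℝ, EM × (F × F'))
      (extChartAt 𝓚 (⟨x, 0⟩ : TotalSpace (F × F') (E ×ᵇ E'))) ⟨x, 0⟩ u)).2.2 := by
  set p : TotalSpace (F × F') (E ×ᵇ E') := ⟨x, 0⟩
  have h1 := mfderiv_comp (I := 𝓚) (I' := 𝓙') (I'' := 𝓘(ℝ, EM × F')) p
    (mdifferentiableAt_extChartAt_of_mem (mem_extChartAt_source (I := 𝓙') (sumSnd F E F' E' p)))
    (mdifferentiableAt_sumSnd p)
  have h2 := mfderiv_comp (I := 𝓚) (I' := 𝓘(ℝ, EM × F')) (I'' := 𝓘(ℝ, F')) p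
    (g := (Prod.snd : EM × F' → F')) differentiableAt_snd.mdifferentiableAt
    (MDifferentiableAt.comp p
      (mdifferentiableAt_extChartAt_of_mem (mem_extChartAt_source (I := 𝓙') (sumSnd F E F' E' p)))
      (mdifferentiableAt_sumSnd p))
  let G : EM × (F × F') →L[ℝ] F' :=
    (ContinuousLinearMap.snd ℝ F F').comp (ContinuousLinearMap.snd ℝ EM (F × F'))
  have h3 := mfderiv_comp (I := 𝓚) (I' := 𝓘(ℝ, EM × (F × F'))) (I'' := 𝓘(ℝ, F')) p
    (g := G) G.differentiableAt.mdifferentiableAt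
    (mdifferentiableAt_extChartAt_of_mem (mem_extChartAt_source (I := 𝓚) p))
  have h4 : (Prod.snd : EM × F' → F') ∘ (extChartAt 𝓙' (sumSnd F E F' E' p) ∘ sumSnd F E F' E') =
      G ∘ extChartAt 𝓚 p := by
    funext q
    simp only [Function.comp_apply]
    rw [bundleChart_apply, bundleChart_apply]
    rfl
  rw [h4, h3, mfderiv_eq_fderiv, mfderiv_eq_fderiv, G.fderiv, fderiv_snd, h1] at h2
  exact (congrArg (fun l : EM × (F × F') →L[ℝ] F' => l u) h2).symm

/-- If the base part is `v` and the fiber parts are `a`, `b`, the kernel equations are `v + A a = 0`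
and `v + A' b = 0`. Hence `A a = A' b`, and transversality forces `a = b = 0`, then `v = 0`. -/
theorem mfderiv_endpointMap_zero_injective (hΛ : Λ.Transversal Λ') (x : M) :
    Function.Injective (mfderiv 𝓚 (𝓘(ℝ, EM).prod 𝓘(ℝ, EM)) (endpointMap Λ Λ')
      (⟨x, 0⟩ : TotalSpace (F × F') (E ×ᵇ E'))) := by
  set p : TotalSpace (F × F') (E ×ᵇ E') := ⟨x, 0⟩ with hp
  refine (injective_iff_map_eq_zero (mfderiv 𝓚 (𝓘(ℝ, EM).prod 𝓘(ℝ, EM)) (endpointMap Λ Λ') p)).2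
    fun (u : EM × (F × F')) hu => ?_
  have hm1 : MDifferentiableAt 𝓚 𝓘(ℝ, EM) (fun p => Λ'.lam (sumSnd F E F' E' p)) p :=
    ((Λ'.smooth _).mdifferentiableAt (by simp)).comp p (mdifferentiableAt_sumSnd p)
  have hm2 : MDifferentiableAt 𝓚 𝓘(ℝ, EM) (fun p => Λ.lam (sumFst F E F' E' p)) p :=
    ((Λ.smooth _).mdifferentiableAt (by simp)).comp p (mdifferentiableAt_sumFst p)
  have h1 := mfderiv_prodMk hm1 hm2
  have h2 : ((mfderiv 𝓚 𝓘(ℝ, EM) (fun p => Λ'.lam (sumSnd F E F' E' p)) p u,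
      mfderiv 𝓚 𝓘(ℝ, EM) (fun p => Λ.lam (sumFst F E F' E' p)) p u) : EM × EM) = 0 :=
    (congrArg (fun l : EM × (F × F') →L[ℝ] EM × EM => l u) h1).symm.trans hu
  have h3 := congrArg Prod.fst h2
  have h4 := congrArg Prod.snd h2
  have c1 := congrArg (fun l : EM × (F × F') →L[ℝ] EM => l u) (mfderiv_comp (I := 𝓚) (I' := 𝓙')
    (I'' := 𝓘(ℝ, EM)) p ((Λ'.smooth _).mdifferentiableAt (by simp)) (mdifferentiableAt_sumSnd p))
  have c2 := congrArg (fun l : EM × (F × F') →L[ℝ] EM => l u) (mfderiv_comp (I := 𝓚) (I' := 𝓙)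
    (I'' := 𝓘(ℝ, EM)) p ((Λ.smooth _).mdifferentiableAt (by simp)) (mdifferentiableAt_sumFst p))
  let v : EM := mfderiv 𝓚 𝓘(ℝ, EM) (TotalSpace.proj : TotalSpace (F × F') (E ×ᵇ E') → M) p u
  let d : EM × (F × F') := mfderiv 𝓚 𝓘(ℝ, EM × (F × F')) (extChartAt 𝓚 p) p u
  have k1 : v + Λ'.fiberDeriv x d.2.2 = 0 := by
    refine Eq.trans ?_ (c1.symm.trans h3)
    refine Eq.trans ?_ (Λ'.mfderiv_lam_zero x (mfderiv 𝓚 𝓙' (sumSnd F E F' E') p u)).symm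
    rw [mfderiv_bundleChart_sumSnd]
    exact congrArg (· + Λ'.fiberDeriv x d.2.2) (mfderiv_proj_sumSnd p u).symm
  have k2 : v + Λ.fiberDeriv x d.2.1 = 0 := by
    refine Eq.trans ?_ (c2.symm.trans h4)
    refine Eq.trans ?_ (Λ.mfderiv_lam_zero x (mfderiv 𝓚 𝓙 (sumFst F E F' E') p u)).symm
    rw [mfderiv_bundleChart_sumFst]
    exact congrArg (· + Λ.fiberDeriv x d.2.1) (mfderiv_proj_sumFst p u).symm
  obtain ⟨k3, k4⟩ := LagrangianField.range_fiberDeriv_disjoint hΛ x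
    (add_left_cancel (k2.trans k1.symm))
  rw [k3, map_zero, add_zero] at k2
  have k5 : d.1 = 0 := mfderiv_bundleChart_fst p u k2
  have k6 : d = 0 := Prod.ext k5 (Prod.ext k3 k4)
  have k7 := mfderiv_extChartAt_symm_comp (I := 𝓚) (mem_extChartAt_source p) u
  refine k7.symm.trans ?_
  exact (congrArg (mfderiv 𝓘(ℝ, EM × (F × F')) 𝓚 (extChartAt 𝓚 p).symm (extChartAt 𝓚 p p))
    k6).trans (map_zero _)

theorem finrank_sum (Λ : LagrangianField om F E) (Λ' : LagrangianField om F' E') :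
    Module.finrank ℝ (EM × (F × F')) = Module.finrank ℝ (EM × EM) := by
  have h5 := Λ.rank
  have h6 := Λ'.rank
  simp only [Module.finrank_prod]
  omega

theorem mfderiv_endpointMap_zero_bijective (hΛ : Λ.Transversal Λ') (x : M) :
    Function.Bijective (mfderiv 𝓚 (𝓘(ℝ, EM).prod 𝓘(ℝ, EM)) (endpointMap Λ Λ')
      (⟨x, 0⟩ : TotalSpace (F × F') (E ×ᵇ E'))) := by
  have hi := mfderiv_endpointMap_zero_injective hΛ x
  exact ⟨hi, (LinearMap.injective_iff_surjective_of_finrank_eq_finrank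
    (f := LinearMap.id (R := ℝ) (M := EM × (F × F') →ₗ[ℝ] EM × EM) (mfderiv 𝓚
      (𝓘(ℝ, EM).prod 𝓘(ℝ, EM)) (endpointMap Λ Λ')
      (⟨x, 0⟩ : TotalSpace (F × F') (E ×ᵇ E'))).toLinearMap) (finrank_sum Λ Λ')).1 hi⟩

theorem pairForm_nondegenerate (h : ∀ x, ∀ v : TangentSpace 𝓘(ℝ, EM) x,
    (∀ w : TangentSpace 𝓘(ℝ, EM) x, om x ![v, w] = 0) → v = 0) (q : M × M) (v : EM × EM)
    (hv : ∀ w : EM × EM, (om.pairForm q : (EM × EM) [⋀^Fin 2]→L[ℝ] ℝ) ![v, w] = 0) : v = 0 := by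
  have key : ∀ w : EM × EM, (om.pairForm q : (EM × EM) [⋀^Fin 2]→L[ℝ] ℝ) ![v, w] =
      (om q.2 : EM [⋀^Fin 2]→L[ℝ] ℝ) ![v.2, w.2] - (om q.1 : EM [⋀^Fin 2]→L[ℝ] ℝ) ![v.1, w.1] := by
    intro w
    refine congrArg₂ (fun a b : ℝ => a - b) ?_ ?_
    · refine congrArg (om q.2) (funext fun i => ?_)
      refine (congrArg (fun l : EM × EM →L[ℝ] EM => l (![v, w] i))
        (mfderiv_snd (I := 𝓘(ℝ, EM)) (I' := 𝓘(ℝ, EM)) (x := q))).trans ?_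
      fin_cases i <;> rfl
    · refine congrArg (om q.1) (funext fun i => ?_)
      refine (congrArg (fun l : EM × EM →L[ℝ] EM => l (![v, w] i))
        (mfderiv_fst (I := 𝓘(ℝ, EM)) (I' := 𝓘(ℝ, EM)) (x := q))).trans ?_
      fin_cases i <;> rfl
  have z : ∀ (x : M) (a : EM), (om x : EM [⋀^Fin 2]→L[ℝ] ℝ) ![a, 0] = 0 := fun x a =>
    (om x).map_coord_zero 1 rfl
  refine Prod.ext (h q.1 v.1 fun w => ?_) (h q.2 v.2 fun w => ?_)
  · have := (key (w, 0)).symm.trans (hv _)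
    exact (sub_eq_zero.1 this).symm.trans (z _ _)
  · have := (key (0, w)).symm.trans (hv _)
    exact (sub_eq_zero.1 this).trans (z _ _)

variable {c : ∀ p : TotalSpace (F × F') (E ×ᵇ E'), TangentSpace 𝓘(ℝ, EM) p.proj →L[ℝ] ℝ}

theorem contMDiff_covectorMap (hφ : Λ.IsHorizontalPrimitive φ)
    (hφ' : Λ'.IsHorizontalPrimitive φ') (hc : RepresentsDifference φ φ' c) :
    ContMDiff 𝓚 (cotangentModel EM) ∞ (covectorMap c) :=
  contMDiff_covector (differenceForm_smoothAt hφ hφ') hc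

theorem covectorMap_zero (hφ : Λ.IsHorizontalPrimitive φ)
    (hφ' : Λ'.IsHorizontalPrimitive φ') (hc : RepresentsDifference φ φ' c) (x : M) :
    covectorMap c ⟨x, 0⟩ = ⟨x, 0⟩ := by
  refine congrArg (TotalSpace.mk x) (ContinuousLinearMap.ext fun (w : EM) => ?_)
  have h1 := hc ⟨x, 0⟩ (horizontalLift (⟨x, 0⟩ : TotalSpace (F × F') (E ×ᵇ E')) w)
  have h2 := congrArg (c ⟨x, 0⟩ : EM →L[ℝ] ℝ)
    (mfderiv_proj_horizontalLift (⟨x, 0⟩ : TotalSpace (F × F') (E ×ᵇ E')) w)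
  refine h2.symm.trans (h1.trans ?_)
  have h3 := differenceForm_zero hφ hφ' x
  rw [differenceForm] at h3
  rw [h3]
  rfl

/-- `χ` pulls `θ` back to the difference of the primitives, and the differential of that difference
is known from the endpoints. This identity is both the reason why `f` is symplectic and the tool by
which `χ` is shown to be a local diffeomorphism. -/
theorem pullback_canonicalSymplecticForm (hφ : Λ.IsHorizontalPrimitive φ)
    (hφ' : Λ'.IsHorizontalPrimitive φ') (hc : RepresentsDifference φ φ' c)
    (p : TotalSpace (F × F') (E ×ᵇ E')) :
    (canonicalSymplecticForm M).pullback (J := 𝓚) (covectorMap c) p =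
      om.pairForm.pullback (J := 𝓚) (endpointMap Λ Λ') p := by
  have hχ := contMDiff_covectorMap hφ hφ' hc
  have h1 := pullback_canonicalOneForm hχ hc
  have h2 := DiffForm.extD_pullback (J := 𝓚) (f := covectorMap c) (y := p)
    (canonicalOneForm_smoothAt _) (Filter.Eventually.of_forall fun w => hχ w)
  rw [canonicalSymplecticForm, DiffForm.pullback_neg]
  refine Eq.trans (congrArg Neg.neg h2.symm) ?_
  have h3 := extD_differenceForm hφ hφ' p
  rw [neg_eq_iff_eq_neg]
  refine Eq.trans ?_ h3
  exact congrArg (fun a => DiffForm.extD a p) h1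

/-- A vector in the kernel of the derivative of `χ` pairs to zero with everything under the pullback
of `-dθ`. That pullback equals the pullback of the nondegenerate pair form by the endpoint map,
whose derivative is bijective; so the vector is zero. Surjectivity follows from equal dimensions. -/
theorem mfderiv_covectorMap_zero_bijective (hom : om.IsSymplecticOn univ)
    (hΛ : Λ.Transversal Λ') (hφ : Λ.IsHorizontalPrimitive φ)
    (hφ' : Λ'.IsHorizontalPrimitive φ') (hc : RepresentsDifference φ φ' c) (x : M) :
    Function.Bijective (mfderiv 𝓚 (cotangentModel EM) (covectorMap c)
      (⟨x, 0⟩ : TotalSpace (F × F') (E ×ᵇ E'))) := by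
  set p : TotalSpace (F × F') (E ×ᵇ E') := ⟨x, 0⟩
  have hF := mfderiv_endpointMap_zero_bijective hΛ x
  have hi : Function.Injective (mfderiv 𝓚 (cotangentModel EM) (covectorMap c) p) := by
    refine (injective_iff_map_eq_zero (mfderiv 𝓚 (cotangentModel EM) (covectorMap c) p)).2
      fun (u : EM × (F × F')) hu => ?_
    refine (injective_iff_map_eq_zero _).1 hF.1 u ?_
    refine pairForm_nondegenerate (fun x => hom.nondegenerate x (mem_univ x))
      (endpointMap Λ Λ' p) _ fun w => ?_
    obtain ⟨w, rfl⟩ := hF.2 w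
    have h1 := congrArg (fun l : (EM × (F × F')) [⋀^Fin 2]→L[ℝ] ℝ => l ![u, w])
      (pullback_canonicalSymplecticForm hφ hφ' hc p)
    refine Eq.trans ?_ (h1.symm.trans ?_)
    · refine congrArg (om.pairForm (endpointMap Λ Λ' p)) (funext fun i => ?_)
      fin_cases i <;> rfl
    · exact ((canonicalSymplecticForm M) (covectorMap c p)).map_coord_zero 0 hu
  have hd : Module.finrank ℝ (EM × (F × F')) = Module.finrank ℝ (EM × (EM →L[ℝ] ℝ)) := by
    rw [finrank_sum Λ Λ', Module.finrank_prod, Module.finrank_prod]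
    congr 1
    rw [← LinearMap.toContinuousLinearMap (𝕜 := ℝ) (E := EM) (F' := ℝ) |>.finrank_eq]
    exact Subspace.dual_finrank_eq.symm
  exact ⟨hi, (LinearMap.injective_iff_surjective_of_finrank_eq_finrank
    (f := LinearMap.id (R := ℝ) (M := EM × (F × F') →ₗ[ℝ] EM × (EM →L[ℝ] ℝ)) (mfderiv 𝓚
      (cotangentModel EM) (covectorMap c) p).toLinearMap) hd).1 hi⟩

end Sum

/-! ### Local diffeomorphisms and injectivity near a subset -/

section InverseFunction

variable {EM : Type*} [NormedAddCommGroup EM] [NormedSpace ℝ EM]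
  {H : Type*} [TopologicalSpace H] {I : ModelWithCorners ℝ EM H}
  {M : Type*} [TopologicalSpace M] [ChartedSpace H M]
  {EN : Type*} [NormedAddCommGroup EN] [NormedSpace ℝ EN]
  {H' : Type*} [TopologicalSpace H'] {J : ModelWithCorners ℝ EN H'}
  {N : Type*} [TopologicalSpace N] [ChartedSpace H' N]

theorem IsDiffeoOntoOpen.mono {f : N → M} {W W' : Set N} (h : IsDiffeoOntoOpen J I f W)
    (hW' : IsOpen W') (hs : W' ⊆ W) : IsDiffeoOntoOpen J I f W' := by
  obtain ⟨-, h2, h3, g, h4, h5⟩ := h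
  refine ⟨hW', ?_, h3.mono hs, g, h4.mono (image_mono hs), fun z hz => h5 z (hs hz)⟩
  have : f '' W' = f '' W ∩ g ⁻¹' W' := by
    ext y
    constructor
    · rintro ⟨z, hz, rfl⟩
      exact ⟨⟨z, hs hz, rfl⟩, by rw [mem_preimage, h5 z (hs hz)]; exact hz⟩
    · rintro ⟨⟨z, hz, rfl⟩, hy⟩
      rw [mem_preimage, h5 z hz] at hy
      exact ⟨z, hy, rfl⟩
  rw [this]
  exact h4.continuousOn.isOpen_inter_preimage h2 hW'

theorem IsDiffeoOntoOpen.injOn {f : N → M} {W : Set N} (h : IsDiffeoOntoOpen J I f W) :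
    InjOn f W := by
  obtain ⟨-, -, -, g, -, h5⟩ := h
  intro a ha b hb hab
  rw [← h5 a ha, ← h5 b hb, hab]

/-- An injective map which is locally a diffeomorphism is a diffeomorphism onto its image. -/
theorem isDiffeoOntoOpen_of_injOn {f : N → M} {W : Set N} (g₀ : M → N) (hW : IsOpen W)
    (hi : InjOn f W) (h : ∀ z ∈ W, ∃ U, z ∈ U ∧ IsDiffeoOntoOpen J I f U) :
    IsDiffeoOntoOpen J I f W := by
  classical
  have h' : ∀ z ∈ W, ∃ U ⊆ W, z ∈ U ∧ IsDiffeoOntoOpen J I f U := by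
    intro z hz
    obtain ⟨U, hzU, hU⟩ := h z hz
    exact ⟨U ∩ W, inter_subset_right, ⟨hzU, hz⟩, hU.mono (hU.1.inter hW) inter_subset_left⟩
  -- `g₀` only provides values outside the image of `W`. On the image, injectivity makes this choice
  -- agree with every local inverse, hence smooth.
  let g : M → N := fun y => if hy : ∃ z ∈ W, f z = y then hy.choose else g₀ y
  have hg : ∀ z ∈ W, g (f z) = z := by
    intro z hz
    have hy : ∃ z' ∈ W, f z' = f z := ⟨z, hz, rfl⟩
    simp only [g, dif_pos hy]
    exact hi hy.choose_spec.1 hz hy.choose_spec.2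
  refine ⟨hW, ?_, ?_, g, ?_, hg⟩
  · rw [isOpen_iff_mem_nhds]
    rintro _ ⟨z, hz, rfl⟩
    obtain ⟨U, hUW, hzU, hU⟩ := h' z hz
    exact Filter.mem_of_superset (hU.2.1.mem_nhds ⟨z, hzU, rfl⟩) (image_mono hUW)
  · intro z hz
    obtain ⟨U, hUW, hzU, hU⟩ := h' z hz
    exact (hU.2.2.1.contMDiffAt (hU.1.mem_nhds hzU)).contMDiffWithinAt
  · rintro _ ⟨z, hz, rfl⟩
    obtain ⟨U, hUW, hzU, h1, h2, h3, k, h4, h5⟩ := h' z hz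
    have hn := h2.mem_nhds ⟨z, hzU, rfl⟩
    refine ((h4.contMDiffAt hn).congr_of_eventuallyEq ?_).contMDiffWithinAt
    filter_upwards [hn] with y hy
    obtain ⟨z', hz', rfl⟩ := hy
    rw [h5 z' hz', hg z' (hUW hz')]

/-- The inverse function theorem for the local representative `h` in charts, whose derivative is
bijective because chart derivatives are. -/
theorem exists_isDiffeoOntoOpen [FiniteDimensional ℝ EN] [CompleteSpace EM]
    [I.Boundaryless] [IsManifold I ∞ M] [J.Boundaryless] [IsManifold J ∞ N] {f : N → M}
    (hf : ContMDiff J I ∞ f) {x : N} (hb : Function.Bijective (mfderiv J I f x)) :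
    ∃ U, x ∈ U ∧ IsDiffeoOntoOpen J I f U := by
  have : CompleteSpace EN := FiniteDimensional.complete ℝ EN
  set e := extChartAt J x with he
  set e' := extChartAt I (f x) with he'
  let h : EN → EM := fun y => e' (f (e.symm y))
  have hs : ∀ y ∈ e.target, f (e.symm y) ∈ e'.source → ContDiffAt ℝ ∞ h y := fun y hy hy' =>
    DiffForm.contDiffAt_chart_comp hy (hf _) hy'
  have hx : e x ∈ e.target := mem_extChartAt_target x
  have hxe : e.symm (e x) = x := extChartAt_to_inv x
  have hx' : f (e.symm (e x)) ∈ e'.source := by rw [hxe]; exact mem_extChartAt_source (f x)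
  -- the derivative at the centre
  have hd : Function.Bijective (fderiv ℝ h (e x)) := by
    have h1 := mfderiv_comp (I := 𝓘(ℝ, EN)) (e x) ((hf (e.symm (e x))).mdifferentiableAt (by simp))
      (mdifferentiableAt_extChartAt_symm (I := J) hx)
    have h2 := mfderiv_comp (I := 𝓘(ℝ, EN)) (I' := I) (g := e') (f := f ∘ e.symm) (e x)
      (mdifferentiableAt_extChartAt_of_mem hx')
      (((hf (e.symm (e x))).mdifferentiableAt (by simp)).comp _
        (mdifferentiableAt_extChartAt_symm hx))
    have h3 : ∀ v : EN, fderiv ℝ h (e x) v = mfderiv I 𝓘(ℝ, EM) e' (f (e.symm (e x)))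
        (mfderiv J I f (e.symm (e x)) (mfderiv 𝓘(ℝ, EN) J e.symm (e x) v)) := by
      intro v
      rw [h1, mfderiv_eq_fderiv] at h2
      exact congrArg (fun l : EN →L[ℝ] EM => l v) h2
    have hb' : Function.Bijective (mfderiv J I f (e.symm (e x))) := by rw [hxe]; exact hb
    constructor
    · refine (injective_iff_map_eq_zero (fderiv ℝ h (e x))).2 fun v hv => ?_
      have h4 := mfderiv_extChartAt_symm_comp (I := I) hx'
        (mfderiv J I f (e.symm (e x)) (mfderiv 𝓘(ℝ, EN) J e.symm (e x) v))
      have h5 := (congrArg (mfderiv 𝓘(ℝ, EM) I e'.symm (e' (f (e.symm (e x)))))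
        ((h3 v).symm.trans hv)).trans (map_zero _)
      have h6 := (injective_iff_map_eq_zero _).1 hb'.1 _ (h4.symm.trans h5)
      have h7 := mfderiv_extChartAt_comp_symm (I := J) hx v
      exact h7.symm.trans ((congrArg (mfderiv J 𝓘(ℝ, EN) e (e.symm (e x))) h6).trans (map_zero _))
    · intro w
      obtain ⟨v, hv⟩ := hb'.2 (mfderiv 𝓘(ℝ, EM) I e'.symm (e' (f (e.symm (e x)))) w)
      refine ⟨mfderiv J 𝓘(ℝ, EN) e (e.symm (e x)) v, (h3 _).trans ?_⟩
      have h4 := mfderiv_extChartAt_symm_comp (I := J) (e.map_target hx) v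
      have h4' : mfderiv 𝓘(ℝ, EN) J e.symm (e x) (mfderiv J 𝓘(ℝ, EN) e (e.symm (e x)) v) = v := by
        refine Eq.trans ?_ h4
        exact congrArg (fun y => (mfderiv 𝓘(ℝ, EN) J e.symm y : EN →L[ℝ] EN) _)
          (e.right_inv hx).symm
      have h5 := mfderiv_extChartAt_comp_symm (I := I) (e'.map_source hx') w
      have h6 : mfderiv I 𝓘(ℝ, EM) e' (f (e.symm (e x)))
          (mfderiv 𝓘(ℝ, EM) I e'.symm (e' (f (e.symm (e x)))) w) = w := by
        refine Eq.trans ?_ h5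
        exact congrArg (fun y => (mfderiv I 𝓘(ℝ, EM) e' y : EM →L[ℝ] EM) _)
          (e'.left_inv hx').symm
      refine Eq.trans (congrArg _ ?_) h6
      exact (congrArg (mfderiv J I f (e.symm (e x))) h4').trans hv
  let L : EN ≃L[ℝ] EM := ContinuousLinearEquiv.ofBijective (fderiv ℝ h (e x))
    (LinearMap.ker_eq_bot.2 hd.1) (LinearMap.range_eq_top.2 hd.2)
  have hL : HasFDerivAt h (L : EN →L[ℝ] EM) (e x) :=
    ((hs _ hx hx').differentiableAt (by simp)).hasFDerivAt
  let Φ := (hs _ hx hx').toOpenPartialHomeomorph h hL (by simp)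
  have hΦ : ∀ y, Φ y = h y := fun _ => rfl
  have hΦx : e x ∈ Φ.source := (hs _ hx hx').mem_toOpenPartialHomeomorph_source hL (by simp)
  -- Isomorphisms are open among continuous linear maps, so the derivative stays invertible near the
  -- center. This makes the local inverse smooth at every image point, not only at the image of the
  -- center.
  have hev : ∀ᶠ y in 𝓝 (e x), y ∈ Φ.source ∧ y ∈ e.target ∧ f (e.symm y) ∈ e'.source ∧
      ∃ L' : EN ≃L[ℝ] EM, (L' : EN →L[ℝ] EM) = fderiv ℝ h y := by
    have hc : ContinuousAt (fun y => f (e.symm y)) (e x) :=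
      (hf.continuous.continuousAt).comp (continuousAt_extChartAt_symm x)
    have hc2 : ContinuousAt (fderiv ℝ h) (e x) :=
      ((hs _ hx hx').fderiv_right (m := 0) (by simp)).continuousAt
    filter_upwards [Φ.open_source.mem_nhds hΦx, (isOpen_extChartAt_target x).mem_nhds hx,
      hc ((isOpen_extChartAt_source (f x)).mem_nhds hx'), hc2 (ContinuousLinearEquiv.nhds L)]
      with y h1 h2 h3 h4
    exact ⟨h1, h2, h3, h4⟩
  obtain ⟨A, hA, hAo, hxA⟩ := eventually_nhds_iff.1 hev
  have hsrc : ∀ y ∈ A, e.symm y ∈ e.source := fun y hy => e.map_target (hA y hy).2.1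
  have himg : f '' (e.source ∩ e ⁻¹' A) = e'.source ∩ e' ⁻¹' (Φ '' A) := by
    ext z
    constructor
    · rintro ⟨u, ⟨hu, huA⟩, rfl⟩
      have h1 := (hA _ huA).2.2.1
      rw [e.left_inv hu] at h1
      refine ⟨h1, e u, huA, ?_⟩
      rw [hΦ]
      simp only [h, e.left_inv hu]
    · rintro ⟨hz, a, ha, haz⟩
      refine ⟨e.symm a, ⟨hsrc a ha, ?_⟩, e'.injOn (hA a ha).2.2.1 hz haz⟩
      rw [mem_preimage, e.right_inv (hA a ha).2.1]
      exact ha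
  have hΦA : IsOpen (Φ '' A) := Φ.isOpen_image_of_subset_source hAo fun y hy => (hA y hy).1
  refine ⟨e.source ∩ e ⁻¹' A, ⟨mem_extChartAt_source x, hxA⟩, ?_, ?_, hf.contMDiffOn,
    fun z => e.symm (Φ.symm (e' z)), ?_, ?_⟩
  · exact (continuousOn_extChartAt x).isOpen_inter_preimage (isOpen_extChartAt_source x) hAo
  · rw [himg]
    exact (continuousOn_extChartAt _).isOpen_inter_preimage (isOpen_extChartAt_source _) hΦA
  · rw [himg]
    rintro z ⟨hz, a, ha, haz⟩
    obtain ⟨L', hL'⟩ := (hA a ha).2.2.2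
    have hsa : Φ.symm (e' z) = a := by rw [← haz, Φ.left_inv (hA a ha).1]
    have h1 : ContDiffAt ℝ ∞ Φ.symm (e' z) := by
      refine Φ.contDiffAt_symm (f₀' := L') ?_ ?_ ?_
      · rw [← haz]; exact Φ.map_source (hA a ha).1
      · rw [hsa, hL']
        exact ((hs a (hA a ha).2.1 (hA a ha).2.2.1).differentiableAt (by simp)).hasFDerivAt
      · rw [hsa]
        exact hs a (hA a ha).2.1 (hA a ha).2.2.1
    have h2 : ContMDiffAt I 𝓘(ℝ, EM) ∞ e' z := contMDiffAt_extChartAt' (by simpa [he'] using hz)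
    have h3 : ContMDiffAt 𝓘(ℝ, EN) J ∞ e.symm (Φ.symm (e' z)) := by
      rw [hsa]; exact contMDiffAt_extChartAt_symm (hA a ha).2.1
    exact (ContMDiffAt.comp z h3 (ContMDiffAt.comp z h1.contMDiffAt h2)).contMDiffWithinAt
  · rintro u ⟨hu, huA⟩
    have h1 : e' (f u) = Φ (e u) := by
      rw [hΦ]; simp only [h, e.left_inv hu]
    simp only
    rw [h1, Φ.left_inv (hA _ huA).1, e.left_inv hu]

end InverseFunction

/-- A map which is locally injective near the points of `A`, and for which some retraction onto `A`
factors through it, is injective on a neighbourhood of `A`. -/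
theorem exists_isOpen_injOn {X Y : Type*} [TopologicalSpace X] [TopologicalSpace.MetrizableSpace X]
    {A : Set X} {f : X → Y} (g : Y → X) (hc : Continuous (g ∘ f)) (hr : ∀ a ∈ A, g (f a) = a)
    (hl : ∀ a ∈ A, ∃ U ∈ 𝓝 a, InjOn f U) : ∃ W, IsOpen W ∧ A ⊆ W ∧ InjOn f W := by
  let _ := TopologicalSpace.metrizableSpaceMetric X
  have h1 : ∀ a : A, ∃ ρ > 0, InjOn f (Metric.ball (a : X) ρ) := by
    intro a
    obtain ⟨U, hU, hi⟩ := hl a a.2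
    obtain ⟨ρ, hρ, hs⟩ := Metric.mem_nhds_iff.1 hU
    exact ⟨ρ, hρ, hi.mono hs⟩
  choose ρ hρ hi using h1
  -- The radii `ρ / 4` work as follows. If `f p = f q` then `g ∘ f` takes the same value at `p` and
  -- `q`, so the centers are at distance less than `(ρ a + ρ b) / 4`. When `ρ b ≤ ρ a`, the point
  -- `q` is then within `3 ρ a / 4` of `a`, so `p` and `q` lie in one ball on which `f` is
  -- injective.
  let V : A → Set X := fun a => {p | dist p a < ρ a / 4 ∧ dist (g (f p)) a < ρ a / 4}
  have key : ∀ a b : A, ∀ p ∈ V a, ∀ q ∈ V b, f p = f q → ρ b ≤ ρ a → p = q := by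
    rintro a b p ⟨hp1, hp2⟩ q ⟨hq1, hq2⟩ hpq hab
    refine hi a ?_ ?_ hpq
    · rw [Metric.mem_ball]
      linarith [hρ a]
    · rw [Metric.mem_ball]
      have t1 := dist_triangle q b a
      have t2 := dist_triangle_left (b : X) a (g (f q))
      rw [hpq] at hp2
      linarith [hρ a]
  refine ⟨⋃ a, V a, isOpen_iUnion fun a => ?_, fun a ha => mem_iUnion.2 ⟨⟨a, ha⟩, ?_⟩, ?_⟩
  · exact (isOpen_lt (continuous_id.dist continuous_const) continuous_const).inter
      (isOpen_lt (hc.dist continuous_const) continuous_const)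
  · have := hρ ⟨a, ha⟩
    refine ⟨?_, ?_⟩
    · simp only [dist_self]; linarith
    · simp only [hr a ha, dist_self]; linarith
  · intro p hp q hq hpq
    obtain ⟨a, ha⟩ := mem_iUnion.1 hp
    obtain ⟨b, hb⟩ := mem_iUnion.1 hq
    rcases le_total (ρ b) (ρ a) with h | h
    · exact key a b p ha q hb hpq h
    · exact (key b a q hb p ha hpq.symm h).symm

/-! ### Separation and countability properties of total spaces -/

theorem totalSpace_t2Space {M : Type*} [TopologicalSpace M] [T2Space M]
    {F : Type*} [TopologicalSpace F] [T2Space F]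
    {E : M → Type*} [∀ x, TopologicalSpace (E x)]
    [TopologicalSpace (TotalSpace F E)] [FiberBundle F E] : T2Space (TotalSpace F E) := by
  refine ⟨fun p q hpq => ?_⟩
  by_cases h : p.proj = q.proj
  · let t := trivializationAt F E p.proj
    have hp : p ∈ t.source := t.mem_source.2 (mem_baseSet_trivializationAt F E p.proj)
    have hq : q ∈ t.source := t.mem_source.2 (h ▸ mem_baseSet_trivializationAt F E p.proj)
    obtain ⟨u, v, hu, hv, hpu, hqv, huv⟩ := t2_separation (fun h' => hpq (t.injOn hp hq h'))
    refine ⟨t.source ∩ t ⁻¹' u, t.source ∩ t ⁻¹' v, t.continuousOn.isOpen_inter_preimage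
      t.open_source hu, t.continuousOn.isOpen_inter_preimage t.open_source hv, ⟨hp, hpu⟩,
      ⟨hq, hqv⟩, ?_⟩
    exact (huv.preimage t).mono inter_subset_right inter_subset_right
  · exact separated_by_continuous (FiberBundle.continuous_proj F E) h

/-- This supplies the distance on which `exists_isOpen_injOn` relies. The total space is Hausdorff
and locally compact, hence regular, and countably many bundle charts cover it, hence it is second
countable; Urysohn's theorem applies. -/
theorem totalSpace_metrizableSpace
    (EM : Type*) [NormedAddCommGroup EM] [NormedSpace ℝ EM] [FiniteDimensional ℝ EM]
    {M : Type*} [TopologicalSpace M] [T2Space M] [SecondCountableTopology M] [ChartedSpace EM M]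
    {F : Type*} [NormedAddCommGroup F] [NormedSpace ℝ F] [FiniteDimensional ℝ F]
    {E : M → Type*} [∀ x, AddCommGroup (E x)] [∀ x, Module ℝ (E x)] [∀ x, TopologicalSpace (E x)]
    [TopologicalSpace (TotalSpace F E)] [FiberBundle F E] [VectorBundle ℝ F E] :
    TopologicalSpace.MetrizableSpace (TotalSpace F E) := by
  have := totalSpace_t2Space (F := F) (E := E)
  have : LocallyCompactSpace (ModelProd EM F) := inferInstanceAs (LocallyCompactSpace (EM × F))
  have : SecondCountableTopology (ModelProd EM F) :=
    inferInstanceAs (SecondCountableTopology (EM × F))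
  have hl : LocallyCompactSpace (TotalSpace F E) :=
    ChartedSpace.locallyCompactSpace (ModelProd EM F) (TotalSpace F E)
  have hs : SecondCountableTopology (TotalSpace F E) := by
    obtain ⟨s, hs, hsU⟩ := TopologicalSpace.countable_cover_nhds (α := M)
      (f := fun x => (trivializationAt F E x).baseSet ∩ (extChartAt 𝓘(ℝ, EM) x).source)
      fun x => Filter.inter_mem ((trivializationAt F E x).open_baseSet.mem_nhds
        (mem_baseSet_trivializationAt F E x)) (extChartAt_source_mem_nhds x)
    refine ChartedSpace.secondCountable_of_countable_cover (H := ModelProd EM F)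
      (s := (fun x => (⟨x, 0⟩ : TotalSpace F E)) '' s) ?_ (hs.image _)
    refine eq_univ_of_forall fun p => ?_
    have hp : p.proj ∈ ⋃ x ∈ s, _ := hsU ▸ mem_univ p.proj
    obtain ⟨x, hx, hpx⟩ := mem_iUnion₂.1 hp
    refine mem_iUnion₂.2 ⟨⟨x, 0⟩, mem_image_of_mem _ hx, ?_⟩
    rw [← extChartAt_source (ModelWithCorners.prod 𝓘(ℝ, EM) 𝓘(ℝ, F))]
    exact (bundleChart_source (EM := EM) (⟨x, 0⟩ : TotalSpace F E) p).2 hpx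
  exact TopologicalSpace.metrizableSpace_of_t3_secondCountable _

/-! ### Admissible neighbourhoods of the zero section -/

section Admissible

variable {EM : Type*} [NormedAddCommGroup EM] [NormedSpace ℝ EM] [FiniteDimensional ℝ EM]
  {M : Type*} [TopologicalSpace M] [ChartedSpace EM M] [IsManifold 𝓘(ℝ, EM) ∞ M]
  {F : Type*} [NormedAddCommGroup F] [NormedSpace ℝ F] [FiniteDimensional ℝ F]
  {E : M → Type*} [∀ x, AddCommGroup (E x)] [∀ x, Module ℝ (E x)] [∀ x, TopologicalSpace (E x)]
  [TopologicalSpace (TotalSpace F E)] [FiberBundle F E] [VectorBundle ℝ F E]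
  [ContMDiffVectorBundle ∞ F E 𝓘(ℝ, EM)]
  {F' : Type*} [NormedAddCommGroup F'] [NormedSpace ℝ F'] [FiniteDimensional ℝ F']
  {E' : M → Type*} [∀ x, AddCommGroup (E' x)] [∀ x, Module ℝ (E' x)]
  [∀ x, TopologicalSpace (E' x)] [TopologicalSpace (TotalSpace F' E')]
  [FiberBundle F' E'] [VectorBundle ℝ F' E'] [ContMDiffVectorBundle ∞ F' E' 𝓘(ℝ, EM)]
  {om : DiffForm 𝓘(ℝ, EM) M 2} {Λ : LagrangianField om F E} {Λ' : LagrangianField om F' E'}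
  {φ : DiffForm (ModelWithCorners.prod 𝓘(ℝ, EM) 𝓘(ℝ, F)) (TotalSpace F E) 1}
  {φ' : DiffForm (ModelWithCorners.prod 𝓘(ℝ, EM) 𝓘(ℝ, F')) (TotalSpace F' E') 1}
  {c : ∀ p : TotalSpace (F × F') (E ×ᵇ E'), TangentSpace 𝓘(ℝ, EM) p.proj →L[ℝ] ℝ}

local notation "𝓚" => ModelWithCorners.prod 𝓘(ℝ, EM) 𝓘(ℝ, F × F')

theorem endpointMap_zero (x : M) :
    endpointMap Λ Λ' (⟨x, 0⟩ : TotalSpace (F × F') (E ×ᵇ E')) = (x, x) :=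
  Prod.ext (Λ'.zero x) (Λ.zero x)

/-- Bijective derivatives make both maps local diffeomorphisms along the zero section, and
retractions make them injective near it. It remains to cut down to a symmetric image, which is
possible because the diagonal is symmetric. -/
theorem exists_isAdmissible [T2Space M] [SecondCountableTopology M]
    (hom : om.IsSymplecticOn univ) (hΛ : Λ.Transversal Λ') (hφ : Λ.IsHorizontalPrimitive φ)
    (hφ' : Λ'.IsHorizontalPrimitive φ') (hc : RepresentsDifference φ φ' c)
    {U : Set (TotalSpace (F × F') (E ×ᵇ E'))} (hU : IsOpen U)
    (hU0 : ∀ x : M, (⟨x, 0⟩ : TotalSpace (F × F') (E ×ᵇ E')) ∈ U) :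
    ∃ W, W ⊆ U ∧ IsAdmissible Λ Λ' (covectorMap c) W ∧
      Prod.swap '' (endpointMap Λ Λ' '' W) = endpointMap Λ Λ' '' W := by
  have hmet : TopologicalSpace.MetrizableSpace (TotalSpace (F × F') (E ×ᵇ E')) :=
    totalSpace_metrizableSpace EM
  let z : M → TotalSpace (F × F') (E ×ᵇ E') := zeroSection (F × F') (E ×ᵇ E')
  have hz : Continuous z := (Bundle.contMDiff_zeroSection (IB := 𝓘(ℝ, EM)) ℝ (E ×ᵇ E')
    (F := F × F') (n := ∞)).continuous
  have hFs : ContMDiff 𝓚 (𝓘(ℝ, EM).prod 𝓘(ℝ, EM)) ∞ (endpointMap Λ Λ') := contMDiff_endpointMap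
  have hχs := contMDiff_covectorMap hφ hφ' hc
  have hF : ∀ x, ∃ V, z x ∈ V ∧
      IsDiffeoOntoOpen 𝓚 (𝓘(ℝ, EM).prod 𝓘(ℝ, EM)) (endpointMap Λ Λ') V := fun x =>
    exists_isDiffeoOntoOpen hFs (mfderiv_endpointMap_zero_bijective hΛ x)
  have hχ : ∀ x, ∃ V, z x ∈ V ∧ IsDiffeoOntoOpen 𝓚 (cotangentModel EM) (covectorMap c) V :=
    fun x => exists_isDiffeoOntoOpen hχs
      (mfderiv_covectorMap_zero_bijective hom hΛ hφ hφ' hc x)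
  -- The retraction onto the zero section sends `p` to the zero vector over the second endpoint of
  -- `p`; it visibly factors through the endpoint map. For `χ` below, the zero vector over the foot
  -- point plays this role.
  obtain ⟨W₁, hW₁, hzW₁, hi₁⟩ := exists_isOpen_injOn (A := range z) (f := endpointMap Λ Λ')
    (fun q => z q.2) ((hz.comp continuous_snd).comp hFs.continuous)
    (by rintro _ ⟨x, rfl⟩; exact congrArg (fun q : M × M => z q.2) (endpointMap_zero x))
    (by
      rintro _ ⟨x, rfl⟩
      obtain ⟨V, hV, h⟩ := hF x
      exact ⟨V, h.1.mem_nhds hV, h.injOn⟩)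
  obtain ⟨W₂, hW₂, hzW₂, hi₂⟩ := exists_isOpen_injOn (A := range z) (f := covectorMap c)
    (fun q => z q.proj) (hz.comp (FiberBundle.continuous_proj (F × F') (E ×ᵇ E')))
    (by rintro _ ⟨x, rfl⟩; rfl)
    (by
      rintro _ ⟨x, rfl⟩
      obtain ⟨V, hV, h⟩ := hχ x
      exact ⟨V, h.1.mem_nhds hV, h.injOn⟩)
  choose A hzA hA using hF
  choose B hzB hB using hχ
  let W₀ : Set (TotalSpace (F × F') (E ×ᵇ E')) := U ∩ (W₁ ∩ (W₂ ∩ ⋃ x, A x ∩ B x))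
  have hW₀ : IsOpen W₀ := hU.inter (hW₁.inter (hW₂.inter
    (isOpen_iUnion fun x => (hA x).1.inter (hB x).1)))
  have hzW₀ : ∀ x, z x ∈ W₀ := fun x => ⟨hU0 x, hzW₁ ⟨x, rfl⟩, hzW₂ ⟨x, rfl⟩,
    mem_iUnion.2 ⟨x, hzA x, hzB x⟩⟩
  have dF : IsDiffeoOntoOpen 𝓚 (𝓘(ℝ, EM).prod 𝓘(ℝ, EM)) (endpointMap Λ Λ') W₀ := by
    refine isDiffeoOntoOpen_of_injOn (fun q => z q.2) hW₀ (hi₁.mono fun p hp => hp.2.1)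
      fun p hp => ?_
    obtain ⟨x, hx⟩ := mem_iUnion.1 hp.2.2.2
    exact ⟨A x, hx.1, hA x⟩
  have dχ : IsDiffeoOntoOpen 𝓚 (cotangentModel EM) (covectorMap c) W₀ := by
    refine isDiffeoOntoOpen_of_injOn (fun q => z q.proj) hW₀ (hi₂.mono fun p hp => hp.2.2.1)
      fun p hp => ?_
    obtain ⟨x, hx⟩ := mem_iUnion.1 hp.2.2.2
    exact ⟨B x, hx.2, hB x⟩
  -- The part of `W₀` lying over `S ∩ swap⁻¹ S` has exactly this symmetric set as its image and
  -- still contains the zero section.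
  let S := endpointMap Λ Λ' '' W₀
  have hS : IsOpen S := dF.2.1
  have hS' : IsOpen (S ∩ Prod.swap ⁻¹' S) := hS.inter (hS.preimage continuous_swap)
  have hW : IsOpen (W₀ ∩ endpointMap Λ Λ' ⁻¹' (S ∩ Prod.swap ⁻¹' S)) :=
    hW₀.inter (hS'.preimage hFs.continuous)
  have himg : endpointMap Λ Λ' '' (W₀ ∩ endpointMap Λ Λ' ⁻¹' (S ∩ Prod.swap ⁻¹' S)) =
      S ∩ Prod.swap ⁻¹' S := by
    rw [image_inter_preimage]
    exact inter_eq_right.2 inter_subset_left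
  refine ⟨W₀ ∩ endpointMap Λ Λ' ⁻¹' (S ∩ Prod.swap ⁻¹' S), fun p hp => hp.1.1,
    ⟨hW, fun x => ⟨hzW₀ x, ?_⟩, dχ.mono hW inter_subset_left, dF.mono hW inter_subset_left⟩, ?_⟩
  · have h1 : endpointMap Λ Λ' (z x) = (x, x) := endpointMap_zero x
    have h2 : (x, x) ∈ S := ⟨z x, hzW₀ x, h1⟩
    change endpointMap Λ Λ' (z x) ∈ S ∩ Prod.swap ⁻¹' S
    rw [h1]
    exact ⟨h2, h2⟩
  · rw [himg]
    ext ⟨x, y⟩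
    constructor
    · rintro ⟨⟨a, b⟩, ⟨h1, h2⟩, h3⟩
      obtain ⟨rfl, rfl⟩ := Prod.mk.inj h3
      exact ⟨h2, h1⟩
    · rintro ⟨h1, h2⟩
      exact ⟨(y, x), ⟨h2, h1⟩, rfl⟩

end Admissible

/-! ### Images of smooth maps with a smooth left inverse -/

section LeftInverse

variable {EM : Type*} [NormedAddCommGroup EM] [NormedSpace ℝ EM]
  {H : Type*} [TopologicalSpace H] {I : ModelWithCorners ℝ EM H}
  {M : Type*} [TopologicalSpace M] [ChartedSpace H M]
  {EN : Type*} [NormedAddCommGroup EN] [NormedSpace ℝ EN]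
  {H' : Type*} [TopologicalSpace H'] {J : ModelWithCorners ℝ EN H'}
  {N : Type*} [TopologicalSpace N] [ChartedSpace H' N]

theorem mfderiv_comp_eq_of_eventuallyEq_id {f : N → M} {g : M → N} {y : N}
    (hf : MDifferentiableAt J I f y) (hg : MDifferentiableAt I J g (f y))
    (h : g ∘ f =ᶠ[𝓝 y] id) (v : TangentSpace J y) :
    (mfderiv I J g (f y) (mfderiv J I f y v) : EN) = v := by
  have h1 := mfderiv_comp y hg hf
  have h2 := h.mfderiv_eq (I := J) (I' := J)
  rw [mfderiv_id] at h2
  exact congrArg (fun l : EN →L[ℝ] EN => l v) (h1.symm.trans h2)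

theorem mfderiv_injective_of_leftInverse {f : N → M} {g : M → N} {y : N}
    (hf : MDifferentiableAt J I f y) (hg : MDifferentiableAt I J g (f y))
    (h : g ∘ f =ᶠ[𝓝 y] id) : Function.Injective (mfderiv J I f y) := by
  intro v w hvw
  have h1 := mfderiv_comp_eq_of_eventuallyEq_id hf hg h v
  have h2 := mfderiv_comp_eq_of_eventuallyEq_id hf hg h w
  exact h1.symm.trans ((congrArg (mfderiv I J g (f y)) hvw).trans h2)

theorem IsDiffeoOntoOpen.mfderiv_bijective {f : N → M} {W : Set N} (h : IsDiffeoOntoOpen J I f W)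
    {y : N} (hy : y ∈ W) : Function.Bijective (mfderiv J I f y) := by
  obtain ⟨h1, h2, h3, g, h4, h5⟩ := h
  have hf := (h3.contMDiffAt (h1.mem_nhds hy)).mdifferentiableAt (by simp)
  have hfy := h2.mem_nhds ⟨y, hy, rfl⟩
  have hg := (h4.contMDiffAt hfy).mdifferentiableAt (by simp)
  constructor
  · refine mfderiv_injective_of_leftInverse hf hg ?_
    filter_upwards [h1.mem_nhds hy] with z hz using h5 z hz
  · intro w
    have hf' : MDifferentiableAt J I f (g (f y)) := by rw [h5 y hy]; exact hf
    have e : f ∘ g =ᶠ[𝓝 (f y)] id := by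
      filter_upwards [hfy] with z hz
      obtain ⟨z, hz, rfl⟩ := hz
      simp only [Function.comp_apply, id, h5 z hz]
    have h6 := mfderiv_comp_eq_of_eventuallyEq_id hg hf' e w
    have h7 : ∀ y', y' = y → (∃ v : EN, (mfderiv J I f y' v : EM) = w) →
        ∃ v : EN, (mfderiv J I f y v : EM) = w := by
      rintro _ rfl h
      exact h
    exact h7 _ (h5 y hy) ⟨_, h6⟩

theorem isEmbedding_of_leftInverse {X Y : Type*} [TopologicalSpace X] [TopologicalSpace Y]
    {f : X → Y} {g : Y → X} {O : Set Y} (hf : Continuous f) (hg : ContinuousOn g O)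
    (hO : ∀ x, f x ∈ O) (h : ∀ x, g (f x) = x) : IsEmbedding f := by
  have h1 : IsEmbedding (fun x => (⟨f x, hO x⟩ : O)) :=
    Function.LeftInverse.isEmbedding (f := O.domRestrict g) h hg.domRestrict
      (hf.subtype_mk hO)
  exact IsEmbedding.subtypeVal.comp h1

/-- A smooth left inverse `r` near the image makes `j` an injective immersion and a homeomorphism
onto its image, so charts of `N` followed by `j` parametrize the image. Units and 3-cycles are both
of this form. -/
theorem DiffForm.isLagrangian_of_leftInverse [FiniteDimensional ℝ EN] [J.Boundaryless]
    [IsManifold J ∞ N] {om : DiffForm I M 2}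
    (hd : Module.finrank ℝ EM = 2 * Module.finrank ℝ EN) {j : N → M} {r : M → N} {U₀ : Set N}
    {O₀ : Set M} (hU₀ : IsOpen U₀) (hO₀ : IsOpen O₀) (hj : ContMDiffOn J I ∞ j U₀)
    (hr : ContMDiffOn I J ∞ r O₀) (hjO : ∀ n ∈ U₀, j n ∈ O₀) (hrj : ∀ n ∈ U₀, r (j n) = n)
    (h0 : ∀ n ∈ U₀, om.pullback (J := J) j n = 0) : om.IsLagrangian (j '' U₀) := by
  refine ⟨Module.finrank ℝ EN, hd, ?_⟩
  rintro _ ⟨n, hn, rfl⟩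
  set e := extChartAt J n
  let L : EuclideanSpace ℝ (Fin (Module.finrank ℝ EN)) ≃L[ℝ] EN :=
    ContinuousLinearEquiv.ofFinrankEq (by simp)
  have hA : IsOpen (e.target ∩ e.symm ⁻¹' U₀) :=
    (continuousOn_extChartAt_symm n).isOpen_inter_preimage (isOpen_extChartAt_target n) hU₀
  have hB : IsOpen (U₀ ∩ e.source) := hU₀.inter (isOpen_extChartAt_source n)
  have hU : IsOpen (L ⁻¹' (e.target ∩ e.symm ⁻¹' U₀)) := hA.preimage L.continuous
  -- This neighborhood is cut out by `r`: a point `j n'` of the image lies in it exactly when `n'`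
  -- lies in the chart domain. So the parametrization fills the whole of the image inside it.
  have hO : IsOpen (O₀ ∩ r ⁻¹' (U₀ ∩ e.source)) := hr.continuousOn.isOpen_inter_preimage hO₀ hB
  have hi : ContMDiffOn 𝓘(ℝ, EuclideanSpace ℝ (Fin (Module.finrank ℝ EN))) J ∞ (e.symm ∘ L)
      (L ⁻¹' (e.target ∩ e.symm ⁻¹' U₀)) :=
    (contMDiffOn_extChartAt_symm n).comp L.contDiff.contMDiff.contMDiffOn fun u hu => hu.1
  have hg : ContMDiffOn 𝓘(ℝ, EuclideanSpace ℝ (Fin (Module.finrank ℝ EN))) I ∞ (j ∘ (e.symm ∘ L))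
      (L ⁻¹' (e.target ∩ e.symm ⁻¹' U₀)) := hj.comp hi fun u hu => hu.2
  have hgO : ∀ u ∈ L ⁻¹' (e.target ∩ e.symm ⁻¹' U₀),
      j (e.symm (L u)) ∈ O₀ ∩ r ⁻¹' (U₀ ∩ e.source) := by
    intro u hu
    refine ⟨hjO _ hu.2, ?_⟩
    rw [mem_preimage, hrj _ hu.2]
    exact ⟨hu.2, e.map_target hu.1⟩
  have hk : ContMDiffOn I 𝓘(ℝ, EuclideanSpace ℝ (Fin (Module.finrank ℝ EN))) ∞
      (fun p => L.symm (e (r p))) (O₀ ∩ r ⁻¹' (U₀ ∩ e.source)) := by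
    have h1 : ContMDiffOn J 𝓘(ℝ, EN) ∞ e e.source := contMDiffOn_extChartAt (n := ∞) |>.mono
      (by rw [extChartAt_source])
    exact L.symm.contDiff.contMDiff.comp_contMDiffOn
      (h1.comp (hr.mono inter_subset_left) fun p hp => hp.2.2)
  have hkg : ∀ u ∈ L ⁻¹' (e.target ∩ e.symm ⁻¹' U₀), L.symm (e (r (j (e.symm (L u))))) = u := by
    intro u hu
    rw [hrj _ hu.2, e.right_inv hu.1, L.symm_apply_apply]
  refine ⟨O₀ ∩ r ⁻¹' (U₀ ∩ e.source), L ⁻¹' (e.target ∩ e.symm ⁻¹' U₀), j ∘ (e.symm ∘ L), hO,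
    ?_, hU, ?_, hg, ?_, ?_⟩
  · refine ⟨hjO n hn, ?_⟩
    rw [mem_preimage, hrj n hn]
    exact ⟨hn, mem_extChartAt_source n⟩
  · ext p
    constructor
    · rintro ⟨u, hu, rfl⟩
      exact ⟨⟨_, hu.2, rfl⟩, hgO u hu⟩
    · rintro ⟨⟨n', hn', rfl⟩, -, hp⟩
      rw [mem_preimage, hrj n' hn'] at hp
      refine ⟨L.symm (e n'), ?_, ?_⟩
      · rw [mem_preimage, L.apply_symm_apply]
        refine ⟨e.map_source hp.2, ?_⟩
        rw [mem_preimage, e.left_inv hp.2]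
        exact hn'
      · simp only [Function.comp_apply, L.apply_symm_apply, e.left_inv hp.2]
  · let U := L ⁻¹' (e.target ∩ e.symm ⁻¹' U₀)
    let k : (O₀ ∩ r ⁻¹' (U₀ ∩ e.source) : Set M) → U := fun p => ⟨L.symm (e (r p)), by
      have hp := p.2.2
      rw [mem_preimage, L.apply_symm_apply]
      refine ⟨e.map_source hp.2, ?_⟩
      rw [mem_preimage, e.left_inv hp.2]
      exact hp.1⟩
    have h1 : IsEmbedding (fun u : U =>
        (⟨j (e.symm (L u)), hgO u u.2⟩ : (O₀ ∩ r ⁻¹' (U₀ ∩ e.source) : Set M))) := by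
      refine Function.LeftInverse.isEmbedding (f := k) (fun u => Subtype.ext (hkg u u.2)) ?_ ?_
      · exact Continuous.subtype_mk hk.continuousOn.domRestrict _
      · exact Continuous.subtype_mk hg.continuousOn.domRestrict _
    exact IsEmbedding.subtypeVal.comp h1
  · intro u hu
    have hgu : MDifferentiableAt 𝓘(ℝ, EuclideanSpace ℝ (Fin (Module.finrank ℝ EN))) I
        (j ∘ (e.symm ∘ L)) u := (hg.contMDiffAt (hU.mem_nhds hu)).mdifferentiableAt (by simp)
    constructor
    · refine mfderiv_injective_of_leftInverse hgu
        ((hk.contMDiffAt (hO.mem_nhds (hgO u hu))).mdifferentiableAt (by simp)) ?_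
      filter_upwards [hU.mem_nhds hu] with u' hu' using hkg u' hu'
    · refine (DiffForm.pullback_pullback (g := e.symm ∘ L) om
        ((hj.contMDiffAt (hU₀.mem_nhds hu.2)).mdifferentiableAt (by simp))
        ((hi.contMDiffAt (hU.mem_nhds hu)).mdifferentiableAt (by simp))).symm.trans ?_
      exact DiffForm.pullback_eq_of_eq (β := 0) (h0 _ hu.2)

end LeftInverse

/-! ### The groupoid of a neighbourhood of the diagonal -/

section PairGroupoid

variable {EM : Type*} [NormedAddCommGroup EM] [NormedSpace ℝ EM]
  {H : Type*} [TopologicalSpace H]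
  {EP : Type*} [NormedAddCommGroup EP] [NormedSpace ℝ EP]
  {H' : Type*} [TopologicalSpace H']

/-- A diffeomorphism `toPair` (with inverse `ofPair`) of the open set `V` onto an open neighbourhood
of the diagonal of `M × M`, with a smooth lift `unit` of the diagonal. -/
structure PairChart (I : ModelWithCorners ℝ EM H)
    (M : Type*) [TopologicalSpace M] [ChartedSpace H M]
    (J : ModelWithCorners ℝ EP H') {P : Type*} [TopologicalSpace P] [ChartedSpace H' P]
    (V : Set P) where
  toPair : P → M × M
  ofPair : M × M → P
  unit : M → P
  isOpen_source : IsOpen V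
  isOpen_image : IsOpen (toPair '' V)
  contMDiffOn_toPair : ContMDiffOn J (I.prod I) ∞ toPair V
  contMDiffOn_ofPair : ContMDiffOn (I.prod I) J ∞ ofPair (toPair '' V)
  ofPair_toPair : ∀ α ∈ V, ofPair (toPair α) = α
  contMDiff_unit : ContMDiff I J ∞ unit
  unit_mem : ∀ x, unit x ∈ V
  toPair_unit : ∀ x, toPair (unit x) = (x, x)

namespace PairChart

variable {I : ModelWithCorners ℝ EM H}
  {M : Type*} [TopologicalSpace M] [ChartedSpace H M]
  {J : ModelWithCorners ℝ EP H'} {P : Type*} [TopologicalSpace P] [ChartedSpace H' P]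
  {V : Set P} (C : PairChart I M J V)

theorem ofPair_mem {q : M × M} (hq : q ∈ C.toPair '' V) : C.ofPair q ∈ V := by
  obtain ⟨α, hα, rfl⟩ := hq
  rwa [C.ofPair_toPair α hα]

theorem toPair_ofPair {q : M × M} (hq : q ∈ C.toPair '' V) : C.toPair (C.ofPair q) = q := by
  obtain ⟨α, hα, rfl⟩ := hq
  rw [C.ofPair_toPair α hα]

theorem toPair_mem {α : P} (hα : α ∈ V) : ((C.toPair α).1, (C.toPair α).2) ∈ C.toPair '' V :=
  ⟨α, hα, rfl⟩

theorem diag_mem (x : M) : (x, x) ∈ C.toPair '' V := ⟨C.unit x, C.unit_mem x, C.toPair_unit x⟩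

theorem ofPair_diag (x : M) : C.ofPair (x, x) = C.unit x := by
  rw [← C.toPair_unit x, C.ofPair_toPair _ (C.unit_mem x)]

theorem isDiffeoOntoOpen : IsDiffeoOntoOpen J (I.prod I) C.toPair V :=
  ⟨C.isOpen_source, C.isOpen_image, C.contMDiffOn_toPair, C.ofPair, C.contMDiffOn_ofPair,
    C.ofPair_toPair⟩

theorem contMDiffOn_target : ContMDiffOn J I ∞ (fun α => (C.toPair α).1) V :=
  contMDiff_fst.comp_contMDiffOn C.contMDiffOn_toPair

theorem contMDiffOn_source : ContMDiffOn J I ∞ (fun α => (C.toPair α).2) V :=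
  contMDiff_snd.comp_contMDiffOn C.contMDiffOn_toPair

theorem mdifferentiableAt_toPair {α : P} (hα : α ∈ V) : MDifferentiableAt J (I.prod I) C.toPair α :=
  (C.contMDiffOn_toPair.contMDiffAt (C.isOpen_source.mem_nhds hα)).mdifferentiableAt (by simp)

theorem surjective_mfderiv_target {α : P} (hα : α ∈ V) :
    Function.Surjective (mfderiv J I (fun α => (C.toPair α).1) α) := by
  intro w
  obtain ⟨v, hv⟩ := (C.isDiffeoOntoOpen.mfderiv_bijective hα).2 ((w, 0) : EM × EM)
  refine ⟨v, ?_⟩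
  have h := mfderiv_comp (I'' := I) (g := (Prod.fst : M × M → M)) α mdifferentiableAt_fst
    (C.mdifferentiableAt_toPair hα)
  rw [mfderiv_fst] at h
  refine (congrArg (fun l : EP →L[ℝ] EM => l v) h).trans ?_
  exact congrArg (fun q : EM × EM => q.1) hv

theorem surjective_mfderiv_source {α : P} (hα : α ∈ V) :
    Function.Surjective (mfderiv J I (fun α => (C.toPair α).2) α) := by
  intro w
  obtain ⟨v, hv⟩ := (C.isDiffeoOntoOpen.mfderiv_bijective hα).2 ((0, w) : EM × EM)
  refine ⟨v, ?_⟩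
  have h := mfderiv_comp (I'' := I) (g := (Prod.snd : M × M → M)) α mdifferentiableAt_snd
    (C.mdifferentiableAt_toPair hα)
  rw [mfderiv_snd] at h
  refine (congrArg (fun l : EP →L[ℝ] EM => l v) h).trans ?_
  exact congrArg (fun q : EM × EM => q.2) hv

/-- The domain of the product. -/
noncomputable def mulDom : Set (P × P) :=
  {p | p.1 ∈ V ∧ p.2 ∈ V ∧ (C.toPair p.1).2 = (C.toPair p.2).1 ∧
    ((C.toPair p.1).1, (C.toPair p.2).2) ∈ C.toPair '' V}

/-- The domain of the inverse. -/
noncomputable def invDom : Set P := {α | α ∈ V ∧ (C.toPair α).swap ∈ C.toPair '' V}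

theorem isOpen_invDom : IsOpen C.invDom :=
  C.contMDiffOn_toPair.continuousOn.isOpen_inter_preimage C.isOpen_source
    (C.isOpen_image.preimage continuous_swap)

/-- The product. -/
noncomputable def mul (p : P × P) : P := C.ofPair ((C.toPair p.1).1, (C.toPair p.2).2)

/-- The inverse. -/
noncomputable def inv (α : P) : P := C.ofPair (C.toPair α).swap

theorem toPair_mul {p : P × P} (hp : p ∈ C.mulDom) :
    C.toPair (C.mul p) = ((C.toPair p.1).1, (C.toPair p.2).2) := C.toPair_ofPair hp.2.2.2

theorem mul_mem {p : P × P} (hp : p ∈ C.mulDom) : C.mul p ∈ V := C.ofPair_mem hp.2.2.2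

theorem toPair_inv {α : P} (hα : α ∈ C.invDom) : C.toPair (C.inv α) = (C.toPair α).swap :=
  C.toPair_ofPair hα.2

theorem inv_mem {α : P} (hα : α ∈ C.invDom) : C.inv α ∈ V := C.ofPair_mem hα.2

theorem contMDiffOn_mul : ContMDiffOn (J.prod J) J ∞ C.mul C.mulDom := by
  have h1 : ContMDiffOn (J.prod J) I ∞ (fun p : P × P => (C.toPair p.1).1) C.mulDom :=
    C.contMDiffOn_target.comp contMDiff_fst.contMDiffOn fun p hp => hp.1
  have h2 : ContMDiffOn (J.prod J) I ∞ (fun p : P × P => (C.toPair p.2).2) C.mulDom :=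
    C.contMDiffOn_source.comp contMDiff_snd.contMDiffOn fun p hp => hp.2.1
  exact C.contMDiffOn_ofPair.comp (h1.prodMk h2) fun p hp => hp.2.2.2

theorem contMDiffOn_inv : ContMDiffOn J J ∞ C.inv C.invDom := by
  have h1 : ContMDiffOn J (I.prod I) ∞ (fun α => (C.toPair α).swap) C.invDom :=
    (C.contMDiffOn_source.prodMk C.contMDiffOn_target).mono fun α hα => hα.1
  exact C.contMDiffOn_ofPair.comp h1 fun α hα => hα.2

theorem mulDom_eq : ∃ O : Set (P × P), IsOpen O ∧
    C.mulDom = {p | p.1 ∈ V ∧ p.2 ∈ V ∧ (C.toPair p.1).2 = (C.toPair p.2).1} ∩ O := by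
  have h1 : ContinuousOn (fun p : P × P => ((C.toPair p.1).1, (C.toPair p.2).2)) (V ×ˢ V) :=
    (C.contMDiffOn_target.continuousOn.comp continuousOn_fst fun p hp => hp.1).prodMk
      (C.contMDiffOn_source.continuousOn.comp continuousOn_snd fun p hp => hp.2)
  refine ⟨_, h1.isOpen_inter_preimage (C.isOpen_source.prod C.isOpen_source) C.isOpen_image, ?_⟩
  ext p
  constructor
  · rintro ⟨h1, h2, h3, h4⟩
    exact ⟨⟨h1, h2, h3⟩, ⟨h1, h2⟩, h4⟩
  · rintro ⟨⟨h1, h2, h3⟩, -, h4⟩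
    exact ⟨h1, h2, h3, h4⟩

/-- The local Lie groupoid on `V` induced by the pair groupoid `M × M`. -/
noncomputable def groupoid : LocalLieGroupoid I M J V where
  s α := (C.toPair α).2
  t α := (C.toPair α).1
  unit := C.unit
  mul := C.mul
  inv := C.inv
  mulDom := C.mulDom
  invDom := C.invDom
  isOpen_arrows := C.isOpen_source
  smooth_s := C.contMDiffOn_source
  smooth_t := C.contMDiffOn_target
  surj_s := eq_univ_of_forall fun x => ⟨C.unit x, C.unit_mem x, by simp only [C.toPair_unit]⟩
  surj_t := eq_univ_of_forall fun x => ⟨C.unit x, C.unit_mem x, by simp only [C.toPair_unit]⟩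
  submersion_s _ hα := C.surjective_mfderiv_source hα
  submersion_t _ hα := C.surjective_mfderiv_target hα
  unit_mem := C.unit_mem
  smooth_unit := C.contMDiff_unit
  embedding_unit := isEmbedding_of_leftInverse C.contMDiff_unit.continuous
    C.contMDiffOn_source.continuousOn C.unit_mem fun x => by rw [C.toPair_unit]
  immersion_unit x := by
    refine mfderiv_injective_of_leftInverse (g := fun α => (C.toPair α).2)
      ((C.contMDiff_unit x).mdifferentiableAt (by simp))
      ((C.contMDiffOn_source.contMDiffAt
        (C.isOpen_source.mem_nhds (C.unit_mem x))).mdifferentiableAt (by simp))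
      (Filter.Eventually.of_forall fun y => ?_)
    simp only [Function.comp_apply, C.toPair_unit, id]
  s_unit x := by rw [C.toPair_unit]
  t_unit x := by rw [C.toPair_unit]
  mulDom_eq := C.mulDom_eq
  smooth_mul := C.contMDiffOn_mul
  mul_mem _ hp := C.mul_mem hp
  s_mul _ hp := by rw [C.toPair_mul hp]
  t_mul _ hp := by rw [C.toPair_mul hp]
  unit_mul α hα := by
    refine ⟨⟨C.unit_mem _, hα, ?_, ?_⟩, ?_⟩
    · simp only [C.toPair_unit]
    · simp only [C.toPair_unit]
      exact C.toPair_mem hα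
    · simp only [mul, C.toPair_unit]
      exact C.ofPair_toPair α hα
  mul_unit α hα := by
    refine ⟨⟨hα, C.unit_mem _, ?_, ?_⟩, ?_⟩
    · simp only [C.toPair_unit]
    · simp only [C.toPair_unit]
      exact C.toPair_mem hα
    · simp only [mul, C.toPair_unit]
      exact C.ofPair_toPair α hα
  -- Given that `αβ` and `βγ` are defined, both conditions say that the pair of the target of `α`
  -- and the source of `γ` belongs to the image. Both triple products are the arrow of that pair.
  assoc_dom α β γ h1 h2 := by
    have e1 := C.toPair_mul h1
    have e2 := C.toPair_mul h2
    constructor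
    · rintro ⟨-, h3, -, h4⟩
      refine ⟨h1.1, C.mul_mem h2, ?_, ?_⟩
      · simp only [e2]; exact h1.2.2.1
      · simp only [e2]
        simp only [e1] at h4
        exact h4
    · rintro ⟨h3, -, -, h4⟩
      refine ⟨C.mul_mem h1, h2.2.1, ?_, ?_⟩
      · simp only [e1]; exact h2.2.2.1
      · simp only [e1]
        simp only [e2] at h4
        exact h4
  assoc α β γ h1 h2 _ := by
    have e1 := C.toPair_mul h1
    have e2 := C.toPair_mul h2
    change C.ofPair ((C.toPair (C.mul (α, β))).1, _) = C.ofPair (_, (C.toPair (C.mul (β, γ))).2)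
    rw [e1, e2]
  isOpen_invDom := C.isOpen_invDom
  invDom_subset _ hα := hα.1
  unit_mem_invDom x := ⟨C.unit_mem x, by rw [C.toPair_unit]; exact C.diag_mem x⟩
  smooth_inv := C.contMDiffOn_inv
  inv_mem α hα := ⟨C.inv_mem hα, by rw [C.toPair_inv hα, Prod.swap_swap]; exact C.toPair_mem hα.1⟩
  inv_inv α hα := by
    change C.ofPair (C.toPair (C.inv α)).swap = α
    rw [C.toPair_inv hα, Prod.swap_swap, C.ofPair_toPair α hα.1]
  s_inv α hα := by rw [C.toPair_inv hα]; rfl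
  t_inv α hα := by rw [C.toPair_inv hα]; rfl
  mul_inv α hα := by
    have e := C.toPair_inv hα
    refine ⟨⟨hα.1, C.inv_mem hα, ?_, ?_⟩, ?_⟩
    · simp only [e, Prod.fst_swap]
    · simp only [e, Prod.snd_swap]; exact C.diag_mem _
    · simp only [mul, e, Prod.snd_swap]; exact C.ofPair_diag _
  inv_mul α hα := by
    have e := C.toPair_inv hα
    refine ⟨⟨C.inv_mem hα, hα.1, ?_, ?_⟩, ?_⟩
    · simp only [e, Prod.snd_swap]
    · simp only [e, Prod.fst_swap]; exact C.diag_mem _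
    · simp only [mul, e, Prod.fst_swap]; exact C.ofPair_diag _

/-- The triples of points whose pairs all belong to the image of the chart. -/
noncomputable def cycleDom : Set (M × M × M) :=
  {q | (q.1, q.2.1) ∈ C.toPair '' V ∧ (q.2.1, q.2.2) ∈ C.toPair '' V ∧
    (q.2.2, q.1) ∈ C.toPair '' V ∧ (q.1, q.2.2) ∈ C.toPair '' V}

theorem isOpen_cycleDom : IsOpen C.cycleDom := by
  have h1 : Continuous fun q : M × M × M => (q.1, q.2.1) := by fun_prop
  have h2 : Continuous fun q : M × M × M => (q.2.1, q.2.2) := by fun_prop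
  have h3 : Continuous fun q : M × M × M => (q.2.2, q.1) := by fun_prop
  have h4 : Continuous fun q : M × M × M => (q.1, q.2.2) := by fun_prop
  exact (C.isOpen_image.preimage h1).inter ((C.isOpen_image.preimage h2).inter
    ((C.isOpen_image.preimage h3).inter (C.isOpen_image.preimage h4)))

/-- The 3-cycle with the given vertices. -/
noncomputable def cycle (q : M × M × M) : P × P × P :=
  (C.ofPair (q.1, q.2.1), C.ofPair (q.2.1, q.2.2), C.ofPair (q.2.2, q.1))

/-- A product `αβγ` is a unit precisely when the arrows close up as `(x,y)`, `(y,z)`, `(z,x)`. The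
fourth condition in `cycleDom`, on `(x,z)`, expresses that `αβ` is defined; it does not follow from
the condition on `(z,x)` unless the image is symmetric. -/
theorem threeCycles_eq : C.groupoid.threeCycles = C.cycle '' C.cycleDom := by
  ext ⟨α, β, γ⟩
  constructor
  · rintro ⟨h1, h2, h3⟩
    have h1' : (α, β) ∈ C.mulDom := h1
    have h2' : (C.mul (α, β), γ) ∈ C.mulDom := h2
    have h3' : C.mul (C.mul (α, β), γ) = C.unit (C.toPair α).1 := h3
    have e1 := C.toPair_mul h1'
    have e2 := C.toPair_mul h2'
    rw [h3', C.toPair_unit] at e2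
    have a1 : (C.toPair α).1 = (C.toPair γ).2 := congrArg Prod.snd e2
    have a2 : (C.toPair α).2 = (C.toPair β).1 := h1'.2.2.1
    have a3 : (C.toPair β).2 = (C.toPair γ).1 := by
      have := h2'.2.2.1
      simp only [e1] at this
      exact this
    have m1 : ((C.toPair α).1, (C.toPair β).1) = C.toPair α := by rw [← a2]
    have m2 : ((C.toPair β).1, (C.toPair γ).1) = C.toPair β := by rw [← a3]
    have m3 : ((C.toPair γ).1, (C.toPair α).1) = C.toPair γ := by rw [a1]
    refine ⟨((C.toPair α).1, (C.toPair β).1, (C.toPair γ).1), ⟨?_, ?_, ?_, ?_⟩, ?_⟩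
    · simp only [m1]; exact ⟨α, h1'.1, rfl⟩
    · simp only [m2]; exact ⟨β, h1'.2.1, rfl⟩
    · simp only [m3]; exact ⟨γ, h2'.2.1, rfl⟩
    · simp only [← a3]; exact h1'.2.2.2
    · simp only [cycle, m1, m2, m3, C.ofPair_toPair α h1'.1, C.ofPair_toPair β h1'.2.1,
        C.ofPair_toPair γ h2'.2.1]
  · rintro ⟨⟨x, y, z⟩, ⟨h1, h2, h3, h4⟩, h5⟩
    simp only at h1 h2 h3 h4
    obtain ⟨rfl, h6⟩ := Prod.mk.inj h5
    obtain ⟨rfl, rfl⟩ := Prod.mk.inj h6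
    have d1 : (C.ofPair (x, y), C.ofPair (y, z)) ∈ C.mulDom := by
      refine ⟨C.ofPair_mem h1, C.ofPair_mem h2, ?_, ?_⟩
      · simp only [C.toPair_ofPair h1, C.toPair_ofPair h2]
      · simp only [C.toPair_ofPair h1, C.toPair_ofPair h2]; exact h4
    have e1 := C.toPair_mul d1
    simp only [C.toPair_ofPair h1, C.toPair_ofPair h2] at e1
    refine ⟨d1, ⟨C.mul_mem d1, C.ofPair_mem h3, ?_, ?_⟩, ?_⟩
    · change (C.toPair (C.mul _)).2 = _
      simp only [e1, C.toPair_ofPair h3]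
    · change ((C.toPair (C.mul _)).1, _) ∈ _
      simp only [e1, C.toPair_ofPair h3]
      exact C.diag_mem x
    · change C.ofPair ((C.toPair (C.mul _)).1, _) = C.unit (C.toPair _).1
      simp only [e1, C.toPair_ofPair h3, C.toPair_ofPair h1]
      exact C.ofPair_diag x

theorem contMDiffOn_cycle : ContMDiffOn (I.prod (I.prod I)) (J.prod (J.prod J)) ∞ C.cycle
    C.cycleDom := by
  have p1 : ContMDiff (I.prod (I.prod I)) I ∞ fun q : M × M × M => q.1 := contMDiff_fst
  have p2 : ContMDiff (I.prod (I.prod I)) I ∞ fun q : M × M × M => q.2.1 :=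
    contMDiff_fst.comp contMDiff_snd
  have p3 : ContMDiff (I.prod (I.prod I)) I ∞ fun q : M × M × M => q.2.2 :=
    contMDiff_snd.comp contMDiff_snd
  have h1 := C.contMDiffOn_ofPair.comp (p1.prodMk p2).contMDiffOn
    fun (q : M × M × M) (hq : q ∈ C.cycleDom) => hq.1
  have h2 := C.contMDiffOn_ofPair.comp (p2.prodMk p3).contMDiffOn
    fun (q : M × M × M) (hq : q ∈ C.cycleDom) => hq.2.1
  have h3 := C.contMDiffOn_ofPair.comp (p3.prodMk p1).contMDiffOn
    fun (q : M × M × M) (hq : q ∈ C.cycleDom) => hq.2.2.1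
  exact h1.prodMk (h2.prodMk h3)

/-- The vertices of a 3-cycle. -/
noncomputable def vertices (p : P × P × P) : M × M × M :=
  ((C.toPair p.1).1, (C.toPair p.2.1).1, (C.toPair p.2.2).1)

theorem contMDiffOn_vertices : ContMDiffOn (J.prod (J.prod J)) (I.prod (I.prod I)) ∞ C.vertices
    (V ×ˢ V ×ˢ V) := by
  have p1 : ContMDiff (J.prod (J.prod J)) J ∞ fun q : P × P × P => q.1 := contMDiff_fst
  have p2 : ContMDiff (J.prod (J.prod J)) J ∞ fun q : P × P × P => q.2.1 :=
    contMDiff_fst.comp contMDiff_snd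
  have p3 : ContMDiff (J.prod (J.prod J)) J ∞ fun q : P × P × P => q.2.2 :=
    contMDiff_snd.comp contMDiff_snd
  have h1 := C.contMDiffOn_target.comp p1.contMDiffOn
    fun (q : P × P × P) (hq : q ∈ V ×ˢ V ×ˢ V) => hq.1
  have h2 := C.contMDiffOn_target.comp p2.contMDiffOn
    fun (q : P × P × P) (hq : q ∈ V ×ˢ V ×ˢ V) => hq.2.1
  have h3 := C.contMDiffOn_target.comp p3.contMDiffOn
    fun (q : P × P × P) (hq : q ∈ V ×ˢ V ×ˢ V) => hq.2.2
  exact h1.prodMk (h2.prodMk h3)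

theorem cycle_mem {q : M × M × M} (hq : q ∈ C.cycleDom) : C.cycle q ∈ V ×ˢ V ×ˢ V :=
  ⟨C.ofPair_mem hq.1, C.ofPair_mem hq.2.1, C.ofPair_mem hq.2.2.1⟩

theorem vertices_cycle {q : M × M × M} (hq : q ∈ C.cycleDom) : C.vertices (C.cycle q) = q := by
  simp only [vertices, cycle, C.toPair_ofPair hq.1, C.toPair_ofPair hq.2.1,
    C.toPair_ofPair hq.2.2.1]

end PairChart

end PairGroupoid

/-! ### The symplectic structure of the groupoid -/

section SymplecticGroupoid

variable {EM : Type*} [NormedAddCommGroup EM] [NormedSpace ℝ EM] [FiniteDimensional ℝ EM]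
  {M : Type*} [TopologicalSpace M] [ChartedSpace EM M] [IsManifold 𝓘(ℝ, EM) ∞ M]
  {EP : Type*} [NormedAddCommGroup EP] [NormedSpace ℝ EP] [FiniteDimensional ℝ EP]
  {H' : Type*} [TopologicalSpace H'] {J : ModelWithCorners ℝ EP H'} [J.Boundaryless]
  {P : Type*} [TopologicalSpace P] [ChartedSpace H' P] [IsManifold J ∞ P]
  {V : Set P} (C : PairChart 𝓘(ℝ, EM) M J V) {om : DiffForm 𝓘(ℝ, EM) M 2} {Ω : DiffForm J P 2}

namespace PairChart

theorem pullback_form (hΩ : ∀ α ∈ V, om.pairForm.pullback (J := J) C.toPair α = Ω α)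
    {EQ : Type*} [NormedAddCommGroup EQ] [NormedSpace ℝ EQ]
    {HQ : Type*} [TopologicalSpace HQ] {K : ModelWithCorners ℝ EQ HQ}
    {Q : Type*} [TopologicalSpace Q] [ChartedSpace HQ Q] {g : Q → P} {q : Q}
    (hg : MDifferentiableAt K J g q) (hq : g q ∈ V) :
    Ω.pullback (J := K) g q = om.pullback (J := K) (fun q => (C.toPair (g q)).2) q -
      om.pullback (J := K) (fun q => (C.toPair (g q)).1) q := by
  have hf := C.mdifferentiableAt_toPair hq
  rw [← DiffForm.pullback_eq_of_eq (hΩ _ hq), DiffForm.pullback_pullback _ hf hg]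
  exact pullback_pairForm (hf.comp q hg)

theorem pairForm_smoothAt (hom : om.IsSymplecticOn univ) (q : M × M) : om.pairForm.SmoothAt q :=
  ((hom.smooth.smoothAt Filter.univ_mem).pullback
      (Filter.Eventually.of_forall fun _ => contMDiffAt_snd)).sub
    ((hom.smooth.smoothAt Filter.univ_mem).pullback
      (Filter.Eventually.of_forall fun _ => contMDiffAt_fst))

theorem extD_pairForm (hom : om.IsSymplecticOn univ) (q : M × M) : om.pairForm.extD q = 0 := by
  have hs : ∀ x, om.SmoothAt x := fun x => hom.smooth.smoothAt Filter.univ_mem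
  have hc : om.extD = 0 := funext fun x => hom.closed x (mem_univ x)
  have h1 : ∀ᶠ w in 𝓝 q, ContMDiffAt (𝓘(ℝ, EM).prod 𝓘(ℝ, EM)) 𝓘(ℝ, EM) ∞
    (fun p : M × M => p.2) w := Filter.Eventually.of_forall fun _ => contMDiffAt_snd
  have h2 : ∀ᶠ w in 𝓝 q, ContMDiffAt (𝓘(ℝ, EM).prod 𝓘(ℝ, EM)) 𝓘(ℝ, EM) ∞
    (fun p : M × M => p.1) w := Filter.Eventually.of_forall fun _ => contMDiffAt_fst
  rw [DiffForm.pairForm, DiffForm.extD_sub ((hs _).pullback h1) ((hs _).pullback h2),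
    DiffForm.extD_pullback (hs _) h1, DiffForm.extD_pullback (hs _) h2, hc]
  exact sub_self _

theorem eventually_contMDiffAt_toPair {α : P} (hα : α ∈ V) :
    ∀ᶠ β in 𝓝 α, ContMDiffAt J (𝓘(ℝ, EM).prod 𝓘(ℝ, EM)) ∞ C.toPair β := by
  filter_upwards [C.isOpen_source.mem_nhds hα] with β hβ
  exact C.contMDiffOn_toPair.contMDiffAt (C.isOpen_source.mem_nhds hβ)

theorem eventually_eq_pullback
    (hΩ : ∀ α ∈ V, om.pairForm.pullback (J := J) C.toPair α = Ω α) {α : P} (hα : α ∈ V) :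
    ∀ᶠ β in 𝓝 α, Ω β = om.pairForm.pullback (J := J) C.toPair β := by
  filter_upwards [C.isOpen_source.mem_nhds hα] with β hβ using (hΩ β hβ).symm

theorem isSymplecticOn (hom : om.IsSymplecticOn univ)
    (hΩ : ∀ α ∈ V, om.pairForm.pullback (J := J) C.toPair α = Ω α) : Ω.IsSymplecticOn V := by
  refine ⟨DiffForm.smoothOn_of_smoothAt fun α hα => ?_, fun α hα => ?_, fun α hα v hv => ?_⟩
  · exact ((pairForm_smoothAt hom _).pullback (C.eventually_contMDiffAt_toPair hα)).congr
      (C.eventually_eq_pullback hΩ hα)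
  · rw [DiffForm.extD_congr (C.eventually_eq_pullback hΩ hα),
      DiffForm.extD_pullback (pairForm_smoothAt hom _) (C.eventually_contMDiffAt_toPair hα)]
    exact DiffForm.pullback_eq_of_eq (β := 0) (extD_pairForm hom _)
  · have hb := C.isDiffeoOntoOpen.mfderiv_bijective hα
    refine (injective_iff_map_eq_zero _).1 hb.1 v ?_
    refine pairForm_nondegenerate (fun x => hom.nondegenerate x (mem_univ x)) (C.toPair α) _
      fun w => ?_
    obtain ⟨w, rfl⟩ := hb.2 w
    refine Eq.trans ?_ ((congrArg (fun l : EP [⋀^Fin 2]→L[ℝ] ℝ => l ![v, w]) (hΩ α hα)).trans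
      (hv w))
    refine congrArg (om.pairForm (C.toPair α)) (funext fun i => ?_)
    fin_cases i <;> rfl

/-- Both endpoints of a unit are the same point, so the two copies of `om` cancel. -/
theorem pullback_unit (hΩ : ∀ α ∈ V, om.pairForm.pullback (J := J) C.toPair α = Ω α) (x : M) :
    Ω.pullback (J := 𝓘(ℝ, EM)) C.unit x = 0 := by
  rw [C.pullback_form hΩ ((C.contMDiff_unit x).mdifferentiableAt (by simp)) (C.unit_mem x)]
  simp only [C.toPair_unit, sub_self]

theorem isLagrangian_range_unit (hd : Module.finrank ℝ EP = 2 * Module.finrank ℝ EM)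
    (hΩ : ∀ α ∈ V, om.pairForm.pullback (J := J) C.toPair α = Ω α) :
    Ω.IsLagrangian (range C.unit) := by
  rw [← image_univ]
  exact DiffForm.isLagrangian_of_leftInverse hd isOpen_univ C.isOpen_source
    C.contMDiff_unit.contMDiffOn C.contMDiffOn_source (fun x _ => C.unit_mem x)
    (fun x _ => by rw [C.toPair_unit]) fun x _ => C.pullback_unit hΩ x

/-- Inversion exchanges the two endpoints, and the pair form changes sign under this exchange. -/
theorem pullback_inv (hΩ : ∀ α ∈ V, om.pairForm.pullback (J := J) C.toPair α = Ω α)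
    {α : P} (hα : α ∈ C.invDom) : Ω.pullback (J := J) C.inv α = - Ω α := by
  have hn := C.isOpen_invDom.mem_nhds hα
  rw [C.pullback_form hΩ ((C.contMDiffOn_inv.contMDiffAt hn).mdifferentiableAt (by simp))
    (C.inv_mem hα), ← hΩ α hα.1, pullback_pairForm (C.mdifferentiableAt_toPair hα.1), neg_sub]
  congr 1
  · refine DiffForm.pullback_congr om ?_
    filter_upwards [hn] with β hβ
    rw [C.toPair_inv hβ, Prod.snd_swap]
  · refine DiffForm.pullback_congr om ?_
    filter_upwards [hn] with β hβ
    rw [C.toPair_inv hβ, Prod.fst_swap]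

theorem pullback_ofPair (hΩ : ∀ α ∈ V, om.pairForm.pullback (J := J) C.toPair α = Ω α)
    {EQ : Type*} [NormedAddCommGroup EQ] [NormedSpace ℝ EQ]
    {HQ : Type*} [TopologicalSpace HQ] {K : ModelWithCorners ℝ EQ HQ}
    {Q : Type*} [TopologicalSpace Q] [ChartedSpace HQ Q] {a b : Q → M} {q : Q}
    (ha : ContMDiffAt K 𝓘(ℝ, EM) ∞ a q) (hb : ContMDiffAt K 𝓘(ℝ, EM) ∞ b q)
    (hq : (a q, b q) ∈ C.toPair '' V) :
    Ω.pullback (J := K) (fun q => C.ofPair (a q, b q)) q =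
      om.pullback (J := K) b q - om.pullback (J := K) a q := by
  have hab := ha.prodMk hb
  have hn := C.isOpen_image.mem_nhds hq
  have hc : ContMDiffAt K J ∞ (fun q => C.ofPair (a q, b q)) q :=
    ContMDiffAt.comp q (C.contMDiffOn_ofPair.contMDiffAt hn) hab
  rw [C.pullback_form hΩ (hc.mdifferentiableAt (by simp)) (C.ofPair_mem hq)]
  have he := hab.continuousAt hn
  congr 1
  · refine DiffForm.pullback_congr om ?_
    filter_upwards [he] with q' hq'
    rw [C.toPair_ofPair hq']
  · refine DiffForm.pullback_congr om ?_
    filter_upwards [he] with q' hq'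
    rw [C.toPair_ofPair hq']

/-- The three arrows contribute `ω_y - ω_x`, `ω_z - ω_y` and `ω_x - ω_z`, whose sum telescopes to
zero. -/
theorem pullback_cycle (hΩ : ∀ α ∈ V, om.pairForm.pullback (J := J) C.toPair α = Ω α)
    {q : M × M × M} (hq : q ∈ C.cycleDom) :
    Ω.triple.pullback (J := 𝓘(ℝ, EM).prod (𝓘(ℝ, EM).prod 𝓘(ℝ, EM))) C.cycle q = 0 := by
  have hm := (C.contMDiffOn_cycle.contMDiffAt (C.isOpen_cycleDom.mem_nhds hq)).mdifferentiableAt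
    (by simp)
  have p1 : ContMDiffAt (𝓘(ℝ, EM).prod (𝓘(ℝ, EM).prod 𝓘(ℝ, EM))) 𝓘(ℝ, EM) ∞
    (fun q : M × M × M => q.1) q := contMDiffAt_fst
  have p2 : ContMDiffAt (𝓘(ℝ, EM).prod (𝓘(ℝ, EM).prod 𝓘(ℝ, EM))) 𝓘(ℝ, EM) ∞
    (fun q : M × M × M => q.2.1) q := contMDiffAt_fst.comp q contMDiffAt_snd
  have p3 : ContMDiffAt (𝓘(ℝ, EM).prod (𝓘(ℝ, EM).prod 𝓘(ℝ, EM))) 𝓘(ℝ, EM) ∞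
    (fun q : M × M × M => q.2.2) q := contMDiffAt_snd.comp q contMDiffAt_snd
  have q2 : MDifferentiableAt (J.prod (J.prod J)) J (fun p : P × P × P => p.2.1) (C.cycle q) :=
    mdifferentiableAt_fst.comp (C.cycle q) mdifferentiableAt_snd
  have q3 : MDifferentiableAt (J.prod (J.prod J)) J (fun p : P × P × P => p.2.2) (C.cycle q) :=
    mdifferentiableAt_snd.comp (C.cycle q) mdifferentiableAt_snd
  have e1 := (DiffForm.pullback_pullback Ω (mdifferentiableAt_fst (I := J) (I' := J.prod J)) hm).trans
    (C.pullback_ofPair hΩ p1 p2 hq.1)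
  have e2 := (DiffForm.pullback_pullback Ω q2 hm).trans (C.pullback_ofPair hΩ p2 p3 hq.2.1)
  have e3 := (DiffForm.pullback_pullback Ω q3 hm).trans (C.pullback_ofPair hΩ p3 p1 hq.2.2.1)
  rw [DiffForm.triple, DiffForm.pullback_add, DiffForm.pullback_add]
  refine (congrArg₂ (· + ·) (congrArg₂ (· + ·) e1 e2) e3).trans ?_
  abel

theorem isLagrangian_threeCycles (hd : Module.finrank ℝ EP = 2 * Module.finrank ℝ EM)
    (hΩ : ∀ α ∈ V, om.pairForm.pullback (J := J) C.toPair α = Ω α) :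
    Ω.triple.IsLagrangian C.groupoid.threeCycles := by
  rw [C.threeCycles_eq]
  refine DiffForm.isLagrangian_of_leftInverse ?_ C.isOpen_cycleDom
    (C.isOpen_source.prod (C.isOpen_source.prod C.isOpen_source)) C.contMDiffOn_cycle
    C.contMDiffOn_vertices (fun q hq => C.cycle_mem hq) (fun q hq => C.vertices_cycle hq)
    fun q hq => C.pullback_cycle hΩ hq
  simp only [Module.finrank_prod]
  omega

/-- The local symplectic groupoid on `V` induced by the symplectic pair groupoid `M × M`. -/
noncomputable def symplecticGroupoid (hom : om.IsSymplecticOn univ)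
    (hd : Module.finrank ℝ EP = 2 * Module.finrank ℝ EM)
    (hΩ : ∀ α ∈ V, om.pairForm.pullback (J := J) C.toPair α = Ω α) :
    LocalSymplecticGroupoid 𝓘(ℝ, EM) M Ω V where
  toLocalLieGroupoid := C.groupoid
  symplectic := C.isSymplecticOn hom hΩ
  lagrangian_units := C.isLagrangian_range_unit hd hΩ
  antisymplectic_inv _ hα := C.pullback_inv hΩ hα
  lagrangian_threeCycles := C.isLagrangian_threeCycles hd hΩ

end PairChart

end SymplecticGroupoid

/-! ### The local symplectic groupoid on `χ(W)` -/

section Main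

variable {EM : Type*} [NormedAddCommGroup EM] [NormedSpace ℝ EM] [FiniteDimensional ℝ EM]
  {M : Type*} [TopologicalSpace M] [ChartedSpace EM M] [IsManifold 𝓘(ℝ, EM) ∞ M]
  {F : Type*} [NormedAddCommGroup F] [NormedSpace ℝ F] [FiniteDimensional ℝ F]
  {E : M → Type*} [∀ x, AddCommGroup (E x)] [∀ x, Module ℝ (E x)] [∀ x, TopologicalSpace (E x)]
  [TopologicalSpace (TotalSpace F E)] [FiberBundle F E] [VectorBundle ℝ F E]
  [ContMDiffVectorBundle ∞ F E 𝓘(ℝ, EM)]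
  {F' : Type*} [NormedAddCommGroup F'] [NormedSpace ℝ F'] [FiniteDimensional ℝ F']
  {E' : M → Type*} [∀ x, AddCommGroup (E' x)] [∀ x, Module ℝ (E' x)]
  [∀ x, TopologicalSpace (E' x)] [TopologicalSpace (TotalSpace F' E')]
  [FiberBundle F' E'] [VectorBundle ℝ F' E'] [ContMDiffVectorBundle ∞ F' E' 𝓘(ℝ, EM)]
  {om : DiffForm 𝓘(ℝ, EM) M 2} {Λ : LagrangianField om F E} {Λ' : LagrangianField om F' E'}
  {φ : DiffForm (ModelWithCorners.prod 𝓘(ℝ, EM) 𝓘(ℝ, F)) (TotalSpace F E) 1}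
  {φ' : DiffForm (ModelWithCorners.prod 𝓘(ℝ, EM) 𝓘(ℝ, F')) (TotalSpace F' E') 1}
  {c : ∀ p : TotalSpace (F × F') (E ×ᵇ E'), TangentSpace 𝓘(ℝ, EM) p.proj →L[ℝ] ℝ}
  {W : Set (TotalSpace (F × F') (E ×ᵇ E'))}

local notation "𝓚" => ModelWithCorners.prod 𝓘(ℝ, EM) 𝓘(ℝ, F × F')

theorem finrank_cotangentModel :
    Module.finrank ℝ (EM × (EM →L[ℝ] ℝ)) = 2 * Module.finrank ℝ EM := by
  rw [Module.finrank_prod,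
    ← LinearMap.toContinuousLinearMap (𝕜 := ℝ) (E := EM) (F' := ℝ) |>.finrank_eq]
  have : Module.finrank ℝ (EM →ₗ[ℝ] ℝ) = Module.finrank ℝ EM := Subspace.dual_finrank_eq
  omega

/-- With `F` the endpoint map, the chart is `F ∘ (χ|W)⁻¹` and its inverse is `χ ∘ (F|W)⁻¹`. The
statement on forms is the identity of `pullback_canonicalSymplecticForm`, pulled back once more by
`(χ|W)⁻¹`. -/
theorem IsAdmissible.exists_pairChart (hφ : Λ.IsHorizontalPrimitive φ)
    (hφ' : Λ'.IsHorizontalPrimitive φ') (hc : RepresentsDifference φ φ' c)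
    (hW : IsAdmissible Λ Λ' (covectorMap c) W) :
    ∃ C : PairChart 𝓘(ℝ, EM) M (cotangentModel EM) (covectorMap c '' W),
      (∀ p ∈ W, C.toPair (covectorMap c p) = endpointMap Λ Λ' p) ∧
      (∀ x, C.unit x = ⟨x, 0⟩) ∧
      ∀ α ∈ covectorMap c '' W,
        om.pairForm.pullback (J := cotangentModel EM) C.toPair α = canonicalSymplecticForm M α := by
  obtain ⟨-, hW2, hW3, g, hg1, hg2⟩ := hW.diffeo_chi
  obtain ⟨-, hW5, hW6, k, hk1, hk2⟩ := hW.diffeo_endpoint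
  have hFs : ContMDiff 𝓚 (𝓘(ℝ, EM).prod 𝓘(ℝ, EM)) ∞ (endpointMap Λ Λ') := contMDiff_endpointMap
  have hχs := contMDiff_covectorMap hφ hφ' hc
  have hfχ : ∀ p ∈ W, endpointMap Λ Λ' (g (covectorMap c p)) = endpointMap Λ Λ' p := fun p hp => by
    rw [hg2 p hp]
  have hzero := covectorMap_zero hφ hφ' hc
  have himg : (fun α => endpointMap Λ Λ' (g α)) '' (covectorMap c '' W) = endpointMap Λ Λ' '' W := by
    rw [image_image]
    exact image_congr hfχ
  refine ⟨{ toPair := fun α => endpointMap Λ Λ' (g α)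
            ofPair := fun q => covectorMap c (k q)
            unit := zeroSection (EM →L[ℝ] ℝ) (fun x : M => TangentSpace 𝓘(ℝ, EM) x →L[ℝ] ℝ)
            isOpen_source := hW2
            isOpen_image := himg ▸ hW5
            contMDiffOn_toPair := hFs.comp_contMDiffOn hg1
            contMDiffOn_ofPair := himg ▸ hχs.comp_contMDiffOn hk1
            ofPair_toPair := ?_
            contMDiff_unit := Bundle.contMDiff_zeroSection ℝ _
            unit_mem := fun x => ⟨⟨x, 0⟩, hW.zero_mem x, hzero x⟩
            toPair_unit := fun x => ?_ }, hfχ, fun x => rfl, ?_⟩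
  · rintro _ ⟨p, hp, rfl⟩
    simp only [hg2 p hp, hk2 p hp]
  · change endpointMap Λ Λ' (g ⟨x, 0⟩) = _
    rw [← hzero x, hfχ _ (hW.zero_mem x)]
    exact endpointMap_zero x
  · rintro _ ⟨p, hp, rfl⟩
    have hn := hW2.mem_nhds ⟨p, hp, rfl⟩
    have hgm := (hg1.contMDiffAt hn).mdifferentiableAt (by simp)
    have h1 := DiffForm.pullback_pullback (f := endpointMap Λ Λ') om.pairForm
      ((hFs _).mdifferentiableAt (by simp)) hgm
    have h2 := DiffForm.pullback_pullback (f := covectorMap c) (canonicalSymplecticForm M)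
      ((hχs _).mdifferentiableAt (by simp)) hgm
    refine h1.symm.trans (Eq.trans ?_ (h2.trans ?_))
    · exact DiffForm.pullback_eq_of_eq (pullback_canonicalSymplecticForm hφ hφ' hc _).symm
    -- `χ ∘ g` is the identity only on the open set `χ(W)`, which suffices since pullback depends on
    -- the germ.
    · refine (DiffForm.pullback_congr (g := id) _ ?_).trans (DiffForm.pullback_id _ _)
      filter_upwards [hn] with β hβ
      obtain ⟨p', hp', rfl⟩ := hβ
      simp only [Function.comp_apply, hg2 p' hp', id]

end Main

theorem mainTheorem1
    {EM : Type*} [NormedAddCommGroup EM] [NormedSpace ℝ EM] [FiniteDimensional ℝ EM]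
    {M : Type*} [TopologicalSpace M] [T2Space M] [SecondCountableTopology M]
    [ChartedSpace EM M] [IsManifold 𝓘(ℝ, EM) ∞ M]
    (om : DiffForm 𝓘(ℝ, EM) M 2) (_hsymp : om.IsSymplecticOn univ)
    {F : Type*} [NormedAddCommGroup F] [NormedSpace ℝ F] [FiniteDimensional ℝ F]
    {E : M → Type*} [∀ x, AddCommGroup (E x)] [∀ x, Module ℝ (E x)]
    [∀ x, TopologicalSpace (E x)] [TopologicalSpace (TotalSpace F E)]
    [FiberBundle F E] [VectorBundle ℝ F E] [ContMDiffVectorBundle ∞ F E 𝓘(ℝ, EM)]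
    {F' : Type*} [NormedAddCommGroup F'] [NormedSpace ℝ F'] [FiniteDimensional ℝ F']
    {E' : M → Type*} [∀ x, AddCommGroup (E' x)] [∀ x, Module ℝ (E' x)]
    [∀ x, TopologicalSpace (E' x)] [TopologicalSpace (TotalSpace F' E')]
    [FiberBundle F' E'] [VectorBundle ℝ F' E'] [ContMDiffVectorBundle ∞ F' E' 𝓘(ℝ, EM)]
    (Λ : LagrangianField om F E) (Λ' : LagrangianField om F' E')
    (_hΛ : Λ.Transversal Λ') :
    -- the horizontal primitives `φ`, `φ'` exist and are unique
    (∃! φ, Λ.IsHorizontalPrimitive φ) ∧ (∃! φ', Λ'.IsHorizontalPrimitive φ') ∧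
    ∀ φ φ', Λ.IsHorizontalPrimitive φ → Λ'.IsHorizontalPrimitive φ' →
    -- they determine the map `χ = covectorMap c`
    (∃! c, RepresentsDifference φ φ' c) ∧
    ∀ c, RepresentsDifference φ φ' c →
    -- there are arbitrarily small admissible neighbourhoods `W` of the zero section of `E ⊕ E'`,
    -- which can be chosen with symmetric image in `M × M`
    (∀ U : Set (TotalSpace (F × F') (E ×ᵇ E')), IsOpen U →
      (∀ x : M, (⟨x, 0⟩ : TotalSpace (F × F') (E ×ᵇ E')) ∈ U) →
      ∃ W, W ⊆ U ∧ IsAdmissible Λ Λ' (covectorMap c) W ∧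
        Prod.swap '' (endpointMap Λ Λ' '' W) = endpointMap Λ Λ' '' W) ∧
    -- and every admissible `W` gives a local symplectic groupoid on `V = χ(W)`
    ∀ W, IsAdmissible Λ Λ' (covectorMap c) W →
    ∀ V : Set (CotangentBundle EM M), V = covectorMap c '' W →
      IsOpen V ∧ (∀ x : M, (⟨x, 0⟩ : CotangentBundle EM M) ∈ V) ∧
      ∃ f : CotangentBundle EM M → M × M,
        (∀ p ∈ W, f (covectorMap c p) = endpointMap Λ Λ' p) ∧
        (∀ g : CotangentBundle EM M → M × M,
          (∀ p ∈ W, g (covectorMap c p) = endpointMap Λ Λ' p) → EqOn g f V) ∧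
        IsDiffeoOntoOpen (cotangentModel EM) (𝓘(ℝ, EM).prod 𝓘(ℝ, EM)) f V ∧
        (∀ x : M, f ⟨x, 0⟩ = (x, x)) ∧
        (∀ α ∈ V, om.pairForm.pullback f α = canonicalSymplecticForm M α) ∧
        (∃ G : LocalSymplecticGroupoid 𝓘(ℝ, EM) M (canonicalSymplecticForm M) V,
          (∀ α ∈ V, G.s α = (f α).2) ∧ (∀ α ∈ V, G.t α = (f α).1) ∧
          (∀ x, G.unit x = ⟨x, 0⟩) ∧
          G.mulDom = {p | p.1 ∈ V ∧ p.2 ∈ V ∧ (f p.1).2 = (f p.2).1 ∧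
            ((f p.1).1, (f p.2).2) ∈ f '' V} ∧
          G.invDom = {α | α ∈ V ∧ (f α).swap ∈ f '' V}) ∧
        ∀ α ∈ V, (f α).2 ∈ Λ.leaf α.proj ∧ (f α).1 ∈ Λ'.leaf α.proj := by
  refine ⟨?_, ?_, fun φ φ' hφ hφ' => ⟨?_, fun c hc => ⟨?_, ?_⟩⟩⟩
  · obtain ⟨φ, hφ⟩ := LagrangianField.exists_isHorizontalPrimitive _hsymp Λ
    exact ⟨φ, hφ, fun _ h => LagrangianField.IsHorizontalPrimitive.unique h hφ⟩
  · obtain ⟨φ, hφ⟩ := LagrangianField.exists_isHorizontalPrimitive _hsymp Λ'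
    exact ⟨φ, hφ, fun _ h => LagrangianField.IsHorizontalPrimitive.unique h hφ⟩
  · exact existsUnique_covector_of_horizontal (differenceForm_horizontal hφ hφ')
  · exact fun U hU hU0 => exists_isAdmissible _hsymp _hΛ hφ hφ' hc hU hU0
  · rintro W hW _ rfl
    obtain ⟨C, hC, hCu, hCΩ⟩ := hW.exists_pairChart hφ hφ' hc
    refine ⟨C.isOpen_source, fun x => hCu x ▸ C.unit_mem x, C.toPair, hC, ?_, C.isDiffeoOntoOpen,
      fun x => hCu x ▸ C.toPair_unit x, hCΩ,
      ⟨C.symplecticGroupoid _hsymp finrank_cotangentModel hCΩ, fun _ _ => rfl, fun _ _ => rfl, hCu,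
        rfl, rfl⟩, ?_⟩
    · rintro g hg _ ⟨p, hp, rfl⟩
      rw [hg p hp, hC p hp]
    · rintro _ ⟨p, hp, rfl⟩
      rw [hC p hp]
      -- `χ` preserves foot points, so the two fiber components of `p` lie over the foot point of
      -- the covector and witness membership in the two leaves.
      exact ⟨⟨p.2.1, rfl⟩, ⟨p.2.2, rfl⟩⟩
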